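/- Consider the axially symmetric Landau–Lifschitz–Gilbert–Slonczewski equation for $m(x,t)\in\mathbb S^2$, $x,t\in\mathbb R$, $$\partial_t m-\alpha\, m\times\partial_t m=-m\times\bigl(\partial_x^2m+h e_3-\mu m_3e_3\bigr)+m\times\Bigl(m\times\tfrac{\beta}{1+c_{\rm cp}m_3}e_3\Bigr).$$ A domain wall (DW) with speed $s$ and frequency $\Omega$ is a solution of the form $m=(\cos\varphi\sin\theta,\sin\varphi\sin\theta,\cos\theta)$ with $\theta=\theta(\xi)\in(0,\pi)$, $\varphi=\phi(\xi)+\Omega t$, $\xi=x-st$, whose profile $(\sin\theta,0,\cos\theta)(\xi)$ tends to $e_3$ at one end and to $-e_3$ at the other end of the real line. Put $q=\phi'$ and $p=\theta'/\sin\theta$. The DW is homogeneous if $\phi$ is constant, inhomogeneous otherwise, and flat if $|q(\xi)|$ has a limit in $\mathbb R\cup\{\infty\}$ as $\xi\to-\infty$ and as $\xi\to+\infty$. For $\mu<0$ and $c_{\rm cp}=0$ there is the explicit homogeneous DW $m_0$ with $\theta_0(\xi)=2\arctan(e^{\sqrt{-\mu}\,\xi})$, $\phi_0=0$ (so $p_0=\sqrt{-\mu}$,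 $q_0=0$), speed $s_0=\frac{\alpha h-\beta}{\sqrt{-\mu}(1+\alpha^2)}$ and frequency $\Omega_0=\frac{h+\alpha\beta}{1+\alpha^2}$. **Theorem.** Let $\alpha_0>0$, $\beta_0\ge0$, $\mu_0<0$ and $\beta_0/\alpha_0\le h_0<\beta_0/\alpha_0-2\mu_0-2\mu_0/\alpha_0^2$ (the codim-2 case), and let $P_0=(0,\alpha_0,\beta_0,h_0,\mu_0)$. Then there are an open neighbourhood $U$ of $P_0$ in $\mathbb R^5$, smooth functions $s,\Omega:U\to\mathbb R$ of the parameters $P=(c_{\rm cp},\alpha,\beta,h,\mu)$, and a family $(\theta_P,\phi_P)_{P\in U}$, smooth jointly in $(P,\xi)$, such that: 1. for every $P\in U$, $(\theta_P,\phi_P)$ is a flat DW with speed $s(P)$ and frequency $\Omega(P)$, and it is inhomogeneous if $c_{\rm cp}\ne0$ and $\beta\neq0$; 2. for $P\in U$ with $c_{\rm cp}=0$ the family consists of the explicit DWs: $s(P)=s_0(P)$, $\Omega(P)=\Omega_0(P)$, and $(\theta_P,\phi_P)$ is $m_0$ for the parameters $P$; 3. the orbits $(\theta,p,q)$ of the family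 converge, uniformly in $\xi$, to that of $m_0$ at $P_0$ as $P\to P_0$; 4. (local uniqueness) there is $\delta>0$ such that, for all $P\in U$, $(s,\Omega)(P)$ is within $\delta$ of $(s_0,\Omega_0)(P_0)$ and the orbit $(\theta,p,q)$ of the family member at $P$ is, uniformly in $\xi$, within $\delta$ of that of $m_0$ at $P_0$; and every DW for a parameter $P\in U$ with speed and frequency $(s',\Omega')$ within $\delta$ of $(s_0,\Omega_0)(P_0)$, whose orbit $(\theta,p,q)$ stays in the $\delta$-neighbourhood of the orbit of $m_0$ at $P_0$, has $(s',\Omega')=(s,\Omega)(P)$ and equals $(\theta_P,\phi_P)$ up to a translation in $\xi$ and a constant rotation of $\phi$. -/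

import Mathlib

open Filter Topology
open scoped Matrix ContDiff

namespace LLGS

/-- The parameters `(c_cp, α, β, h, μ)`, as a point of `ℝ⁵`. -/
abbrev Params : Type := ℝ × ℝ × ℝ × ℝ × ℝ

namespace Params

/-- ratio of the polarization `c_cp` -/
abbrev ccp (P : Params) : ℝ := P.1

/-- Gilbert damping `α` -/
abbrev alpha (P : Params) : ℝ := P.2.1

/-- strength `β` of the spin transfer -/
abbrev beta (P : Params) : ℝ := P.2.2.1

/-- applied field `h` -/
abbrev field (P : Params) : ℝ := P.2.2.2.1

/-- anisotropy `μ` -/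
abbrev mu (P : Params) : ℝ := P.2.2.2.2

end Params

/-- The unit vector `e₃`. -/
def e3 : Fin 3 → ℝ := ![0, 0, 1]

/-- Effective field `h_eff = ∂ₓ²m + h e₃ - μ m₃ e₃`, for the values `m` and `mxx = ∂ₓ²m`. -/
def effectiveField (P : Params) (m mxx : Fin 3 → ℝ) : Fin 3 → ℝ :=
  mxx + P.field • e3 - (P.mu * m 2) • e3

/-- Spin transfer `J = β / (1 + c_cp m₃) e₃`. -/
noncomputable def spinTransfer (P : Params) (m : Fin 3 → ℝ) : Fin 3 → ℝ :=
  (P.beta / (1 + P.ccp * m 2)) • e3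

/-- `m = m(x, t)` is a classical solution, with values in the unit sphere, of
`∂ₜm - α m × ∂ₜm = - m × h_eff + m × (m × J)` on `ℝ × ℝ`. -/
structure IsSolution (P : Params) (m : ℝ → ℝ → Fin 3 → ℝ) : Prop where
  contDiff_space : ∀ t, ContDiff ℝ 2 (fun x => m x t)
  contDiff_time : ∀ x, ContDiff ℝ 1 (fun t => m x t)
  unit : ∀ x t, m x t ⬝ᵥ m x t = 1
  equation : ∀ x t,
    deriv (fun τ => m x τ) t - P.alpha • (m x t ⨯₃ deriv (fun τ => m x τ) t) =
      -(m x t ⨯₃ effectiveField P (m x t) (iteratedDeriv 2 (fun y => m y t) x)) +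
        m x t ⨯₃ (m x t ⨯₃ spinTransfer P (m x t))

/-- The profile `(sin θ, 0, cos θ)`. -/
noncomputable def profile (θ : ℝ → ℝ) (ξ : ℝ) : Fin 3 → ℝ :=
  ![Real.sin (θ ξ), 0, Real.cos (θ ξ)]

/-- The magnetization `m(x, t)` with polar angle `θ(ξ)` and azimuth `φ(ξ) + Ω t`,
where `ξ = x - s t`. -/
noncomputable def magnetization (s Ω : ℝ) (θ φ : ℝ → ℝ) (x t : ℝ) : Fin 3 → ℝ :=
  ![Real.cos (φ (x - s * t) + Ω * t) * Real.sin (θ (x - s * t)),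
    Real.sin (φ (x - s * t) + Ω * t) * Real.sin (θ (x - s * t)),
    Real.cos (θ (x - s * t))]

/-- The pair `(θ, φ)` is a domain wall with speed `s` and frequency `Ω`: it gives a solution that
is a relative equilibrium and connects the poles `e₃` and `-e₃`, in either order. -/
structure IsDomainWall (P : Params) (s Ω : ℝ) (θ φ : ℝ → ℝ) : Prop where
  contDiff_theta : ContDiff ℝ 2 θ
  contDiff_phi : ContDiff ℝ 2 φ
  mem_Ioo : ∀ ξ, θ ξ ∈ Set.Ioo 0 Real.pi
  solution : IsSolution P (magnetization s Ω θ φ)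
  connects :
    (Tendsto (profile θ) atBot (𝓝 e3) ∧ Tendsto (profile θ) atTop (𝓝 (-e3))) ∨
    (Tendsto (profile θ) atBot (𝓝 (-e3)) ∧ Tendsto (profile θ) atTop (𝓝 e3))

/-- Local wavenumber `q = φ'`. -/
noncomputable def wavenumber (φ : ℝ → ℝ) (ξ : ℝ) : ℝ := deriv φ ξ

/-- A domain wall is homogeneous if its azimuthal profile `φ` is constant. -/
def IsHomogeneous (φ : ℝ → ℝ) : Prop := ∃ φ₀, ∀ ξ, φ ξ = φ₀

/-- A domain wall is flat if `|q|` has a limit in `ℝ ∪ {∞}` at each of the two ends. -/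
def IsFlat (φ : ℝ → ℝ) : Prop :=
  (∃ l : EReal, Tendsto (fun ξ => ((|wavenumber φ ξ| : ℝ) : EReal)) atBot (𝓝 l)) ∧
  (∃ l : EReal, Tendsto (fun ξ => ((|wavenumber φ ξ| : ℝ) : EReal)) atTop (𝓝 l))

/-- The orbit `(θ, p, q)` of a domain wall in the desingularized phase space, with
`p = θ' / sin θ` and `q = φ'`. -/
noncomputable def phase (θ φ : ℝ → ℝ) (ξ : ℝ) : ℝ × ℝ × ℝ :=
  (θ ξ, deriv θ ξ / Real.sin (θ ξ), wavenumber φ ξ)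

/-- Polar angle `θ₀(ξ) = 2 arctan (exp (√(-μ) ξ))` of the explicit homogeneous domain wall. -/
noncomputable def theta0 (P : Params) (ξ : ℝ) : ℝ :=
  2 * Real.arctan (Real.exp (Real.sqrt (-P.mu) * ξ))

/-- Azimuthal profile `φ₀ = 0` of the explicit homogeneous domain wall. -/
def phi0 (_ξ : ℝ) : ℝ := 0

/-- Speed `s₀` of the explicit homogeneous domain wall. -/
noncomputable def s0 (P : Params) : ℝ :=
  (P.alpha * P.field - P.beta) / (Real.sqrt (-P.mu) * (1 + P.alpha ^ 2))

/-- Frequency `Ω₀` of the explicit homogeneous domain wall. -/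
noncomputable def Omega0 (P : Params) : ℝ :=
  (P.field + P.alpha * P.beta) / (1 + P.alpha ^ 2)

end LLGS

/-! In the coordinate `v = log tan (θ / 2)` one has `v' = p`, `cos θ = -tanh v` and `sin θ = 1 /
cosh v`, and the equation for `m` becomes a complex Riccati equation `z' = R(z, tanh v)` for `z = p
+ i q`, where `R` is `riccati` (`isSolution_iff`). Near the explicit wall `p` is bounded away from
zero, so `v` can replace `ξ` as independent variable. A nearby wall is then a bounded solution on
the whole line of `dz/dv = R(z, tanh v) / Re z` (`IsProfile`); the explicit wall is the constant `r
= √(-μ)`, and translations and rotations have disappeared. It remains to find `(z, s, Ω)` near `(r,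
s₀, Ω₀)`.

The linearisation at the constant is `y' = (2 tanh v - a) y - (α + i)(σ - i ω / r) + g` with `a =
(s₀ / r)(α + i)`, where `σ`, `ω` are the increments of speed and frequency. Its homogeneous
solutions are the multiples of `cosh² v · exp (-a v)`, the reciprocal of `weight a`. The codim-2
hypotheses give `0 ≤ Re a < 2`. For `|Re a| < 2` this function is unbounded at both ends and the
weight is integrable, so a bounded solution is unique, and it exists exactly if the weighted
integral of the whole forcing vanishes. That is one complex condition, and `σ`, `ω` supply one free
complex constant. It can be met because the mass of the weight is `2 B(1 + a/2, 1 - a/2) ≠ 0`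
(`integral_weight_ne_zero`). The linearised problem is therefore uniquely solvable
(`eq_solutionOp_iff`), and the implicit function theorem in the space of bounded continuous
functions gives an analytic family together with local uniqueness (`exists_profile_family`).

Flatness holds because the functions with limits at both ends form a closed set, invariant under the
contraction whose fixed point is the solution. For `c_cp = 0` the explicit wall is identified by
local uniqueness. Joint smoothness in `(P, ξ)` comes from smooth dependence of solutions of an
autonomous polynomial system (`contDiffAt_solution_family`). Convergence of orbits is uniform
although the error in `v` may grow linearly in `ξ`, because `θ` hardly reacts to `v` when `|v|` is
large (`abs_polarAngle_sub_le`). Finally, `q = 0` would force a polynomial identity in `tanh v`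
which fails at `1 / c_cp` (`not_isHomogeneous_wallPhi`). -/

namespace LLGS

/-! ### Smoothness of composition operators on spaces of continuous functions -/

section Superposition

variable {K : Type*} [TopologicalSpace K] [CompactSpace K]

/-- Composition with a continuous map, as an operator on continuous functions. -/
def superposition {E F : Type*} [TopologicalSpace E] [TopologicalSpace F]
    (f : E → F) (hf : Continuous f) (γ : C(K, E)) : C(K, F) := (⟨f, hf⟩ : C(E, F)).comp γ

/-- Pointwise application of operator valued functions, as a bilinear map. -/
noncomputable def pointwiseApply (K : Type*) [TopologicalSpace K] [CompactSpace K]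
    (E F : Type*) [NormedAddCommGroup E] [NormedSpace ℝ E] [NormedAddCommGroup F]
    [NormedSpace ℝ F] : C(K, E →L[ℝ] F) →L[ℝ] C(K, E) →L[ℝ] C(K, F) :=
  LinearMap.mkContinuous₂
    (LinearMap.mk₂ ℝ (fun (A : C(K, E →L[ℝ] F)) (γ : C(K, E)) => (⟨fun k => A k (γ k), by fun_prop⟩ : C(K, F)))
      (fun _ _ _ => by ext; simp) (fun _ _ _ => by ext; simp)
      (fun _ _ _ => by ext; simp) (fun _ _ _ => by ext; simp)) 1 (by
    intro A γ
    refine (ContinuousMap.norm_le _ (by positivity)).2 fun k => ?_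
    simp only [LinearMap.mk₂_apply, ContinuousMap.coe_mk, one_mul]
    exact (ContinuousLinearMap.le_opNorm _ _).trans
      (mul_le_mul (A.norm_coe_le_norm k) (γ.norm_coe_le_norm k) (norm_nonneg (γ k)) (norm_nonneg A)))

/-- The mean value inequality is applied pointwise to `f` minus its linearisation. A bound uniform
in the point needs the derivative along the whole segment to be uniformly close to that at `γ k`. -/
theorem hasFDerivAt_superposition {E F : Type*} [NormedAddCommGroup E] [NormedSpace ℝ E]
    [NormedAddCommGroup F] [NormedSpace ℝ F] {f : E → F} (hf : ContDiff ℝ 1 f) (γ : C(K, E)) :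
    HasFDerivAt (superposition (K := K) f hf.continuous)
      (pointwiseApply K E F (superposition (fderiv ℝ f) (hf.continuous_fderiv one_ne_zero) γ)) γ := by
  -- Compactness of `K` enters here: the compact-open topology is that of the sup norm, so
  -- continuity of this map is a uniform statement.
  have hc : Continuous (superposition (K := K) (fderiv ℝ f) (hf.continuous_fderiv one_ne_zero)) :=
    ContinuousMap.continuous_postcomp _
  rw [hasFDerivAt_iff_isLittleO_nhds_zero, Asymptotics.isLittleO_iff]
  intro ε hε
  obtain ⟨δ, hδ, hball⟩ := (Metric.continuous_iff (α := C(K, E)) (β := C(K, E →L[ℝ] F))).1 hc γ ε hε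
  filter_upwards [Metric.ball_mem_nhds (0 : C(K, E)) hδ] with h hh
  rw [mem_ball_zero_iff] at hh
  refine (ContinuousMap.norm_le _ (by positivity)).2 fun k => ?_
  have key : ∀ y ∈ segment ℝ (γ k) (γ k + h k), ‖fderiv ℝ f y - fderiv ℝ f (γ k)‖ ≤ ε := by
    intro y hy
    rw [segment_eq_image'] at hy
    obtain ⟨τ, hτ, rfl⟩ := hy
    have h1 : ‖τ • h‖ < δ := by
      rw [norm_smul, Real.norm_of_nonneg hτ.1]
      exact (mul_le_of_le_one_left (norm_nonneg _) hτ.2).trans_lt hh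
    have h2 := hball (γ + τ • h) (by simpa [dist_eq_norm] using h1)
    have h3 := (ContinuousMap.dist_apply_le_dist k).trans h2.le
    rw [dist_eq_norm] at h3
    simpa [superposition] using h3
  have h4 := (convex_segment (γ k) (γ k + h k)).norm_image_sub_le_of_norm_hasFDerivWithin_le'
    (f := f) (f' := fderiv ℝ f) (φ := fderiv ℝ f (γ k))
    (fun y _ => ((hf.differentiable one_ne_zero) y).hasFDerivAt.hasFDerivWithinAt) key
    (left_mem_segment ℝ _ _) (right_mem_segment ℝ _ _)
  simp only [add_sub_cancel_left] at h4
  refine le_trans ?_ (h4.trans (mul_le_mul_of_nonneg_left (h.norm_coe_le_norm k) hε.le))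
  simp [superposition, pointwiseApply]

/-- The derivative is again a superposition operator, followed by the bounded bilinear
`pointwiseApply`, so the induction applies to `fderiv ℝ f`. Its target is `E →L[ℝ] F`, hence the
spaces are quantified inside the induction. -/
theorem contDiff_superposition (n : ℕ) : ∀ {E F : Type} [NormedAddCommGroup E] [NormedSpace ℝ E]
    [NormedAddCommGroup F] [NormedSpace ℝ F] {f : E → F} (hf : ContDiff ℝ n f),
    ContDiff ℝ n (superposition (K := K) f hf.continuous) := by
  induction n with
  | zero =>
    intro E F _ _ _ _ f hf
    exact contDiff_zero.2 (ContinuousMap.continuous_postcomp _)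
  | succ n ih =>
    intro E F _ _ _ _ f hf
    have h1 : ContDiff ℝ 1 f := hf.of_le (by exact_mod_cast Nat.le_add_left 1 n)
    have h2 : ContDiff ℝ n (fderiv ℝ f) := hf.fderiv_right (by norm_cast)
    push_cast
    rw [contDiff_succ_iff_hasFDerivAt]
    exact ⟨_, (pointwiseApply K E F).contDiff.comp (ih h2), hasFDerivAt_superposition h1⟩

end Superposition

/-! ### Smooth dependence of solutions on time and parameters -/

section Flow

variable {E : Type} [NormedAddCommGroup E] [NormedSpace ℝ E] [CompleteSpace E]

/-- The primitive `τ ↦ ∫₀^τ γ` of a curve on the unit interval. -/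
noncomputable def primitive (E : Type) [NormedAddCommGroup E] [NormedSpace ℝ E] :
    C(unitInterval, E) →L[ℝ] C(unitInterval, E) :=
  LinearMap.mkContinuous
    { toFun := fun γ => ⟨fun τ => ∫ σ in (0 : ℝ)..τ, γ (Set.projIcc 0 1 zero_le_one σ), by
        have : Continuous fun τ : ℝ => ∫ σ in (0 : ℝ)..τ, γ (Set.projIcc 0 1 zero_le_one σ) :=
          intervalIntegral.continuous_primitive
            (fun a b => (γ.continuous.comp continuous_projIcc).intervalIntegrable a b) 0
        exact this.comp continuous_subtype_val⟩
      map_add' := fun γ η => by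
        ext τ
        exact intervalIntegral.integral_add
          ((γ.continuous.comp continuous_projIcc).intervalIntegrable _ _)
          ((η.continuous.comp continuous_projIcc).intervalIntegrable _ _)
      map_smul' := fun c γ => by
        ext τ
        exact intervalIntegral.integral_smul _ _ } 1 (by
    intro γ
    refine (ContinuousMap.norm_le _ (by positivity)).2 fun τ => ?_
    have h := intervalIntegral.norm_integral_le_of_norm_le_const (a := 0) (b := (τ : ℝ)) (C := ‖γ‖)
      (f := fun σ => γ (Set.projIcc 0 1 zero_le_one σ)) (fun σ _ => γ.norm_coe_le_norm _)
    rw [sub_zero, abs_of_nonneg τ.2.1] at h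
    refine h.trans ?_
    nlinarith [norm_nonneg γ, τ.2.1, τ.2.2])

/-- The defect of a curve `γ` as a solution of `γ' = T f(γ)` with initial value `x`. -/
noncomputable def flowDefect (f : E → E) (hf : Continuous f)
    (w : (ℝ × E) × C(unitInterval, E)) : C(unitInterval, E) :=
  w.2 - ContinuousMap.const _ w.1.2 - w.1.1 • primitive E (superposition f hf w.2)

/-- Constant curves. -/
noncomputable def constCurve (E : Type) [NormedAddCommGroup E] [NormedSpace ℝ E] :
    E →L[ℝ] C(unitInterval, E) :=
  LinearMap.mkContinuous
    { toFun := fun x => ContinuousMap.const _ x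
      map_add' := fun _ _ => rfl
      map_smul' := fun _ _ => rfl } 1 (fun x => by
    simpa using (ContinuousMap.norm_le _ (norm_nonneg x)).2 fun _ => le_rfl)

/-- Time is rescaled to the unit interval, so that it becomes a parameter `T` of the equation `γ' =
T f(γ)`. At `T = 0` the nonlinear term drops out and the derivative of `flowDefect` in the curve is
the identity, so the implicit function theorem applies. The second claim is its uniqueness part:
solutions near the constant curve are values of `ψ`. -/
theorem exists_local_flow {f : E → E} {n : ℕ} (hn : n ≠ 0) (hf : ContDiff ℝ n f) (x₀ : E) :
    ∃ ψ : ℝ × E → C(unitInterval, E),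
      (∀ᶠ w in 𝓝 ((0 : ℝ), x₀), ContDiffAt ℝ n ψ w) ∧
      ∀ᶠ w in 𝓝 (((0 : ℝ), x₀), ContinuousMap.const unitInterval x₀),
        flowDefect f hf.continuous w = 0 → ψ w.1 = w.2 := by
  have hF : ContDiff ℝ n (flowDefect f hf.continuous) := by
    unfold flowDefect
    have h1 : ContDiff ℝ n fun w : (ℝ × E) × C(unitInterval, E) => constCurve E w.1.2 := by fun_prop
    have h2 : ContDiff ℝ n fun w : (ℝ × E) × C(unitInterval, E) =>
        superposition (K := unitInterval) f hf.continuous w.2 :=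
      (contDiff_superposition n hf).comp contDiff_snd
    have h3 : ContDiff ℝ n fun w : (ℝ × E) × C(unitInterval, E) =>
        primitive E (superposition (K := unitInterval) f hf.continuous w.2) :=
      (primitive E).contDiff.comp h2
    exact (contDiff_snd.sub h1).sub ((contDiff_fst.fst).smul h3)
  set u : (ℝ × E) × C(unitInterval, E) := ((0, x₀), ContinuousMap.const unitInterval x₀) with hu
  have hn' : ((n : ℕ∞) : WithTop ℕ∞) ≠ 0 := by exact_mod_cast hn
  have hcd : ContDiffAt ℝ n (flowDefect f hf.continuous) u := hF.contDiffAt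
  have hid : fderiv ℝ (flowDefect f hf.continuous) u ∘L .inr ℝ (ℝ × E) C(unitInterval, E) =
      ContinuousLinearMap.id ℝ _ := by
    have h1 : HasFDerivAt (fun γ : C(unitInterval, E) => flowDefect f hf.continuous ((0, x₀), γ))
        (fderiv ℝ (flowDefect f hf.continuous) u ∘L .inr ℝ (ℝ × E) C(unitInterval, E))
        (ContinuousMap.const unitInterval x₀) :=
      (hcd.differentiableAt hn').hasFDerivAt.comp (ContinuousMap.const unitInterval x₀)
        (hasFDerivAt_prodMk_right _ _)
    refine h1.unique ?_
    simpa [flowDefect] using (hasFDerivAt_id (𝕜 := ℝ) (ContinuousMap.const unitInterval x₀)).sub_const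
      (ContinuousMap.const unitInterval x₀)
  have hinv : (fderiv ℝ (flowDefect f hf.continuous) u ∘L
      .inr ℝ (ℝ × E) C(unitInterval, E)).IsInvertible := by
    rw [hid]; exact ContinuousLinearMap.isInvertible_equiv (f := ContinuousLinearEquiv.refl ℝ _)
  have h0 : flowDefect f hf.continuous u = 0 := by simp [flowDefect, hu]
  refine ⟨hcd.implicitFunction hn' hinv, ?_, ?_⟩
  · exact (hcd.contDiffAt_implicitFunction hn' hinv).eventually (by simp)
  · filter_upwards [hcd.eventually_apply_eq_iff_implicitFunction hn' hinv] with w hw hw0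
    exact hw.1 (hw0.trans h0.symm)

theorem flowDefect_eq_zero {f : E → E} (hf : Continuous f) {X : ℝ → E}
    (hX : ∀ ξ, HasDerivAt X (f (X ξ)) ξ) (ξ T : ℝ) (hγ : Continuous X) :
    flowDefect f hf ((T, X ξ), ⟨fun τ : unitInterval => X (ξ + τ * T), by fun_prop⟩) = 0 := by
  ext τ
  have h1 : ∀ σ ∈ Set.uIcc (0 : ℝ) τ, HasDerivAt (fun σ : ℝ => X (ξ + σ * T))
      (T • f (X (ξ + σ * T))) σ := by
    intro σ _
    have h2 : HasDerivAt (fun σ : ℝ => ξ + σ * T) T σ := by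
      simpa using ((hasDerivAt_id σ).mul_const T).const_add ξ
    exact (hX _).scomp σ h2
  have h3 := intervalIntegral.integral_eq_sub_of_hasDerivAt h1
    (Continuous.intervalIntegrable (by fun_prop) _ _)
  rw [intervalIntegral.integral_smul] at h3
  have h4 : ∫ σ in (0 : ℝ)..τ, f (X (ξ + (Set.projIcc (0 : ℝ) 1 zero_le_one σ : ℝ) * T)) =
      ∫ σ in (0 : ℝ)..τ, f (X (ξ + σ * T)) := by
    refine intervalIntegral.integral_congr fun σ hσ => ?_
    rw [Set.uIcc_of_le τ.2.1] at hσ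
    simp only [Set.projIcc_of_mem zero_le_one ⟨hσ.1, hσ.2.trans τ.2.2⟩]
  have h5 : (flowDefect f hf ((T, X ξ), ⟨fun τ : unitInterval => X (ξ + τ * T), by fun_prop⟩)) τ =
      X (ξ + τ * T) - X ξ -
        T • ∫ σ in (0 : ℝ)..τ, f (X (ξ + (Set.projIcc (0 : ℝ) 1 zero_le_one σ : ℝ) * T)) := rfl
  rw [h5, h4, h3]
  simp

variable {B : Type*} [NormedAddCommGroup B] [NormedSpace ℝ B]

/-- Near `ξ₁` the family is the endpoint of the local flow started at time `ξ₂`, so smoothness in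
`P` at time `ξ₂` becomes joint smoothness at time `ξ`. The radius is uniform in `ξ₂`, and joint
continuity of `X` is what brings the curves into the uniqueness neighbourhood. -/
theorem exists_propagation {f : E → E} {n : ℕ} (hn : n ≠ 0) (hf : ContDiff ℝ n f)
    {X : B × ℝ → E} {P₁ : B}
    (hX : ∀ᶠ P in 𝓝 P₁, ∀ ξ, HasDerivAt (fun ξ => X (P, ξ)) (f (X (P, ξ))) ξ)
    (ξ₁ : ℝ) (hc : ContinuousAt X (P₁, ξ₁)) :
    ∃ ε > 0, ∀ ξ₂, |ξ₂ - ξ₁| < ε → ContDiffAt ℝ n (fun P => X (P, ξ₂)) P₁ →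
      ∀ ξ, |ξ - ξ₁| < ε → ContDiffAt ℝ n X (P₁, ξ) := by
  obtain ⟨ψ, h1, h2⟩ := exists_local_flow hn hf (X (P₁, ξ₁))
  obtain ⟨ε₁, hε₁, H1⟩ := Metric.eventually_nhds_iff.1 h1
  obtain ⟨ε₂, hε₂, H2⟩ := Metric.eventually_nhds_iff.1 h2
  set ε₀ := min ε₁ ε₂ with hε₀
  have hε₀pos : 0 < ε₀ := lt_min hε₁ hε₂
  obtain ⟨ε₃, hε₃, H3⟩ := Metric.continuousAt_iff.1 hc (ε₀ / 2) (by positivity)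
  -- Halving keeps `|ξ - ξ₂|` below `ε₀`, hence within the range of the local flow.
  refine ⟨min ε₃ ε₀ / 2, by positivity, fun ξ₂ hξ₂ hs ξ hξ => ?_⟩
  have hm3 : min ε₃ ε₀ ≤ ε₃ := min_le_left _ _
  have hm0 : min ε₃ ε₀ ≤ ε₀ := min_le_right _ _
  have hmpos : 0 < min ε₃ ε₀ := lt_min hε₃ hε₀pos
  have hm1 : ε₀ ≤ ε₁ := min_le_left _ _
  have hm2 : ε₀ ≤ ε₂ := min_le_right _ _
  have hP : ∀ᶠ w : B × ℝ in 𝓝 (P₁, ξ), X w = ψ (w.2 - ξ₂, X (w.1, ξ₂)) 1 := by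
    have e1 : ∀ᶠ w : B × ℝ in 𝓝 (P₁, ξ),
        ∀ ξ, HasDerivAt (fun ξ => X (w.1, ξ)) (f (X (w.1, ξ))) ξ :=
      (continuousAt_fst (p := (P₁, ξ))).tendsto.eventually hX
    have e2 : ∀ᶠ w : B × ℝ in 𝓝 (P₁, ξ), dist w.1 P₁ < ε₃ :=
      (continuousAt_fst (p := (P₁, ξ))).tendsto.eventually (Metric.ball_mem_nhds P₁ hε₃)
    have e3 : ∀ᶠ w : B × ℝ in 𝓝 (P₁, ξ), |w.2 - ξ₁| < min ε₃ ε₀ / 2 :=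
      (continuousAt_snd (p := (P₁, ξ))).tendsto.eventually (Metric.isOpen_ball.mem_nhds
        (by simpa [Real.dist_eq] using hξ : ξ ∈ Metric.ball ξ₁ (min ε₃ ε₀ / 2)))
    filter_upwards [e1, e2, e3] with ⟨P, η⟩ e1 e2 e3
    simp only at e1 e2 e3 ⊢
    have hcont : Continuous fun ξ => X (P, ξ) :=
      continuous_iff_continuousAt.2 fun ξ => (e1 ξ).continuousAt
    have hclose : ∀ ζ, |ζ - ξ₁| < ε₃ → dist (X (P, ζ)) (X (P₁, ξ₁)) < ε₀ / 2 := by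
      intro ζ hζ
      exact H3 (by rw [Prod.dist_eq]; exact max_lt e2 (by simpa [Real.dist_eq] using hζ))
    have habs : |η - ξ₂| < min ε₃ ε₀ := by
      calc |η - ξ₂| ≤ |η - ξ₁| + |ξ₁ - ξ₂| := abs_sub_le _ _ _
        _ < _ := by rw [abs_sub_comm ξ₁]; linarith
    have key := H2 (y := ((η - ξ₂, X (P, ξ₂)),
        ⟨fun τ : unitInterval => X (P, ξ₂ + τ * (η - ξ₂)),
          hcont.comp (by fun_prop)⟩)) (by
      refine max_lt (max_lt ?_ ?_) ?_
      · rw [Real.dist_eq, sub_zero]; linarith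
      · exact (hclose _ (by linarith)).trans (by linarith)
      · refine lt_of_le_of_lt ((ContinuousMap.dist_le (by positivity)).2 fun τ => ?_)
          (show ε₀ / 2 < ε₂ by linarith)
        refine (hclose _ ?_).le
        have : ξ₂ + τ * (η - ξ₂) - ξ₁ = (1 - τ) * (ξ₂ - ξ₁) + τ * (η - ξ₁) := by ring
        rw [this]
        refine (abs_add_le _ _).trans_lt ?_
        rw [abs_mul, abs_mul, abs_of_nonneg τ.2.1, abs_of_nonneg (sub_nonneg.2 τ.2.2)]
        nlinarith [τ.2.1, τ.2.2, mul_le_mul_of_nonneg_left hξ₂.le (sub_nonneg.2 τ.2.2),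
          mul_le_mul_of_nonneg_left e3.le τ.2.1])
      (flowDefect_eq_zero hf.continuous e1 ξ₂ (η - ξ₂) hcont)
    rw [key]
    simp
  refine ContDiffAt.congr_of_eventuallyEq ?_ hP
  have habs : |ξ - ξ₂| < min ε₃ ε₀ := by
    calc |ξ - ξ₂| ≤ |ξ - ξ₁| + |ξ₁ - ξ₂| := abs_sub_le _ _ _
      _ < _ := by rw [abs_sub_comm ξ₁]; linarith
  have hψ : ContDiffAt ℝ n ψ (ξ - ξ₂, X (P₁, ξ₂)) := by
    refine H1 (max_lt ?_ ?_)
    · rw [Real.dist_eq, sub_zero]; linarith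
    · refine (H3 ?_).trans (by linarith)
      rw [Prod.dist_eq]
      exact max_lt (by simpa using hε₃) (by rw [Real.dist_eq]; linarith)
  have hin : ContDiffAt ℝ n (fun w : B × ℝ => (w.2 - ξ₂, X (w.1, ξ₂))) (P₁, ξ) :=
    (contDiffAt_snd.sub contDiffAt_const).prodMk
      (ContDiffAt.comp (P₁, ξ) (f := Prod.fst) (g := fun P => X (P, ξ₂)) hs contDiffAt_fst)
  exact (ContinuousMap.evalCLM ℝ (1 : unitInterval)).contDiff.contDiffAt.comp (P₁, ξ)
    (ContDiffAt.comp (P₁, ξ) hψ hin)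

/-- Solutions of an autonomous equation with smooth right hand side depend smoothly on time and
parameters if their initial values do. -/
theorem contDiffAt_solution_family {f : E → E} (hf : ContDiff ℝ ∞ f) {X : B × ℝ → E} {P₁ : B}
    (hX : ∀ᶠ P in 𝓝 P₁, ∀ ξ, HasDerivAt (fun ξ => X (P, ξ)) (f (X (P, ξ))) ξ)
    (hc : ∀ ξ, ContinuousAt X (P₁, ξ)) (h0 : ContDiffAt ℝ ∞ (fun P => X (P, 0)) P₁) (ξ : ℝ) :
    ContDiffAt ℝ ∞ X (P₁, ξ) := by
  have main : ∀ n : ℕ, n ≠ 0 → ContDiffAt ℝ n X (P₁, ξ) := by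
    intro n hn
    have hfn : ContDiff ℝ n f := hf.of_le (by exact_mod_cast le_top)
    have h0n : ContDiffAt ℝ n (fun P => X (P, 0)) P₁ := h0.of_le (by exact_mod_cast le_top)
    have slice : ∀ ζ, ContDiffAt ℝ n X (P₁, ζ) → ContDiffAt ℝ n (fun P => X (P, ζ)) P₁ :=
      fun ζ h => ContDiffAt.comp P₁ h (contDiffAt_id.prodMk contDiffAt_const)
    -- Since the radius from `exists_propagation` does not depend on the starting time, the set of
    -- good times is closed as well as open.
    have hclopen : IsClopen {ζ | ContDiffAt ℝ n X (P₁, ζ)} := by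
      constructor
      · refine isClosed_of_closure_subset fun ζ hζ => ?_
        obtain ⟨ε, hε, H⟩ := exists_propagation hn hfn hX ζ (hc ζ)
        obtain ⟨ζ₂, h2, hd⟩ := Metric.mem_closure_iff.1 hζ ε hε
        exact H ζ₂ (by rwa [dist_comm, Real.dist_eq] at hd) (slice _ h2) ζ (by simpa)
      · refine Metric.isOpen_iff.2 fun ζ hζ => ?_
        obtain ⟨ε, hε, H⟩ := exists_propagation hn hfn hX ζ (hc ζ)
        exact ⟨ε, hε, fun η hη => H ζ (by simpa) (slice _ hζ) η hη⟩
    have h00 : (0 : ℝ) ∈ {ζ | ContDiffAt ℝ n X (P₁, ζ)} := by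
      obtain ⟨ε, hε, H⟩ := exists_propagation hn hfn hX 0 (hc 0)
      exact H 0 (by simpa) h0n 0 (by simpa)
    exact Set.eq_univ_iff_forall.1 (hclopen.eq_univ ⟨0, h00⟩) ξ
  rw [contDiffAt_infty]
  intro n
  -- `main` excludes order zero, which is covered by passing to order `n + 1`.
  exact (main (n + 1) n.succ_ne_zero).of_le (by exact_mod_cast Nat.le_succ n)

end Flow

end LLGS

/-! ### The weight of the linearised equation and its total mass -/

namespace LLGS

open MeasureTheory

theorem hasDerivAt_tanh (v : ℝ) : HasDerivAt Real.tanh (1 - Real.tanh v ^ 2) v := by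
  have h := (Real.hasDerivAt_sinh v).div (Real.hasDerivAt_cosh v) (Real.cosh_pos v).ne'
  have h1 : Real.sinh / Real.cosh = Real.tanh := by
    ext x; exact (Real.tanh_eq_sinh_div_cosh x).symm
  rw [h1] at h
  refine h.congr_deriv ?_
  rw [Real.tanh_eq_sinh_div_cosh]
  have := Real.cosh_pos v
  field_simp

theorem continuous_tanh : Continuous Real.tanh :=
  continuous_iff_continuousAt.2 fun v => (hasDerivAt_tanh v).continuousAt

theorem strictMono_tanh : StrictMono Real.tanh :=
  strictMono_of_deriv_pos fun v => by
    rw [(hasDerivAt_tanh v).deriv]; linarith [Real.tanh_sq_lt_one v]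

theorem tendsto_tanh_atTop : Tendsto Real.tanh atTop (𝓝 1) := by
  refine tendsto_atTop_isLUB strictMono_tanh.monotone ?_
  have : Set.range Real.tanh = Set.Ioo (-1) 1 := by
    rw [← Set.image_univ]; exact Real.tanh_bijOn.image_eq
  rw [this]
  exact isLUB_Ioo (by norm_num)

theorem tendsto_tanh_atBot : Tendsto Real.tanh atBot (𝓝 (-1)) := by
  refine tendsto_atBot_isGLB strictMono_tanh.monotone ?_
  have : Set.range Real.tanh = Set.Ioo (-1) 1 := by
    rw [← Set.image_univ]; exact Real.tanh_bijOn.image_eq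
  rw [this]
  exact isGLB_Ioo (by norm_num)

theorem abs_tanh_lt_one (v : ℝ) : |Real.tanh v| < 1 :=
  abs_lt.2 ⟨Real.neg_one_lt_tanh v, Real.tanh_lt_one v⟩

/-- The weight `exp (a v) / cosh² v`, the reciprocal of a solution of `y' = (2 tanh - a) y`. -/
noncomputable def weight (a : ℂ) (v : ℝ) : ℂ := Complex.exp (a * v) / (Real.cosh v : ℂ) ^ 2

theorem cosh_ofReal_ne_zero (v : ℝ) : (Real.cosh v : ℂ) ≠ 0 :=
  Complex.ofReal_ne_zero.2 (Real.cosh_pos v).ne'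

theorem weight_ne_zero (a : ℂ) (v : ℝ) : weight a v ≠ 0 :=
  div_ne_zero (Complex.exp_ne_zero _) (pow_ne_zero 2 (cosh_ofReal_ne_zero v))

theorem weight_neg (a : ℂ) (v : ℝ) : weight a (-v) = weight (-a) v := by
  simp [weight]

theorem hasDerivAt_weight (a : ℂ) (v : ℝ) :
    HasDerivAt (weight a) ((a - 2 * (Real.tanh v : ℂ)) * weight a v) v := by
  have h1 : HasDerivAt (fun v : ℝ => Complex.exp (a * v)) (Complex.exp (a * v) * a) v := by
    have : HasDerivAt (fun v : ℝ => a * (v : ℂ)) a v := by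
      simpa using (Complex.ofRealCLM.hasDerivAt (x := v)).const_mul a
    exact this.cexp
  have h2 : HasDerivAt (fun v : ℝ => (Real.cosh v : ℂ)) (Real.sinh v : ℂ) v :=
    (Real.hasDerivAt_cosh v).ofReal_comp
  have h3 := h1.div (h2.pow 2) (pow_ne_zero 2 (cosh_ofReal_ne_zero v))
  refine h3.congr_deriv ?_
  have := cosh_ofReal_ne_zero v
  rw [Real.tanh_eq_sinh_div_cosh]
  simp only [weight, Complex.ofReal_div, Pi.pow_apply]
  field_simp
  push_cast
  ring

theorem continuous_weight (a : ℂ) : Continuous (weight a) :=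
  continuous_iff_continuousAt.2 fun v => (hasDerivAt_weight a v).continuousAt

theorem norm_weight (a : ℂ) (v : ℝ) : ‖weight a v‖ = Real.exp (a.re * v) / Real.cosh v ^ 2 := by
  simp [weight, Complex.norm_exp, abs_of_pos (Real.cosh_pos v), -Complex.ofReal_cosh]

/-- For `v ≤ 0` one has `cosh v ≤ exp (-v)`, while `cosh t ≥ exp (-t) / 2` for every `t`; the factor
4 is the square of this 2. The comparison makes the tail integral up to `v` proportional to the
weight at `v`. -/
theorem norm_weight_le {a : ℂ} {t v : ℝ} (hv : v ≤ 0) :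
    ‖weight a t‖ ≤ ‖weight a v‖ * (4 * Real.exp ((2 + a.re) * (t - v))) := by
  rw [norm_weight, norm_weight]
  have h1 : Real.exp (-t) / 2 ≤ Real.cosh t := by
    rw [Real.cosh_eq]; linarith [Real.exp_pos t]
  have h2 : Real.cosh v ≤ Real.exp (-v) := by
    rw [Real.cosh_eq]
    linarith [Real.exp_le_exp.2 (show v ≤ -v by linarith)]
  have h3 := Real.cosh_pos v
  have h4 := Real.cosh_pos t
  have h5 := Real.exp_pos (-t)
  rw [div_le_iff₀ (by positivity), div_mul_eq_mul_div, div_mul_eq_mul_div,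
    le_div_iff₀ (by positivity)]
  have h6 : Real.cosh v ^ 2 ≤ Real.exp (-v) ^ 2 := by gcongr
  have h7 : (Real.exp (-t) / 2) ^ 2 ≤ Real.cosh t ^ 2 := by gcongr
  have h8 : Real.exp (a.re * t) * Real.exp (-v) ^ 2 =
      Real.exp (a.re * v) * (4 * Real.exp ((2 + a.re) * (t - v))) * (Real.exp (-t) / 2) ^ 2 := by
    rw [div_pow, ← Real.exp_nat_mul, ← Real.exp_nat_mul, ← Real.exp_add]
    have : Real.exp (a.re * v) * (4 * Real.exp ((2 + a.re) * (t - v))) *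
        (Real.exp ((2 : ℕ) * -t) / 2 ^ 2) = Real.exp (a.re * v) * Real.exp ((2 + a.re) * (t - v)) *
        Real.exp ((2 : ℕ) * -t) := by ring
    rw [this, ← Real.exp_add, ← Real.exp_add]
    congr 1
    push_cast
    ring
  calc Real.exp (a.re * t) * Real.cosh v ^ 2 ≤ Real.exp (a.re * t) * Real.exp (-v) ^ 2 := by gcongr
    _ = _ := h8
    _ ≤ _ := by gcongr

theorem integrableOn_bound {a : ℂ} (ha : -2 < a.re) (v : ℝ) (C : ℝ) :
    IntegrableOn (fun t => C * (4 * Real.exp ((2 + a.re) * (t - v)))) (Set.Iic v) := by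
  refine Integrable.const_mul (Integrable.const_mul ?_ 4) C
  have h := (integrableOn_exp_mul_Iic (a := 2 + a.re) (by linarith) v).mul_const
    (Real.exp (-((2 + a.re) * v)))
  refine h.congr (Eventually.of_forall fun t => ?_)
  simp only
  rw [← Real.exp_add]
  ring_nf

theorem integral_bound {a : ℂ} (ha : -2 < a.re) (v : ℝ) (C : ℝ) :
    ∫ t in Set.Iic v, C * (4 * Real.exp ((2 + a.re) * (t - v))) = C * (4 / (2 + a.re)) := by
  have h1 : ∀ t, C * (4 * Real.exp ((2 + a.re) * (t - v))) =
      C * 4 * Real.exp (-((2 + a.re) * v)) * Real.exp ((2 + a.re) * t) := by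
    intro t
    rw [mul_assoc _ (Real.exp _), ← Real.exp_add]
    ring_nf
  simp_rw [h1]
  rw [integral_const_mul, integral_exp_mul_Iic (by linarith), mul_assoc, mul_div_assoc',
    ← Real.exp_add]
  simp
  ring

theorem norm_integral_Iic_weight_le {a : ℂ} (ha : -2 < a.re) {h : ℝ → ℂ} {v ε : ℝ} (hv : v ≤ 0)
    (hh : ∀ t ≤ v, ‖h t‖ ≤ ε) :
    ‖∫ t in Set.Iic v, weight a t * h t‖ ≤ ‖weight a v‖ * (4 / (2 + a.re)) * ε := by
  have hε : 0 ≤ ε := (norm_nonneg _).trans (hh v le_rfl)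
  have := norm_integral_le_of_norm_le (f := fun t => weight a t * h t)
    (integrableOn_bound ha v (‖weight a v‖ * ε))
    ((ae_restrict_iff' measurableSet_Iic).2 (Eventually.of_forall fun t ht => by
      rw [norm_mul]
      calc ‖weight a t‖ * ‖h t‖ ≤ (‖weight a v‖ * (4 * Real.exp ((2 + a.re) * (t - v)))) * ε :=
            mul_le_mul (norm_weight_le hv) (hh t ht) (norm_nonneg _) (by positivity)
        _ = _ := by ring))
  rw [integral_bound ha] at this
  linarith

/-- The reflection `v ↦ -v` exchanges `a` and `-a`, which reduces the right end to the left one. -/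
theorem norm_integral_Ioi_weight_le {a : ℂ} (ha : a.re < 2) {h : ℝ → ℂ} {v ε : ℝ} (hv : 0 ≤ v)
    (hh : ∀ t ≥ v, ‖h t‖ ≤ ε) :
    ‖∫ t in Set.Ioi v, weight a t * h t‖ ≤ ‖weight a v‖ * (4 / (2 - a.re)) * ε := by
  have h1 := norm_integral_Iic_weight_le (a := -a) (h := fun t => h (-t)) (v := -v) (ε := ε)
    (by simp; linarith) (by linarith) (fun t ht => hh _ (by linarith))
  rw [weight_neg, neg_neg] at h1
  rw [← neg_neg v, ← integral_comp_neg_Iic, neg_neg]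
  simp_rw [weight_neg]
  simpa [sub_eq_add_neg] using h1

theorem integrableOn_Iic_weight {a : ℂ} (ha : -2 < a.re) : IntegrableOn (weight a) (Set.Iic 0) := by
  refine Integrable.mono' (integrableOn_bound ha 0 ‖weight a 0‖)
    (continuous_weight a).aestronglyMeasurable.restrict
    ((ae_restrict_iff' measurableSet_Iic).2 (Eventually.of_forall fun t _ => ?_))
  exact norm_weight_le le_rfl

theorem integrable_weight {a : ℂ} (h1 : -2 < a.re) (h2 : a.re < 2) : Integrable (weight a) := by
  have h3 : IntegrableOn (weight a) (Set.Ioi 0) := by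
    have h4 : IntegrableOn (weight (-a)) (Set.Iic 0) := integrableOn_Iic_weight (by simp; linarith)
    have h5 := (integrableOn_Iic_iff_integrableOn_Iio).1 h4
    have h6 := (Measure.measurePreserving_neg (volume : Measure ℝ)).integrableOn_comp_preimage
      (Homeomorph.neg ℝ).measurableEmbedding (f := weight (-a)) (s := Set.Iio 0)
    have h7 := h6.2 h5
    have h8 : weight (-a) ∘ Neg.neg = weight a := by ext v; simp [weight_neg]
    rw [h8] at h7
    simpa using h7
  have := (integrableOn_Iic_weight h1).union h3
  rwa [Set.Iic_union_Ioi, integrableOn_univ] at this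

/-- The total mass of the weight is a value of the Beta function. -/
theorem integral_weight_eq {a : ℂ} :
    ∫ v, weight a v = 2 * Complex.betaIntegral (1 + a / 2) (1 - a / 2) := by
  -- The substitution `x = (1 + tanh v) / 2` maps the line onto `(0, 1)`. There `x / (1 - x) = exp
  -- (2 v)`, so `x ^ (a/2) * (1 - x) ^ (-a/2) = exp (a v)`, and `dx = dv / (2 cosh² v)`.
  set f : ℝ → ℝ := fun v => (1 + Real.tanh v) / 2 with hf
  have himg : f '' Set.univ = Set.Ioo 0 1 := by
    ext x
    constructor
    · rintro ⟨v, -, rfl⟩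
      constructor <;> simp only [hf] <;> linarith [Real.neg_one_lt_tanh v, Real.tanh_lt_one v]
    · intro hx
      obtain ⟨v, -, hv⟩ := Real.tanh_surjOn (show 2 * x - 1 ∈ Set.Ioo (-1) 1 by
        constructor <;> linarith [hx.1, hx.2])
      exact ⟨v, trivial, by simp only [hf, hv]; ring⟩
  have hderiv : ∀ v ∈ Set.univ, HasDerivWithinAt f ((1 - Real.tanh v ^ 2) / 2) Set.univ v :=
    fun v _ => (((hasDerivAt_tanh v).const_add 1).div_const 2).hasDerivWithinAt
  have hinj : Set.InjOn f Set.univ := fun v _ w _ h => by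
    simp only [hf] at h
    exact strictMono_tanh.injective (by linarith)
  have key := integral_image_eq_integral_abs_deriv_smul MeasurableSet.univ hderiv hinj
    (fun x : ℝ => (x : ℂ) ^ ((1 + a / 2) - 1) * (1 - (x : ℂ)) ^ ((1 - a / 2) - 1))
  rw [Complex.betaIntegral, intervalIntegral.integral_of_le zero_le_one,
    integral_Ioc_eq_integral_Ioo, ← himg, key, Measure.restrict_univ, ← integral_const_mul]
  refine integral_congr_ae (Eventually.of_forall fun v => ?_)
  simp only
  have hc := Real.cosh_pos v
  have hfv : f v = Real.exp v / (2 * Real.cosh v) := by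
    simp only [hf]
    rw [Real.tanh_eq_sinh_div_cosh, ← Real.cosh_add_sinh]
    field_simp
  have h1fv : 1 - f v = Real.exp (-v) / (2 * Real.cosh v) := by
    simp only [hf]
    rw [Real.tanh_eq_sinh_div_cosh, ← Real.cosh_sub_sinh]
    field_simp
    ring
  have hlog : ∀ x b, (((Real.exp x / (2 * Real.cosh v) : ℝ) : ℂ)) ^ (b : ℂ) =
      Complex.exp ((x - Real.log (2 * Real.cosh v)) * b) := by
    intro x b
    have hp : Real.exp x / (2 * Real.cosh v) ≠ 0 := by positivity
    rw [Complex.cpow_def_of_ne_zero (by exact_mod_cast hp), ← Complex.ofReal_log (by positivity),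
      Real.log_div (by positivity) (by positivity), Real.log_exp]
    push_cast
    ring_nf
  have e1 : (1 : ℂ) - (f v : ℂ) = ((1 - f v : ℝ) : ℂ) := by push_cast; ring
  rw [e1, h1fv, hfv, hlog, hlog, ← Complex.exp_add, abs_of_pos (by
    linarith [Real.tanh_sq_lt_one v])]
  have e2 : ((v : ℂ) - Real.log (2 * Real.cosh v)) * (1 + a / 2 - 1) +
      (((-v : ℝ) : ℂ) - Real.log (2 * Real.cosh v)) * (1 - a / 2 - 1) = a * v := by
    push_cast; ring
  rw [e2, weight]
  have e3 : (1 - Real.tanh v ^ 2) / 2 = 1 / (2 * Real.cosh v ^ 2) := by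
    rw [Real.tanh_eq_sinh_div_cosh]
    have := Real.cosh_sq v
    field_simp
    linarith
  rw [e3, Complex.real_smul]
  have := cosh_ofReal_ne_zero v
  rw [Complex.ofReal_div, Complex.ofReal_mul, Complex.ofReal_pow]
  push_cast
  push_cast at this
  field_simp

/-- The weight is complex, so cancellation has to be excluded: the Beta value is a quotient of Gamma
values at arguments with positive real part, where Gamma has no zeros. -/
theorem integral_weight_ne_zero {a : ℂ} (h1 : -2 < a.re) (h2 : a.re < 2) :
    ∫ v, weight a v ≠ 0 := by
  rw [integral_weight_eq]
  have hu : 0 < (1 + a / 2).re := by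
    have : (a / 2).re = a.re / 2 := by simp
    rw [Complex.add_re, this]; simp; linarith
  have hv : 0 < (1 - a / 2).re := by
    have : (a / 2).re = a.re / 2 := by simp
    rw [Complex.sub_re, this]; simp; linarith
  have h := Complex.Gamma_mul_Gamma_eq_betaIntegral hu hv
  refine mul_ne_zero two_ne_zero fun h0 => ?_
  rw [h0, mul_zero] at h
  exact mul_ne_zero (Complex.Gamma_ne_zero_of_re_pos hu) (Complex.Gamma_ne_zero_of_re_pos hv) h

end LLGS

/-! ### Bounded solutions of the linear equation -/

namespace LLGS

open MeasureTheory BoundedContinuousFunction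

section LinearEquation

variable {a : ℂ}

theorem integrable_weight_mul (h1 : -2 < a.re) (h2 : a.re < 2) (g : ℝ →ᵇ ℂ) :
    Integrable fun v => weight a v * g v :=
  (integrable_weight h1 h2).mul_bdd (c := ‖g‖) g.continuous.aestronglyMeasurable
    (Eventually.of_forall g.norm_coe_le_norm)

theorem integral_Iic_eq_neg_integral_Ioi {f : ℝ → ℂ} (hf : Integrable f) (h0 : ∫ v, f v = 0)
    (v : ℝ) : ∫ t in Set.Iic v, f t = -∫ t in Set.Ioi v, f t := by
  have := intervalIntegral.integral_Iic_add_Ioi (b := v) hf.integrableOn hf.integrableOn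
  rw [h0] at this
  exact eq_neg_of_add_eq_zero_left this

theorem hasDerivAt_integral_Iic {f : ℝ → ℂ} (hf : Integrable f) (hc : Continuous f) (v : ℝ) :
    HasDerivAt (fun v => ∫ t in Set.Iic v, f t) (f v) v := by
  have h : (fun v => ∫ t in Set.Iic v, f t) =
      fun v => (∫ t in Set.Iic (0 : ℝ), f t) + ∫ t in (0 : ℝ)..v, f t := by
    ext w
    rw [← intervalIntegral.integral_Iic_sub_Iic hf.integrableOn hf.integrableOn]
    ring
  rw [h]
  exact (hc.integral_hasStrictDerivAt 0 v).hasDerivAt.const_add _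

/-- The weighted mean of a bounded function. -/
noncomputable def weightedMean (a : ℂ) (g : ℝ → ℂ) : ℂ :=
  (∫ v, weight a v * g v) / ∫ v, weight a v

/-- The solution of `y' = (2 tanh - a) y + g` which is bounded at `-∞`. -/
noncomputable def particularSolution (a : ℂ) (g : ℝ → ℂ) (v : ℝ) : ℂ :=
  (weight a v)⁻¹ * ∫ t in Set.Iic v, weight a t * g t

theorem norm_inv_weight_mul_le {v : ℝ} {x : ℂ} {C ε : ℝ} (h : ‖x‖ ≤ ‖weight a v‖ * C * ε) :
    ‖(weight a v)⁻¹ * x‖ ≤ C * ε := by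
  have hw : 0 < ‖weight a v‖ := norm_pos_iff.2 (weight_ne_zero a v)
  rw [norm_mul, norm_inv, inv_mul_le_iff₀ hw]
  linarith

theorem norm_particularSolution_le_left (h1 : -2 < a.re) {g : ℝ → ℂ} {v ε : ℝ} (hv : v ≤ 0)
    (hg : ∀ t ≤ v, ‖g t‖ ≤ ε) : ‖particularSolution a g v‖ ≤ 4 / (2 + a.re) * ε :=
  norm_inv_weight_mul_le (norm_integral_Iic_weight_le h1 hv hg)

/-- With zero weighted integral the solution can also be written as minus the integral over the
right tail, which stays under control as `v → ∞`. -/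
theorem norm_particularSolution_le_right (h1 : -2 < a.re) (h2 : a.re < 2) {g : ℝ →ᵇ ℂ}
    (h0 : ∫ v, weight a v * g v = 0) {v ε : ℝ} (hv : 0 ≤ v)
    (hg : ∀ t ≥ v, ‖g t‖ ≤ ε) : ‖particularSolution a g v‖ ≤ 4 / (2 - a.re) * ε := by
  rw [particularSolution, integral_Iic_eq_neg_integral_Ioi (integrable_weight_mul h1 h2 g) h0]
  exact norm_inv_weight_mul_le (by rw [norm_neg]; exact norm_integral_Ioi_weight_le h2 hv hg)

theorem norm_particularSolution_le (h1 : -2 < a.re) (h2 : a.re < 2) {g : ℝ →ᵇ ℂ}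
    (h0 : ∫ v, weight a v * g v = 0) (v : ℝ) :
    ‖particularSolution a g v‖ ≤ (4 / (2 + a.re) + 4 / (2 - a.re)) * ‖g‖ := by
  have p1 : 0 ≤ 4 / (2 + a.re) * ‖g‖ := by
    have : 0 < 2 + a.re := by linarith
    positivity
  have p2 : 0 ≤ 4 / (2 - a.re) * ‖g‖ := by
    have : 0 < 2 - a.re := by linarith
    positivity
  rcases le_total v 0 with hv | hv
  · have := norm_particularSolution_le_left h1 hv (fun t _ => g.norm_coe_le_norm t)
    linarith
  · have := norm_particularSolution_le_right h1 h2 h0 hv (fun t _ => g.norm_coe_le_norm t)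
    linarith

theorem hasDerivAt_particularSolution (h1 : -2 < a.re) (h2 : a.re < 2) (g : ℝ →ᵇ ℂ) (v : ℝ) :
    HasDerivAt (particularSolution a g)
      ((2 * (Real.tanh v : ℂ) - a) * particularSolution a g v + g v) v := by
  have h3 := (hasDerivAt_weight a v).inv (weight_ne_zero a v)
  have h4 := hasDerivAt_integral_Iic (integrable_weight_mul h1 h2 g)
    ((continuous_weight a).mul g.continuous) v
  refine (h3.mul h4).congr_deriv ?_
  have := weight_ne_zero a v
  simp only [particularSolution, Pi.inv_apply]
  field_simp
  ring

theorem weightedMean_add (h1 : -2 < a.re) (h2 : a.re < 2) (g h : ℝ →ᵇ ℂ) :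
    weightedMean a (g + h : ℝ →ᵇ ℂ) = weightedMean a g + weightedMean a h := by
  simp only [weightedMean, BoundedContinuousFunction.coe_add, Pi.add_apply, mul_add]
  rw [integral_add (integrable_weight_mul h1 h2 g) (integrable_weight_mul h1 h2 h), add_div]

theorem weightedMean_smul (c : ℝ) (g : ℝ →ᵇ ℂ) :
    weightedMean a (c • g : ℝ →ᵇ ℂ) = c • weightedMean a g := by
  simp only [weightedMean, BoundedContinuousFunction.coe_smul, mul_smul_comm]
  rw [integral_smul, smul_div_assoc]

theorem norm_weightedMean_le (h1 : -2 < a.re) (h2 : a.re < 2) (g : ℝ →ᵇ ℂ) :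
    ‖weightedMean a g‖ ≤ (∫ v, ‖weight a v‖) / ‖∫ v, weight a v‖ * ‖g‖ := by
  rw [weightedMean, norm_div, div_mul_eq_mul_div]
  gcongr
  rw [← integral_mul_const]
  refine norm_integral_le_of_norm_le ((integrable_weight h1 h2).norm.mul_const _)
    (Eventually.of_forall fun v => ?_)
  rw [norm_mul]
  gcongr
  exact g.norm_coe_le_norm v

/-- The weighted mean as a bounded linear functional. -/
noncomputable def meanCLM (h1 : -2 < a.re) (h2 : a.re < 2) : (ℝ →ᵇ ℂ) →L[ℝ] ℂ :=
  LinearMap.mkContinuous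
    { toFun := fun g => weightedMean a g
      map_add' := weightedMean_add h1 h2
      map_smul' := weightedMean_smul } _ (norm_weightedMean_le h1 h2)

/-- A bounded function minus its weighted mean. -/
noncomputable def centered (a : ℂ) (g : ℝ →ᵇ ℂ) : ℝ →ᵇ ℂ :=
  g - BoundedContinuousFunction.const ℝ (weightedMean a g)

theorem integral_weight_mul_centered (h1 : -2 < a.re) (h2 : a.re < 2) (g : ℝ →ᵇ ℂ) :
    ∫ v, weight a v * centered a g v = 0 := by
  have h : ∀ v, weight a v * centered a g v =
      weight a v * g v - weight a v * weightedMean a g := by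
    intro v; simp [centered, mul_sub]
  simp_rw [h]
  rw [integral_sub (integrable_weight_mul h1 h2 g) ((integrable_weight h1 h2).mul_const _),
    integral_mul_const, weightedMean, mul_div_cancel₀ _ (integral_weight_ne_zero h1 h2), sub_self]

theorem centered_add (h1 : -2 < a.re) (h2 : a.re < 2) (g h : ℝ →ᵇ ℂ) :
    centered a (g + h) = centered a g + centered a h := by
  rw [centered, weightedMean_add h1 h2 g h, centered, centered]
  ext v
  simp
  ring

theorem centered_smul (c : ℝ) (g : ℝ →ᵇ ℂ) : centered a (c • g) = c • centered a g := by
  rw [centered, weightedMean_smul c g, centered]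
  ext v
  simp
  ring

theorem norm_centered_le (h1 : -2 < a.re) (h2 : a.re < 2) (g : ℝ →ᵇ ℂ) :
    ‖centered a g‖ ≤ (1 + (∫ v, ‖weight a v‖) / ‖∫ v, weight a v‖) * ‖g‖ := by
  have h3 : ‖BoundedContinuousFunction.const ℝ (weightedMean a g)‖ ≤ ‖weightedMean a g‖ :=
    BoundedContinuousFunction.norm_const_le _
  have := norm_weightedMean_le h1 h2 g
  refine (norm_sub_le _ _).trans ?_
  linarith

theorem particularSolution_add (h1 : -2 < a.re) (h2 : a.re < 2) (g h : ℝ →ᵇ ℂ) (v : ℝ) :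
    particularSolution a (g + h : ℝ →ᵇ ℂ) v =
      particularSolution a g v + particularSolution a h v := by
  simp only [particularSolution, BoundedContinuousFunction.coe_add, Pi.add_apply, mul_add]
  rw [integral_add (integrable_weight_mul h1 h2 g).integrableOn
    (integrable_weight_mul h1 h2 h).integrableOn, mul_add]

theorem particularSolution_smul (c : ℝ) (g : ℝ →ᵇ ℂ) (v : ℝ) :
    particularSolution a (c • g : ℝ →ᵇ ℂ) v = c • particularSolution a g v := by
  simp only [particularSolution, BoundedContinuousFunction.coe_smul, mul_smul_comm]
  rw [integral_smul, mul_smul_comm]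

/-- The bounded solution of `y' = (2 tanh - a) y + g - k`, where `k` is the weighted mean of `g`. -/
noncomputable def boundedSolution (h1 : -2 < a.re) (h2 : a.re < 2) :
    (ℝ →ᵇ ℂ) →L[ℝ] (ℝ →ᵇ ℂ) :=
  LinearMap.mkContinuous
    { toFun := fun g => BoundedContinuousFunction.ofNormedAddCommGroup
        (particularSolution a (centered a g))
        (continuous_iff_continuousAt.2 fun v =>
          (hasDerivAt_particularSolution h1 h2 _ v).continuousAt) _
        (norm_particularSolution_le h1 h2 (integral_weight_mul_centered h1 h2 g))
      map_add' := fun g h => by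
        ext v
        simp only [centered_add h1 h2]
        exact particularSolution_add h1 h2 _ _ v
      map_smul' := fun c g => by
        ext v
        simp only [centered_smul]
        exact particularSolution_smul c _ v }
    ((4 / (2 + a.re) + 4 / (2 - a.re)) * (1 + (∫ v, ‖weight a v‖) / ‖∫ v, weight a v‖)) (by
      intro g
      have p1 : 0 ≤ 4 / (2 + a.re) + 4 / (2 - a.re) := by
        have : 0 < 2 - a.re := by linarith
        have : 0 < 2 + a.re := by linarith
        positivity
      have p2 : 0 ≤ (∫ v, ‖weight a v‖) / ‖∫ v, weight a v‖ := by positivity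
      refine (BoundedContinuousFunction.norm_le (by positivity)).2 fun v => ?_
      refine (norm_particularSolution_le h1 h2 (integral_weight_mul_centered h1 h2 g) v).trans ?_
      rw [mul_assoc]
      exact mul_le_mul_of_nonneg_left (norm_centered_le h1 h2 g) p1)

theorem boundedSolution_apply (h1 : -2 < a.re) (h2 : a.re < 2) (g : ℝ →ᵇ ℂ) (v : ℝ) :
    boundedSolution h1 h2 g v = particularSolution a (centered a g) v := rfl

theorem hasDerivAt_boundedSolution (h1 : -2 < a.re) (h2 : a.re < 2) (g : ℝ →ᵇ ℂ) (v : ℝ) :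
    HasDerivAt (boundedSolution h1 h2 g)
      ((2 * (Real.tanh v : ℂ) - a) * boundedSolution h1 h2 g v + g v - meanCLM h1 h2 g) v := by
  refine (hasDerivAt_particularSolution h1 h2 (centered a g) v).congr_deriv ?_
  rw [boundedSolution_apply]
  have : meanCLM h1 h2 g = weightedMean a g := rfl
  simp [centered, this]
  ring

theorem tendsto_weight_atBot (h1 : -2 < a.re) : Tendsto (weight a) atBot (𝓝 0) := by
  rw [tendsto_zero_iff_norm_tendsto_zero]
  have h3 : Tendsto (fun t : ℝ => ‖weight a 0‖ * (4 * Real.exp ((2 + a.re) * (t - 0)))) atBot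
      (𝓝 (‖weight a 0‖ * (4 * 0))) := by
    refine ((Real.tendsto_exp_atBot.comp ?_).const_mul 4).const_mul _
    simp only [sub_zero]
    exact tendsto_id.const_mul_atBot (by linarith)
  rw [mul_zero, mul_zero] at h3
  exact squeeze_zero' (Eventually.of_forall fun _ => norm_nonneg _)
    (Eventually.of_forall fun t => norm_weight_le le_rfl) h3

theorem tendsto_weight_atTop (h2 : a.re < 2) : Tendsto (weight a) atTop (𝓝 0) := by
  have h3 := (tendsto_weight_atBot (a := -a) (by simp; linarith)).comp tendsto_neg_atTop_atBot
  refine h3.congr fun v => ?_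
  simp [weight_neg]

/-- A bounded solution of the linear equation is the one provided by `boundedSolution`. -/
theorem eq_boundedSolution (h1 : -2 < a.re) (h2 : a.re < 2) {g y : ℝ →ᵇ ℂ} {k : ℂ}
    (hy : ∀ v, HasDerivAt y ((2 * (Real.tanh v : ℂ) - a) * y v + g v - k) v) :
    y = boundedSolution h1 h2 g ∧ k = meanCLM h1 h2 g := by
  -- The weight is an integrating factor, and `weight a * y` vanishes at both ends because `y` is
  -- bounded. Integration over the line determines `k`, integration up to `v` determines `y`.
  have hd : ∀ v, HasDerivAt (fun v => weight a v * y v) (weight a v * (g v - k)) v := by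
    intro v
    refine ((hasDerivAt_weight a v).mul (hy v)).congr_deriv ?_
    ring
  have hbd : ∀ {l : Filter ℝ}, Tendsto (weight a) l (𝓝 0) →
      Tendsto (fun v => weight a v * y v) l (𝓝 0) := fun hl =>
    hl.zero_mul_isBoundedUnder_le (isBoundedUnder_of ⟨‖y‖, fun v => y.norm_coe_le_norm v⟩)
  have hint : Integrable fun v => weight a v * (g v - k) := by
    have := (integrable_weight_mul h1 h2 g).sub ((integrable_weight h1 h2).mul_const k)
    refine this.congr (Eventually.of_forall fun v => ?_)
    simp only [Pi.sub_apply]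
    ring
  have hk : k = weightedMean a g := by
    have h3 := integral_of_hasDerivAt_of_tendsto hd hint (hbd (tendsto_weight_atBot h1))
      (hbd (tendsto_weight_atTop h2))
    simp_rw [mul_sub] at h3
    rw [integral_sub (integrable_weight_mul h1 h2 g) ((integrable_weight h1 h2).mul_const _),
      integral_mul_const, sub_zero, sub_eq_zero] at h3
    rw [weightedMean, h3, mul_div_cancel_left₀ _ (integral_weight_ne_zero h1 h2)]
  refine ⟨?_, hk⟩
  ext v
  have h3 := integral_Iic_of_hasDerivAt_of_tendsto' (a := v) (fun t _ => hd t) hint.integrableOn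
    (hbd (tendsto_weight_atBot h1))
  rw [sub_zero] at h3
  have h4 : ∀ t, centered a g t = g t - k := fun t => by simp [centered, hk]
  simp only [boundedSolution_apply, particularSolution, h4]
  rw [h3, inv_mul_cancel_left₀ (weight_ne_zero a v)]

/-- The hyperbolic tangent as a bounded continuous function. -/
noncomputable def tanhBCF : ℝ →ᵇ ℂ :=
  BoundedContinuousFunction.ofNormedAddCommGroup (fun v => (Real.tanh v : ℂ))
    (Complex.continuous_ofReal.comp continuous_tanh) 1
    (fun v => by simpa [-Complex.ofReal_tanh] using (abs_tanh_lt_one v).le)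

@[simp]
theorem tanhBCF_apply (v : ℝ) : tanhBCF v = (Real.tanh v : ℂ) := rfl

/-- The function has limits at both ends of the real line. -/
def HasLimits (y : ℝ → ℂ) : Prop :=
  (∃ l, Tendsto y atBot (𝓝 l)) ∧ ∃ l, Tendsto y atTop (𝓝 l)

/-- The logarithmic derivative `a - 2 tanh` of the weight. -/
noncomputable def logWeight (a : ℂ) : ℝ →ᵇ ℂ :=
  BoundedContinuousFunction.const ℝ a - (2 : ℝ) • tanhBCF

theorem logWeight_apply (v : ℝ) : logWeight a v = a - 2 * (Real.tanh v : ℂ) := by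
  simp [logWeight]

theorem hasDerivAt_weight' (v : ℝ) :
    HasDerivAt (weight a) (weight a v * logWeight a v) v := by
  rw [logWeight_apply, mul_comm]; exact hasDerivAt_weight a v

/-- The constant 1 solves the equation with forcing `a - 2 tanh`. Subtracting a multiple of this
forcing therefore shifts a solution by a constant. -/
theorem particularSolution_logWeight (h1 : -2 < a.re) (h2 : a.re < 2) (v : ℝ) :
    particularSolution a (logWeight a) v = 1 := by
  rw [particularSolution, integral_Iic_of_hasDerivAt_of_tendsto' (fun t _ => hasDerivAt_weight' t)
    (integrable_weight_mul h1 h2 (logWeight a)).integrableOn (tendsto_weight_atBot h1), sub_zero,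
    inv_mul_cancel₀ (weight_ne_zero a v)]

theorem integral_weight_mul_logWeight (h1 : -2 < a.re) (h2 : a.re < 2) :
    ∫ v, weight a v * logWeight a v = 0 := by
  rw [integral_of_hasDerivAt_of_tendsto hasDerivAt_weight' (integrable_weight_mul h1 h2 _)
    (tendsto_weight_atBot h1) (tendsto_weight_atTop h2), sub_zero]

theorem particularSolution_sub_mul_logWeight (h1 : -2 < a.re) (h2 : a.re < 2) (g : ℝ →ᵇ ℂ)
    (c : ℂ) (v : ℝ) :
    particularSolution a (g - BoundedContinuousFunction.const ℝ c * logWeight a : ℝ →ᵇ ℂ) v =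
      particularSolution a g v - c := by
  have h3 : ∀ t, weight a t * (g - BoundedContinuousFunction.const ℝ c * logWeight a : ℝ →ᵇ ℂ) t =
      weight a t * g t - c * (weight a t * logWeight a t) := by
    intro t; simp; ring
  have h4 := particularSolution_logWeight h1 h2 v
  rw [particularSolution] at h4 ⊢
  simp_rw [h3]
  rw [integral_sub (integrable_weight_mul h1 h2 g).integrableOn
    ((integrable_weight_mul h1 h2 _).const_mul c).integrableOn, integral_const_mul, mul_sub,
    mul_left_comm, h4, particularSolution, mul_one]

/-- At each end a constant is subtracted from the solution so that the new forcing tends to zero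
there; the one-sided bounds then show that the shifted solution tends to zero too. -/
theorem hasLimits_particularSolution (h1 : -2 < a.re) (h2 : a.re < 2) {g : ℝ →ᵇ ℂ}
    (h0 : ∫ v, weight a v * g v = 0) (hg : HasLimits g) : HasLimits (particularSolution a g) := by
  obtain ⟨⟨l, hl⟩, ⟨l', hl'⟩⟩ := hg
  have hsub : ∀ (c : ℂ) {L : Filter ℝ} {e x : ℂ}, Tendsto (logWeight a) L (𝓝 e) → e ≠ 0 →
      c = x / e → Tendsto g L (𝓝 x) →
      Tendsto (g - BoundedContinuousFunction.const ℝ c * logWeight a : ℝ →ᵇ ℂ) L (𝓝 0) := by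
    intro c L e x he he0 hc hx
    have := hx.sub (he.const_mul c)
    rw [hc, div_mul_cancel₀ _ he0, sub_self] at this
    refine this.congr fun v => ?_
    simp [hc]
  have hre : ∀ {c : ℂ} {L : Filter ℝ}, Tendsto (particularSolution a
      (g - BoundedContinuousFunction.const ℝ c * logWeight a : ℝ →ᵇ ℂ)) L (𝓝 0) →
      Tendsto (particularSolution a g) L (𝓝 c) := by
    intro c L h
    have := h.add_const c
    rw [zero_add] at this
    refine this.congr fun v => ?_
    rw [particularSolution_sub_mul_logWeight h1 h2]
    ring
  -- The forcing `a - 2 tanh` tends to `a + 2` and `a - 2`, both nonzero as `|Re a| < 2`, so these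
  -- quotients are the limits of the solution.
  refine ⟨⟨l / (a + 2), hre ?_⟩, ⟨l' / (a - 2), hre ?_⟩⟩
  · have hlw : Tendsto (logWeight a) atBot (𝓝 (a + 2)) := by
      have := (((Complex.continuous_ofReal.tendsto _).comp tendsto_tanh_atBot).const_mul
        (2 : ℂ)).const_sub a
      refine (this.congr fun v => (logWeight_apply v).symm).trans_eq ?_
      congr 1; push_cast; ring
    have hne : a + 2 ≠ 0 := fun h => by
      have := congrArg Complex.re h; simp at this; linarith
    have h3 := hsub _ hlw hne rfl hl
    have hpos : 0 < 4 / (2 + a.re) := div_pos four_pos (by linarith)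
    rw [NormedAddGroup.tendsto_nhds_zero] at h3 ⊢
    intro ε hε
    have h4 := h3 (ε / 2 / (4 / (2 + a.re))) (by positivity)
    obtain ⟨v₀, hv₀⟩ := eventually_atBot.1 h4
    filter_upwards [eventually_le_atBot (min v₀ 0)] with v hv
    have := norm_particularSolution_le_left h1 (hv.trans (min_le_right _ _))
      (fun t ht => (hv₀ t (ht.trans (hv.trans (min_le_left _ _)))).le)
    rw [mul_div_cancel₀ _ hpos.ne'] at this
    linarith
  · have hlw : Tendsto (logWeight a) atTop (𝓝 (a - 2)) := by
      have := (((Complex.continuous_ofReal.tendsto _).comp tendsto_tanh_atTop).const_mul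
        (2 : ℂ)).const_sub a
      refine (this.congr fun v => (logWeight_apply v).symm).trans_eq ?_
      congr 1; push_cast; ring
    have hne : a - 2 ≠ 0 := fun h => by
      have := congrArg Complex.re h; simp at this; linarith
    have h3 := hsub _ hlw hne rfl hl'
    have hpos : 0 < 4 / (2 - a.re) := div_pos four_pos (by linarith)
    have hint : ∫ v, weight a v * (g - BoundedContinuousFunction.const ℝ (l' / (a - 2)) *
        logWeight a : ℝ →ᵇ ℂ) v = 0 := by
      have h5 : ∀ t, weight a t * (g - BoundedContinuousFunction.const ℝ (l' / (a - 2)) *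
          logWeight a : ℝ →ᵇ ℂ) t =
          weight a t * g t - (l' / (a - 2)) * (weight a t * logWeight a t) := by
        intro t; simp; ring
      simp_rw [h5]
      rw [integral_sub (integrable_weight_mul h1 h2 g)
        ((integrable_weight_mul h1 h2 _).const_mul _), integral_const_mul, h0,
        integral_weight_mul_logWeight h1 h2, mul_zero, sub_zero]
    rw [NormedAddGroup.tendsto_nhds_zero] at h3 ⊢
    intro ε hε
    have h4 := h3 (ε / 2 / (4 / (2 - a.re))) (by positivity)
    obtain ⟨v₀, hv₀⟩ := eventually_atTop.1 h4
    filter_upwards [eventually_ge_atTop (max v₀ 0)] with v hv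
    have := norm_particularSolution_le_right h1 h2 hint ((le_max_right _ _).trans hv)
      (fun t ht => (hv₀ t (((le_max_left _ _).trans hv).trans ht)).le)
    rw [mul_div_cancel₀ _ hpos.ne'] at this
    linarith

theorem hasLimits_boundedSolution (h1 : -2 < a.re) (h2 : a.re < 2) {g : ℝ →ᵇ ℂ}
    (hg : HasLimits g) : HasLimits (boundedSolution h1 h2 g) := by
  refine hasLimits_particularSolution h1 h2 (integral_weight_mul_centered h1 h2 g) ?_
  obtain ⟨⟨l, hl⟩, ⟨l', hl'⟩⟩ := hg
  exact ⟨⟨_, hl.sub_const (weightedMean a g)⟩, ⟨_, hl'.sub_const (weightedMean a g)⟩⟩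

/-- Under a uniform limit the Cauchy property along each end is inherited, and `ℂ` is complete.
Through this set flatness is carried to the fixed point. -/
theorem isClosed_hasLimits : IsClosed {y : ℝ →ᵇ ℂ | HasLimits y} := by
  refine isClosed_of_closure_subset fun y hy => ?_
  obtain ⟨u, hu, hlim⟩ := mem_closure_iff_seq_limit.1 hy
  have hunif := BoundedContinuousFunction.tendsto_iff_tendstoUniformly.1 hlim
  have main : ∀ L : Filter ℝ, L.NeBot → (∀ n, ∃ l, Tendsto (u n) L (𝓝 l)) →
      ∃ l, Tendsto y L (𝓝 l) := by
    intro L hL hx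
    refine cauchy_map_iff_exists_tendsto.1 (Metric.cauchy_iff.2 ⟨inferInstance, fun ε hε => ?_⟩)
    obtain ⟨n, hn⟩ := ((Metric.tendstoUniformly_iff.1 hunif) (ε / 4) (by positivity)).exists
    obtain ⟨l, hl⟩ := hx n
    refine ⟨Metric.ball l (ε / 2), ?_, fun p hp q hq => ?_⟩
    · refine mem_map.2 ?_
      filter_upwards [Metric.tendsto_nhds.1 hl (ε / 4) (by positivity)] with v hv
      exact Metric.mem_ball.2 ((dist_triangle _ (u n v) _).trans_lt (by linarith [hn v]))
    · rw [Metric.mem_ball] at hp hq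
      exact (dist_triangle_right _ _ l).trans_lt (by linarith)
  exact ⟨main atBot inferInstance fun n => (hu n).1, main atTop inferInstance fun n => (hu n).2⟩

end LinearEquation

end LLGS

/-! ### The Riccati equation as an operator on bounded functions -/

namespace LLGS

open BoundedContinuousFunction

/-- Right hand side of the equation for `z = p + i q`, with `t = -cos θ`. -/
noncomputable def riccati (P : Params) (s Ω : ℝ) (z t : ℂ) : ℂ :=
  t * z ^ 2 - s * (P.alpha + Complex.I) * z + (P.field - Ω) + P.mu * t +
    Complex.I * (P.alpha * Ω - P.beta / (1 - P.ccp * t))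

/-- The homogeneous state `p = r`, `q = 0` is a codim-2 heteroclinic connection. -/
structure IsBaseState (P₀ : Params) (r s₀ Ω₀ : ℝ) : Prop where
  pos : 0 < r
  sq : r ^ 2 = -P₀.mu
  ccp : P₀.ccp = 0
  field : P₀.field - Ω₀ = P₀.alpha * s₀ * r
  torque : P₀.alpha * Ω₀ - P₀.beta = s₀ * r
  lower : -(2 * r) < P₀.alpha * s₀
  upper : P₀.alpha * s₀ < 2 * r

/-- Pointwise real part. -/
noncomputable def reBCF : (ℝ →ᵇ ℂ) →L[ℝ] (ℝ →ᵇ ℂ) :=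
  (Complex.ofRealCLM ∘L Complex.reCLM).compLeftContinuousBounded ℝ

@[simp]
theorem reBCF_apply (y : ℝ →ᵇ ℂ) (v : ℝ) : reBCF y v = ((y v).re : ℂ) := rfl

/-- The constant function `i`. -/
noncomputable def iBCF : ℝ →ᵇ ℂ := BoundedContinuousFunction.const ℝ Complex.I

@[simp]
theorem iBCF_apply (v : ℝ) : iBCF v = Complex.I := rfl

/-- Division is expressed by `Ring.inverse` because this map is analytic at the units of the Banach
algebra of bounded functions. -/
theorem ringInverse_apply {f : ℝ →ᵇ ℂ} (hf : IsUnit f) (v : ℝ) : Ring.inverse f v = (f v)⁻¹ := by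
  have h : f v * Ring.inverse f v = 1 := by
    rw [← BoundedContinuousFunction.mul_apply, Ring.mul_inverse_cancel f hf]; rfl
  exact eq_inv_of_mul_eq_one_right h

theorem apply_ne_zero_of_isUnit {f : ℝ →ᵇ ℂ} (hf : IsUnit f) (v : ℝ) : f v ≠ 0 := by
  intro h0
  have h : f v * Ring.inverse f v = 1 := by
    rw [← BoundedContinuousFunction.mul_apply, Ring.mul_inverse_cancel f hf]; rfl
  simp [h0] at h

/-- The right hand side as an operator on bounded functions. -/
noncomputable def riccatiBCF (P : Params) (s Ω : ℝ) (z : ℝ →ᵇ ℂ) : ℝ →ᵇ ℂ :=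
  tanhBCF * (z * z) - s • ((P.alpha • (1 : ℝ →ᵇ ℂ) + iBCF) * z) + (P.field - Ω) • (1 : ℝ →ᵇ ℂ) +
    P.mu • tanhBCF + iBCF * ((P.alpha * Ω) • (1 : ℝ →ᵇ ℂ) -
      P.beta • Ring.inverse ((1 : ℝ →ᵇ ℂ) - P.ccp • tanhBCF))

theorem riccatiBCF_apply {P : Params} (hu : IsUnit ((1 : ℝ →ᵇ ℂ) - P.ccp • tanhBCF)) (s Ω : ℝ)
    (z : ℝ →ᵇ ℂ) (v : ℝ) : riccatiBCF P s Ω z v = riccati P s Ω (z v) (Real.tanh v) := by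
  simp only [riccatiBCF, riccati, BoundedContinuousFunction.coe_add,
    BoundedContinuousFunction.coe_sub, BoundedContinuousFunction.coe_mul,
    BoundedContinuousFunction.coe_smul, BoundedContinuousFunction.coe_one, Pi.add_apply,
    Pi.sub_apply, Pi.mul_apply, Pi.one_apply, tanhBCF_apply, iBCF_apply, ringInverse_apply hu,
    Complex.real_smul]
  push_cast
  ring

/-- The function `r + y`. -/
noncomputable def shifted (r : ℝ) (y : ℝ →ᵇ ℂ) : ℝ →ᵇ ℂ := r • (1 : ℝ →ᵇ ℂ) + y

theorem shifted_apply (r : ℝ) (y : ℝ →ᵇ ℂ) (v : ℝ) : shifted r y v = r + y v := by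
  simp [shifted]

/-- The linearisation of the equation for `dz/dv` at the homogeneous state. -/
noncomputable def linearPart (P₀ : Params) (r s₀ : ℝ) (x : (ℝ →ᵇ ℂ) × ℝ × ℝ) : ℝ →ᵇ ℂ :=
  ((2 : ℝ) • tanhBCF - (s₀ / r) • (P₀.alpha • (1 : ℝ →ᵇ ℂ) + iBCF)) * x.1 -
    (x.2.1 • (P₀.alpha • (1 : ℝ →ᵇ ℂ) + iBCF) + (x.2.2 / r) • ((1 : ℝ →ᵇ ℂ) - P₀.alpha • iBCF))

/-- The nonlinear remainder of the equation for `dz/dv`. -/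
noncomputable def remainder (P₀ : Params) (r s₀ Ω₀ : ℝ) (w : Params × (ℝ →ᵇ ℂ) × ℝ × ℝ) :
    ℝ →ᵇ ℂ :=
  riccatiBCF w.1 (s₀ + w.2.2.1) (Ω₀ + w.2.2.2) (shifted r w.2.1) *
    Ring.inverse (reBCF (shifted r w.2.1)) - linearPart P₀ r s₀ w.2

variable {P₀ : Params} {r s₀ Ω₀ : ℝ}

theorem isUnit_smul_one {r : ℝ} (hr : r ≠ 0) : IsUnit (r • (1 : ℝ →ᵇ ℂ)) :=
  (isUnit_one (M := ℝ →ᵇ ℂ)).smul (Units.mk0 r hr)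

theorem reBCF_shifted_zero (r : ℝ) : reBCF (shifted r 0) = r • (1 : ℝ →ᵇ ℂ) := by
  ext v; simp [shifted]

/-- The remainder is polynomial except for two inverses, which are taken at units: at the base point
the arguments are `1`, since `c_cp = 0`, and the constant `r > 0`. -/
theorem contDiffAt_remainder (hb : IsBaseState P₀ r s₀ Ω₀) :
    ContDiffAt ℝ ω (remainder P₀ r s₀ Ω₀) (P₀, 0) := by
  have hinv1 : ContDiffAt ℝ ω (fun w : Params × (ℝ →ᵇ ℂ) × ℝ × ℝ =>
      Ring.inverse ((1 : ℝ →ᵇ ℂ) - w.1.ccp • tanhBCF)) (P₀, 0) := by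
    have h1 : ContDiffAt ℝ ω (Ring.inverse (M₀ := ℝ →ᵇ ℂ))
        ((1 : ℝ →ᵇ ℂ) - P₀.ccp • tanhBCF) := by
      rw [hb.ccp, zero_smul, sub_zero]
      exact contDiffAt_ringInverse ℝ (1 : (ℝ →ᵇ ℂ)ˣ)
    exact ContDiffAt.comp (P₀, (0 : (ℝ →ᵇ ℂ) × ℝ × ℝ))
      (f := fun w : Params × (ℝ →ᵇ ℂ) × ℝ × ℝ => (1 : ℝ →ᵇ ℂ) - w.1.ccp • tanhBCF) h1
      (by fun_prop)
  have hinv2 : ContDiffAt ℝ ω (fun w : Params × (ℝ →ᵇ ℂ) × ℝ × ℝ =>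
      Ring.inverse (reBCF (shifted r w.2.1))) (P₀, 0) := by
    have h1 : ContDiffAt ℝ ω (Ring.inverse (M₀ := ℝ →ᵇ ℂ))
        (reBCF (shifted r (0 : ℝ →ᵇ ℂ))) := by
      rw [reBCF_shifted_zero]
      obtain ⟨u, hu⟩ := isUnit_smul_one hb.pos.ne'
      rw [← hu]
      exact contDiffAt_ringInverse ℝ u
    exact ContDiffAt.comp (P₀, (0 : (ℝ →ᵇ ℂ) × ℝ × ℝ))
      (f := fun w : Params × (ℝ →ᵇ ℂ) × ℝ × ℝ => reBCF (shifted r w.2.1)) h1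
      (by unfold shifted; fun_prop)
  unfold remainder riccatiBCF linearPart
  refine ContDiffAt.sub (ContDiffAt.mul (ContDiffAt.add ?_ ?_) hinv2) ?_
  · unfold shifted; fun_prop
  · refine contDiffAt_const.mul (ContDiffAt.sub ?_ (ContDiffAt.fun_smul ?_ hinv1)) <;> fun_prop
  · simp only [div_eq_mul_inv]
    fun_prop

theorem eventually_isUnit (hb : IsBaseState P₀ r s₀ Ω₀) :
    ∀ᶠ w : Params × (ℝ →ᵇ ℂ) × ℝ × ℝ in 𝓝 (P₀, 0),
      IsUnit ((1 : ℝ →ᵇ ℂ) - w.1.ccp • tanhBCF) ∧ IsUnit (reBCF (shifted r w.2.1)) := by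
  refine Filter.Eventually.and ?_ ?_
  · have hc : Continuous fun w : Params × (ℝ →ᵇ ℂ) × ℝ × ℝ =>
        (1 : ℝ →ᵇ ℂ) - w.1.ccp • tanhBCF := by fun_prop
    exact hc.continuousAt.eventually (Units.isOpen.mem_nhds (by
      simp only [hb.ccp, zero_smul, sub_zero]; exact isUnit_one))
  · have hc : Continuous fun w : Params × (ℝ →ᵇ ℂ) × ℝ × ℝ => reBCF (shifted r w.2.1) := by
      unfold shifted; fun_prop
    exact hc.continuousAt.eventually (Units.isOpen.mem_nhds (by
      simp only [Prod.fst_zero, reBCF_shifted_zero]; exact isUnit_smul_one hb.pos.ne'))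

/-- The quadratic numerator of the remainder at the base parameters. -/
theorem remainder_base (hb : IsBaseState P₀ r s₀ Ω₀) {x : (ℝ →ᵇ ℂ) × ℝ × ℝ}
    (hu : IsUnit (reBCF (shifted r x.1))) : remainder P₀ r s₀ Ω₀ (P₀, x) =
      (tanhBCF * (x.1 * x.1) - x.2.1 • ((P₀.alpha • (1 : ℝ →ᵇ ℂ) + iBCF) * x.1) -
        linearPart P₀ r s₀ x * reBCF x.1) * Ring.inverse (reBCF (shifted r x.1)) := by
  have hr : (r : ℂ) ≠ 0 := Complex.ofReal_ne_zero.2 hb.pos.ne'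
  have h1 : IsUnit ((1 : ℝ →ᵇ ℂ) - P₀.ccp • tanhBCF) := by
    rw [hb.ccp, zero_smul, sub_zero]; exact isUnit_one
  have hsq : (r : ℂ) ^ 2 = -P₀.mu := by exact_mod_cast hb.sq
  have hf : (P₀.field : ℂ) = Ω₀ + P₀.alpha * s₀ * r := by
    have := hb.field
    exact_mod_cast (by linarith : P₀.field = Ω₀ + P₀.alpha * s₀ * r)
  have ht : (P₀.beta : ℂ) = P₀.alpha * Ω₀ - s₀ * r := by
    have := hb.torque
    exact_mod_cast (by linarith : P₀.beta = P₀.alpha * Ω₀ - s₀ * r)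
  have hmu : (P₀.mu : ℂ) = -(r : ℂ) ^ 2 := by rw [hsq, neg_neg]
  ext v
  have h2 := apply_ne_zero_of_isUnit hu v
  simp only [remainder, linearPart, BoundedContinuousFunction.coe_sub,
    BoundedContinuousFunction.coe_mul, BoundedContinuousFunction.coe_add,
    BoundedContinuousFunction.coe_smul, BoundedContinuousFunction.coe_one, Pi.add_apply,
    Pi.sub_apply, Pi.mul_apply, Pi.one_apply, tanhBCF_apply, iBCF_apply, ringInverse_apply hu,
    riccatiBCF_apply h1, Complex.real_smul, riccati, hb.ccp, shifted_apply, reBCF_apply,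
    Complex.add_re, Complex.ofReal_re, hf, ht, hmu] at h2 ⊢
  push_cast at h2 ⊢
  simp only [zero_mul, sub_zero, div_one]
  field_simp
  ring

end LLGS

/-! ### The linearised problem and the fixed point formulation -/

namespace LLGS

open BoundedContinuousFunction

variable {P₀ : Params} {r s₀ Ω₀ : ℝ}

theorem linearPart_zero (P₀ : Params) (r s₀ : ℝ) : linearPart P₀ r s₀ 0 = 0 := by
  simp [linearPart]

theorem remainder_base_zero (hb : IsBaseState P₀ r s₀ Ω₀) :
    remainder P₀ r s₀ Ω₀ (P₀, 0) = 0 := by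
  rw [remainder_base hb (by
    rw [Prod.fst_zero, reBCF_shifted_zero]; exact isUnit_smul_one hb.pos.ne')]
  simp

/-- By `remainder_base` the numerator at `P₀` is a sum of products of two factors vanishing at the
origin, so the product rule leaves nothing. -/
theorem hasFDerivAt_remainder_base (hb : IsBaseState P₀ r s₀ Ω₀) :
    HasFDerivAt (fun x => remainder P₀ r s₀ Ω₀ (P₀, x))
      (0 : (ℝ →ᵇ ℂ) × ℝ × ℝ →L[ℝ] (ℝ →ᵇ ℂ)) 0 := by
  have hq : HasFDerivAt (fun x : (ℝ →ᵇ ℂ) × ℝ × ℝ =>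
      tanhBCF * (x.1 * x.1) - x.2.1 • ((P₀.alpha • (1 : ℝ →ᵇ ℂ) + iBCF) * x.1) -
        linearPart P₀ r s₀ x * reBCF x.1) (0 : (ℝ →ᵇ ℂ) × ℝ × ℝ →L[ℝ] (ℝ →ᵇ ℂ)) 0 := by
    have hl : DifferentiableAt ℝ (linearPart P₀ r s₀) 0 := by
      unfold linearPart
      simp only [div_eq_mul_inv]
      fun_prop
    have h1 : HasFDerivAt (fun x : (ℝ →ᵇ ℂ) × ℝ × ℝ => x.1)
      (ContinuousLinearMap.fst ℝ _ _) 0 := hasFDerivAt_fst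
    have h2 : HasFDerivAt (fun x : (ℝ →ᵇ ℂ) × ℝ × ℝ => x.2.1)
      ((ContinuousLinearMap.fst ℝ _ _) ∘L (ContinuousLinearMap.snd ℝ _ _)) 0 :=
      ContinuousLinearMap.hasFDerivAt ((ContinuousLinearMap.fst ℝ ℝ ℝ) ∘L
        (ContinuousLinearMap.snd ℝ (ℝ →ᵇ ℂ) (ℝ × ℝ)))
    have h3 := ((h1.mul h1).const_mul tanhBCF).sub
      (h2.smul (h1.const_mul (P₀.alpha • (1 : ℝ →ᵇ ℂ) + iBCF)))
    have h4 := hl.hasFDerivAt.mul (reBCF.hasFDerivAt.comp _ h1)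
    refine (h3.sub h4).congr_fderiv ?_
    refine ContinuousLinearMap.ext fun x => ?_
    simp [linearPart_zero]
  have hu : ∀ᶠ x : (ℝ →ᵇ ℂ) × ℝ × ℝ in 𝓝 0, IsUnit (reBCF (shifted r x.1)) := by
    have hc : Continuous fun x : (ℝ →ᵇ ℂ) × ℝ × ℝ => reBCF (shifted r x.1) := by
      unfold shifted; fun_prop
    exact hc.continuousAt.eventually (Units.isOpen.mem_nhds (by
      simp only [Prod.fst_zero, reBCF_shifted_zero]; exact isUnit_smul_one hb.pos.ne'))
  have hi : DifferentiableAt ℝ (fun x : (ℝ →ᵇ ℂ) × ℝ × ℝ =>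
      Ring.inverse (reBCF (shifted r x.1))) 0 := by
    have h1 : DifferentiableAt ℝ (Ring.inverse (M₀ := ℝ →ᵇ ℂ))
        (reBCF (shifted r (0 : ℝ →ᵇ ℂ))) := by
      rw [reBCF_shifted_zero]
      obtain ⟨u, hu⟩ := isUnit_smul_one hb.pos.ne'
      rw [← hu]
      exact (contDiffAt_ringInverse (n := 1) ℝ u).differentiableAt one_ne_zero
    exact DifferentiableAt.comp (0 : (ℝ →ᵇ ℂ) × ℝ × ℝ)
      (f := fun x : (ℝ →ᵇ ℂ) × ℝ × ℝ => reBCF (shifted r x.1)) h1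
      (by unfold shifted; fun_prop)
  have h5 := hq.mul hi.hasFDerivAt
  refine HasFDerivAt.congr_of_eventuallyEq (h5.congr_fderiv ?_)
    (hu.mono fun x hx => remainder_base hb hx)
  refine ContinuousLinearMap.ext fun x => ?_
  simp [linearPart_zero]

/-- The exponent of the weight of the linearisation. -/
noncomputable def baseExponent (P₀ : Params) (r s₀ : ℝ) : ℂ :=
  (s₀ / r : ℝ) * (P₀.alpha + Complex.I)

theorem baseExponent_re : (baseExponent P₀ r s₀).re = P₀.alpha * s₀ / r := by
  rw [baseExponent, Complex.re_ofReal_mul]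
  simp
  ring

theorem IsBaseState.lt_re (hb : IsBaseState P₀ r s₀ Ω₀) : -2 < (baseExponent P₀ r s₀).re := by
  rw [baseExponent_re, lt_div_iff₀ hb.pos]; linarith [hb.lower]

theorem IsBaseState.re_lt (hb : IsBaseState P₀ r s₀ Ω₀) : (baseExponent P₀ r s₀).re < 2 := by
  rw [baseExponent_re, div_lt_iff₀ hb.pos]; exact hb.upper

theorem alpha_add_I_ne_zero (α : ℝ) : (α : ℂ) + Complex.I ≠ 0 := fun h => by
  simpa using congrArg Complex.im h

/-- The solution operator of the linearised problem, with the increments of speed and frequency. -/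
noncomputable def solutionOp (hb : IsBaseState P₀ r s₀ Ω₀) :
    (ℝ →ᵇ ℂ) →L[ℝ] (ℝ →ᵇ ℂ) × ℝ × ℝ :=
  (boundedSolution hb.lt_re hb.re_lt).prod
    ((Complex.reCLM ∘L (ContinuousLinearMap.mul ℝ ℂ ((P₀.alpha + Complex.I)⁻¹)) ∘L
        (meanCLM hb.lt_re hb.re_lt)).prod
      ((-r) • (Complex.imCLM ∘L (ContinuousLinearMap.mul ℝ ℂ ((P₀.alpha + Complex.I)⁻¹)) ∘L
        (meanCLM hb.lt_re hb.re_lt))))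

theorem linearPart_apply (x : (ℝ →ᵇ ℂ) × ℝ × ℝ) (v : ℝ) : linearPart P₀ r s₀ x v =
    (2 * (Real.tanh v : ℂ) - baseExponent P₀ r s₀) * x.1 v -
      (P₀.alpha + Complex.I) * (x.2.1 - Complex.I * (x.2.2 / r)) := by
  simp only [linearPart, baseExponent, BoundedContinuousFunction.coe_sub,
    BoundedContinuousFunction.coe_mul, BoundedContinuousFunction.coe_add,
    BoundedContinuousFunction.coe_smul, BoundedContinuousFunction.coe_one, Pi.add_apply,
    Pi.sub_apply, Pi.mul_apply, Pi.one_apply, tanhBCF_apply, iBCF_apply, Complex.real_smul]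
  push_cast
  linear_combination (-(x.2.2 / r : ℂ)) * Complex.I_sq

/-- The bounded solution of the linear equation requires the constant `k` to be the weighted mean of
the forcing. The map `(σ, ω) ↦ (α + i)(σ - i ω / r)` from `ℝ²` to `ℂ` is bijective, so exactly one
pair of increments of speed and frequency produces this constant. -/
theorem eq_solutionOp_iff (hb : IsBaseState P₀ r s₀ Ω₀) (x : (ℝ →ᵇ ℂ) × ℝ × ℝ) (g : ℝ →ᵇ ℂ) :
    x = solutionOp hb g ↔ ∀ v, HasDerivAt x.1 (linearPart P₀ r s₀ x v + g v) v := by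
  have hr : (r : ℂ) ≠ 0 := Complex.ofReal_ne_zero.2 hb.pos.ne'
  have hα := alpha_add_I_ne_zero P₀.alpha
  constructor
  · intro hx v
    have h1 := hasDerivAt_boundedSolution hb.lt_re hb.re_lt g v
    have hx1 : x.1 = boundedSolution hb.lt_re hb.re_lt g := by rw [hx]; rfl
    have hx2 : x.2.1 = ((P₀.alpha + Complex.I)⁻¹ * meanCLM hb.lt_re hb.re_lt g).re := by
      rw [hx]; rfl
    have hx3 : x.2.2 = -r * ((P₀.alpha + Complex.I)⁻¹ * meanCLM hb.lt_re hb.re_lt g).im := by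
      rw [hx]; rfl
    rw [linearPart_apply, hx1]
    refine h1.congr_deriv ?_
    have h4 : meanCLM hb.lt_re hb.re_lt g =
        (P₀.alpha + Complex.I) * (x.2.1 - Complex.I * (x.2.2 / r)) := by
      have h5 : (x.2.1 - Complex.I * (x.2.2 / r) : ℂ) =
          (P₀.alpha + Complex.I)⁻¹ * meanCLM hb.lt_re hb.re_lt g := by
        rw [← Complex.re_add_im ((P₀.alpha + Complex.I)⁻¹ * meanCLM hb.lt_re hb.re_lt g), ← hx2,
          hx3]
        push_cast
        field_simp
        ring
      rw [h5, mul_inv_cancel_left₀ hα]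
    rw [h4]
    ring
  · intro hx
    obtain ⟨h1, h2⟩ := eq_boundedSolution hb.lt_re hb.re_lt (g := g) (y := x.1)
      (k := (P₀.alpha + Complex.I) * (x.2.1 - Complex.I * (x.2.2 / r))) (fun v => by
        refine (hx v).congr_deriv ?_
        rw [linearPart_apply]
        ring)
    have h3 : (P₀.alpha + Complex.I : ℂ)⁻¹ * meanCLM hb.lt_re hb.re_lt g =
        x.2.1 - Complex.I * ((x.2.2 / r : ℝ) : ℂ) := by
      rw [← h2, inv_mul_cancel_left₀ hα]
      push_cast
      ring
    refine Prod.ext h1 (Prod.ext ?_ ?_)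
    · change x.2.1 = ((P₀.alpha + Complex.I)⁻¹ * meanCLM hb.lt_re hb.re_lt g).re
      rw [h3]
      simp [-Complex.ofReal_div]
    · change x.2.2 = -r * ((P₀.alpha + Complex.I)⁻¹ * meanCLM hb.lt_re hb.re_lt g).im
      rw [h3]
      have := hb.pos.ne'
      simp [-Complex.ofReal_div]
      field_simp

theorem hasDerivAt_shifted_iff {y : ℝ →ᵇ ℂ} {d : ℂ} {v : ℝ} :
    HasDerivAt (shifted r y) d v ↔ HasDerivAt y d v := by
  have h1 : (shifted r y : ℝ → ℂ) = fun v => (r : ℂ) + y v := by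
    ext v; exact shifted_apply r y v
  rw [h1]
  exact hasDerivAt_const_add_iff _

/-- Fixed points of the solution operator are the bounded solutions near the base state. -/
theorem fixedPoint_iff (hb : IsBaseState P₀ r s₀ Ω₀) {P : Params} {x : (ℝ →ᵇ ℂ) × ℝ × ℝ}
    (hu : IsUnit ((1 : ℝ →ᵇ ℂ) - P.ccp • tanhBCF) ∧ IsUnit (reBCF (shifted r x.1))) :
    x = solutionOp hb (remainder P₀ r s₀ Ω₀ (P, x)) ↔
      ∀ v, HasDerivAt (shifted r x.1) (riccati P (s₀ + x.2.1) (Ω₀ + x.2.2) (shifted r x.1 v)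
        (Real.tanh v) / ((shifted r x.1 v).re : ℂ)) v := by
  rw [eq_solutionOp_iff]
  refine forall_congr' fun v => ?_
  rw [hasDerivAt_shifted_iff]
  have : linearPart P₀ r s₀ x v + remainder P₀ r s₀ Ω₀ (P, x) v =
      riccati P (s₀ + x.2.1) (Ω₀ + x.2.2) (shifted r x.1 v) (Real.tanh v) /
        ((shifted r x.1 v).re : ℂ) := by
    simp only [remainder, BoundedContinuousFunction.coe_sub, BoundedContinuousFunction.coe_mul,
      Pi.sub_apply, Pi.mul_apply, riccatiBCF_apply hu.1, ringInverse_apply hu.2, reBCF_apply,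
      div_eq_mul_inv]
    push_cast
    ring
  rw [this]

/-- The bounds keep both denominators away from zero in the limit: `‖x.1‖ < r` keeps `Re z`
positive, and `|c_cp| < 1` keeps `1 - c_cp t` nonzero at `t = ±1`. -/
theorem HasLimits.bcf_remainder {P : Params} {x : (ℝ →ᵇ ℂ) × ℝ × ℝ} (hP : |P.ccp| < 1)
    (hx : ‖x.1‖ < r)
    (hu : IsUnit ((1 : ℝ →ᵇ ℂ) - P.ccp • tanhBCF) ∧ IsUnit (reBCF (shifted r x.1)))
    (hl : HasLimits x.1) : HasLimits (remainder P₀ r s₀ Ω₀ (P, x)) := by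
  have hform : ∀ v, remainder P₀ r s₀ Ω₀ (P, x) v =
      riccati P (s₀ + x.2.1) (Ω₀ + x.2.2) (r + x.1 v) (Real.tanh v) / ((r + x.1 v).re : ℂ) -
        ((2 * (Real.tanh v : ℂ) - baseExponent P₀ r s₀) * x.1 v -
          (P₀.alpha + Complex.I) * (x.2.1 - Complex.I * (x.2.2 / r))) := by
    intro v
    simp only [remainder, BoundedContinuousFunction.coe_sub, BoundedContinuousFunction.coe_mul,
      Pi.sub_apply, Pi.mul_apply, riccatiBCF_apply hu.1, ringInverse_apply hu.2, reBCF_apply,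
      div_eq_mul_inv, shifted_apply, linearPart_apply]
  have main : ∀ {L : Filter ℝ} {l : ℂ} {e : ℝ}, L.NeBot → |e| ≤ 1 →
      Tendsto Real.tanh L (𝓝 e) → Tendsto x.1 L (𝓝 l) →
      ∃ l', Tendsto (remainder P₀ r s₀ Ω₀ (P, x)) L (𝓝 l') := by
    intro L l e hL he ht hy
    have ht' : Tendsto (fun v => (Real.tanh v : ℂ)) L (𝓝 (e : ℂ)) :=
      (Complex.continuous_ofReal.tendsto _).comp ht
    have hl : ‖l‖ < r := lt_of_le_of_lt (le_of_tendsto hy.norm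
      (Eventually.of_forall fun v => x.1.norm_coe_le_norm v)) hx
    have hne : ((r + l).re : ℂ) ≠ 0 := by
      have h1 := (abs_le.1 (Complex.abs_re_le_norm l)).1
      refine Complex.ofReal_ne_zero.2 (ne_of_gt ?_)
      simp only [Complex.add_re, Complex.ofReal_re]
      linarith
    have hne' : (1 : ℂ) - P.ccp * e ≠ 0 := by
      have h1 : |P.ccp * e| < 1 := by
        rw [abs_mul]
        exact (mul_le_of_le_one_right (abs_nonneg _) he).trans_lt hP
      have h2 : (1 : ℝ) - P.ccp * e ≠ 0 := by linarith [(abs_lt.1 h1).2]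
      exact_mod_cast h2
    have hz : Tendsto (fun v => (r : ℂ) + x.1 v) L (𝓝 (r + l)) := hy.const_add _
    have hre : Tendsto (fun v => (((r : ℂ) + x.1 v).re : ℂ)) L (𝓝 ((r + l).re : ℂ)) :=
      (Complex.continuous_ofReal.tendsto _).comp ((Complex.continuous_re.tendsto _).comp hz)
    have hd : Tendsto (fun v => (P.beta : ℂ) / (1 - P.ccp * (Real.tanh v : ℂ))) L
        (𝓝 (P.beta / (1 - P.ccp * e))) :=
      tendsto_const_nhds.div ((ht'.const_mul _).const_sub _) hne'
    have hR : Tendsto (fun v => riccati P (s₀ + x.2.1) (Ω₀ + x.2.2) (r + x.1 v) (Real.tanh v)) L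
        (𝓝 (riccati P (s₀ + x.2.1) (Ω₀ + x.2.2) (r + l) e)) := by
      unfold riccati
      exact ((((ht'.mul (hz.pow 2)).sub (hz.const_mul _)).add_const _).add
        (ht'.const_mul _)).add ((hd.const_sub _).const_mul _)
    exact ⟨_, Tendsto.congr (fun v => (hform v).symm) (Tendsto.sub (Tendsto.div hR hre hne)
      (((((ht'.const_mul 2).sub_const _).mul hy).sub_const _)))⟩
  obtain ⟨⟨l, hl⟩, ⟨l', hl'⟩⟩ := hl
  exact ⟨main inferInstance (by simp) tendsto_tanh_atBot hl,
    main inferInstance (by simp) tendsto_tanh_atTop hl'⟩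

end LLGS

/-! ### Persistence of the homogeneous profile by the implicit function theorem -/

namespace LLGS

open BoundedContinuousFunction

/-- A fixed point of a contraction lies in every closed invariant set that contains the origin. -/
theorem mem_of_isFixedPt_of_contraction {X : Type*} [NormedAddCommGroup X] {W : Set X}
    (hW : IsClosed W) (h0 : (0 : X) ∈ W) {G : X → X} {ρ : ℝ}
    (hG : ∀ x y, ‖x‖ < ρ → ‖y‖ < ρ → ‖G x - G y‖ ≤ 1 / 2 * ‖x - y‖)
    (hinv : ∀ x ∈ W, ‖x‖ < ρ → G x ∈ W) {x : X} (hx : G x = x) (hxρ : ‖x‖ < ρ / 2) : x ∈ W := by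
  have key : ∀ n : ℕ, G^[n] 0 ∈ W ∧ ‖G^[n] 0 - x‖ ≤ (1 / 2) ^ n * ‖x‖ := by
    -- The iterates of `0` stay within `‖x‖` of the fixed point, hence have norm below `2 ‖x‖ < ρ`,
    -- where the contraction estimate is valid.
    intro n
    induction n with
    | zero => simpa using h0
    | succ n ih =>
      have hn : ‖G^[n] 0 - x‖ ≤ ‖x‖ :=
        ih.2.trans (mul_le_of_le_one_left (norm_nonneg _) (pow_le_one₀ (by norm_num) (by norm_num)))
      have hn' : ‖G^[n] 0‖ < ρ := by
        have := norm_add_le (G^[n] 0 - x) x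
        rw [sub_add_cancel] at this
        linarith
      rw [Function.iterate_succ_apply']
      refine ⟨hinv _ ih.1 hn', ?_⟩
      have h1 := hG (G^[n] 0) x hn' (by linarith [norm_nonneg x])
      rw [hx] at h1
      calc _ ≤ 1 / 2 * ‖G^[n] 0 - x‖ := h1
        _ ≤ 1 / 2 * ((1 / 2) ^ n * ‖x‖) := by linarith [ih.2]
        _ = _ := by ring
  have hlim : Tendsto (fun n => G^[n] 0) atTop (𝓝 x) := by
    rw [tendsto_iff_norm_sub_tendsto_zero]
    refine squeeze_zero (fun _ => norm_nonneg _) (fun n => (key n).2) ?_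
    have := (tendsto_pow_atTop_nhds_zero_of_lt_one (r := (1 / 2 : ℝ)) (by norm_num)
      (by norm_num)).mul_const ‖x‖
    rwa [zero_mul] at this
  exact hW.mem_of_tendsto hlim (Eventually.of_forall fun n => (key n).1)

variable {P₀ : Params} {r s₀ Ω₀ : ℝ}

/-- `z` solves the equation of the profiles, as a function of `v = log tan (θ / 2)`. -/
def IsProfile (P : Params) (s Ω : ℝ) (z : ℝ →ᵇ ℂ) : Prop :=
  ∀ v, HasDerivAt z (riccati P s Ω (z v) (Real.tanh v) / ((z v).re : ℂ)) v

/-- The homogeneous state persists: profiles near it form a unique analytic family. -/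
theorem exists_profile_family (hb : IsBaseState P₀ r s₀ Ω₀) :
    ∃ (z : Params → ℝ →ᵇ ℂ) (s Ω : Params → ℝ),
      z P₀ = r • (1 : ℝ →ᵇ ℂ) ∧ s P₀ = s₀ ∧ Ω P₀ = Ω₀ ∧
      ContDiffAt ℝ ω z P₀ ∧ ContDiffAt ℝ ω s P₀ ∧ ContDiffAt ℝ ω Ω P₀ ∧
      (∀ᶠ P in 𝓝 P₀, IsProfile P (s P) (Ω P) (z P) ∧ HasLimits (z P)) ∧
      ∃ δ > 0, ∀ᶠ P in 𝓝 P₀, ∀ (z' : ℝ →ᵇ ℂ) (s' Ω' : ℝ), ‖z' - r • (1 : ℝ →ᵇ ℂ)‖ < δ →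
        |s' - s₀| < δ → |Ω' - Ω₀| < δ → IsProfile P s' Ω' z' → z' = z P ∧ s' = s P ∧ Ω' = Ω P := by
  set G : Params × (ℝ →ᵇ ℂ) × ℝ × ℝ → (ℝ →ᵇ ℂ) × ℝ × ℝ :=
    fun w => solutionOp hb (remainder P₀ r s₀ Ω₀ w) with hGdef
  have hG : ContDiffAt ℝ ω G (P₀, 0) :=
    (solutionOp hb).contDiff.contDiffAt.comp _ (contDiffAt_remainder hb)
  have hG0 : G (P₀, 0) = 0 := by simp only [hGdef, remainder_base_zero hb, map_zero]
  have hGd : HasFDerivAt G (fderiv ℝ G (P₀, 0)) (P₀, 0) :=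
    (hG.differentiableAt (by simp)).hasFDerivAt
  have hGs : HasStrictFDerivAt G (fderiv ℝ G (P₀, 0)) (P₀, 0) := hG.hasStrictFDerivAt (by simp)
  -- The remainder has no linear part in the unknown. Hence `x - G(P, x)` has the identity as
  -- partial derivative, and `G(P, ·)` is a contraction near the origin.
  have hGx : fderiv ℝ G (P₀, 0) ∘L .inr ℝ Params ((ℝ →ᵇ ℂ) × ℝ × ℝ) = 0 := by
    have h1 : HasFDerivAt (fun x => G (P₀, x))
        (fderiv ℝ G (P₀, 0) ∘L .inr ℝ Params ((ℝ →ᵇ ℂ) × ℝ × ℝ)) 0 :=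
      hGd.comp 0 (hasFDerivAt_prodMk_right _ _)
    refine h1.unique ?_
    have h2 := (solutionOp hb).hasFDerivAt.comp (0 : (ℝ →ᵇ ℂ) × ℝ × ℝ)
      (hasFDerivAt_remainder_base hb)
    rw [ContinuousLinearMap.comp_zero] at h2
    exact h2
  set F : Params × (ℝ →ᵇ ℂ) × ℝ × ℝ → (ℝ →ᵇ ℂ) × ℝ × ℝ := fun w => w.2 - G w with hFdef
  have hF : ContDiffAt ℝ ω F (P₀, 0) := contDiffAt_snd.sub hG
  have hF0 : F (P₀, 0) = 0 := by simp [hFdef, hG0]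
  have hFx : fderiv ℝ F (P₀, 0) ∘L .inr ℝ Params ((ℝ →ᵇ ℂ) × ℝ × ℝ) =
      ContinuousLinearMap.id ℝ _ := by
    have h1 : HasFDerivAt F (ContinuousLinearMap.snd ℝ _ _ - fderiv ℝ G (P₀, 0)) (P₀, 0) :=
      hasFDerivAt_snd.sub hGd
    rw [h1.fderiv, ContinuousLinearMap.sub_comp, hGx, sub_zero]
    rfl
  have hinv : (fderiv ℝ F (P₀, 0) ∘L .inr ℝ Params ((ℝ →ᵇ ℂ) × ℝ × ℝ)).IsInvertible := by
    rw [hFx]; exact ContinuousLinearMap.isInvertible_equiv (f := ContinuousLinearEquiv.refl ℝ _)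
  set x := hF.implicitFunction (by simp) hinv with hxdef
  have hx0 : x P₀ = 0 := hF.implicitFunction_apply_self (by simp) hinv
  have hxc : ContDiffAt ℝ ω x P₀ := hF.contDiffAt_implicitFunction (by simp) hinv
  have hxF : ∀ᶠ P in 𝓝 P₀, G (P, x P) = x P := by
    filter_upwards [hF.eventually_apply_implicitFunction (by simp) hinv] with P hP
    rw [hF0] at hP
    exact (sub_eq_zero.1 hP).symm
  have hxu : ∀ᶠ w in 𝓝 (P₀, (0 : (ℝ →ᵇ ℂ) × ℝ × ℝ)), G w = w.2 → w.2 = x w.1 := by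
    filter_upwards [hF.eventually_apply_eq_iff_implicitFunction (by simp) hinv] with w hw hGw
    rw [hF0] at hw
    exact (hw.1 (by simp [hFdef, hGw])).symm
  have hxpair : Tendsto (fun P => (P, x P)) (𝓝 P₀) (𝓝 (P₀, 0)) := by
    have := (continuousAt_id.prodMk hxc.continuousAt : ContinuousAt (fun P => (P, x P)) P₀)
    rw [ContinuousAt, hx0] at this
    exact this
  have hunit := eventually_isUnit hb
  refine ⟨fun P => shifted r (x P).1, fun P => s₀ + (x P).2.1, fun P => Ω₀ + (x P).2.2,
    ?_, ?_, ?_, ?_, ?_, ?_, ?_, ?_⟩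
  · simp [hx0, shifted]
  · simp [hx0]
  · simp [hx0]
  · exact contDiffAt_const.add hxc.fst
  · exact contDiffAt_const.add hxc.snd.fst
  · exact contDiffAt_const.add hxc.snd.snd
  · refine Filter.Eventually.and ?_ ?_
    · filter_upwards [hxF, hxpair.eventually hunit] with P h1 h2
      exact (fixedPoint_iff hb h2).1 h1.symm
    · have hcontr : ∀ᶠ p in 𝓝 ((P₀, (0 : (ℝ →ᵇ ℂ) × ℝ × ℝ)), (P₀, (0 : (ℝ →ᵇ ℂ) × ℝ × ℝ))),
          ‖G p.1 - G p.2 - fderiv ℝ G (P₀, 0) (p.1 - p.2)‖ ≤ 1 / 2 * ‖p.1 - p.2‖ :=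
        hGs.isLittleO.def (by norm_num)
      obtain ⟨ε₁, hε₁, H1⟩ := Metric.eventually_nhds_iff.1 hcontr
      obtain ⟨ε₂, hε₂, H2⟩ := Metric.eventually_nhds_iff.1 hunit
      -- The three bounds serve the contraction estimate, the invertibility of the two denominators,
      -- and the positivity of the limits of `Re z`.
      set ρ := min (min ε₁ ε₂) r with hρ
      have hρpos : 0 < ρ := lt_min (lt_min hε₁ hε₂) hb.pos
      have hρ1 : ρ ≤ ε₁ := (min_le_left _ _).trans (min_le_left _ _)
      have hρ2 : ρ ≤ ε₂ := (min_le_left _ _).trans (min_le_right _ _)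
      have hρr : ρ ≤ r := min_le_right _ _
      have hxsmall : ∀ᶠ P in 𝓝 P₀, ‖x P‖ < ρ / 2 := by
        have := hxc.continuousAt.norm
        rw [ContinuousAt, hx0, norm_zero] at this
        exact this.eventually_lt_const (by positivity)
      have hccp : ∀ᶠ P in 𝓝 P₀, |P.ccp| < 1 := by
        have : ContinuousAt (fun P : Params => |P.ccp|) P₀ := by fun_prop
        refine this.eventually_lt_const ?_
        change |P₀.ccp| < 1
        rw [hb.ccp]
        simp
      filter_upwards [Metric.ball_mem_nhds P₀ hρpos, hxF, hxsmall, hccp] with P hP h1 h2 h3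
      rw [Metric.mem_ball] at hP
      have hzero : HasLimits (0 : ℝ →ᵇ ℂ) := ⟨⟨0, tendsto_const_nhds⟩, ⟨0, tendsto_const_nhds⟩⟩
      have hmem : x P ∈ {y : (ℝ →ᵇ ℂ) × ℝ × ℝ | HasLimits y.1} := by
        refine mem_of_isFixedPt_of_contraction (G := fun y => G (P, y)) (ρ := ρ)
          (isClosed_hasLimits.preimage continuous_fst) hzero ?_ ?_ h1 h2
        · intro y y' hy hy'
          have h4 := H1 (y := ((P, y), (P, y'))) (by
            refine max_lt (max_lt ?_ ?_) (max_lt ?_ ?_)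
            · exact hP.trans_le hρ1
            · rw [dist_zero_right]; exact hy.trans_le hρ1
            · exact hP.trans_le hρ1
            · rw [dist_zero_right]; exact hy'.trans_le hρ1)
          -- With equal parameters the increment lies in the directions killed by `hGx`, so strict
          -- differentiability becomes a Lipschitz bound with constant `1 / 2`.
          have h5 : fderiv ℝ G (P₀, 0) ((P, y) - (P, y')) = 0 := by
            have := congrArg (fun L : (ℝ →ᵇ ℂ) × ℝ × ℝ →L[ℝ] (ℝ →ᵇ ℂ) × ℝ × ℝ => L (y - y')) hGx
            simpa using this
          have h6 : ‖((P, y) - (P, y') : Params × (ℝ →ᵇ ℂ) × ℝ × ℝ)‖ = ‖y - y'‖ := by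
            rw [Prod.mk_sub_mk, sub_self, Prod.norm_mk, norm_zero]
            exact max_eq_right (norm_nonneg _)
          simp only at h4
          rw [h5, sub_zero, h6] at h4
          exact h4
        · intro y hy hyρ
          have h4 := H2 (y := (P, y)) (by
            refine max_lt (hP.trans_le hρ2) ?_
            rw [dist_zero_right]; exact hyρ.trans_le hρ2)
          exact hasLimits_boundedSolution hb.lt_re hb.re_lt (HasLimits.bcf_remainder h3
            ((norm_fst_le y).trans_lt (hyρ.trans_le hρr)) h4 hy)
      obtain ⟨⟨l, hl⟩, ⟨l', hl'⟩⟩ := hmem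
      exact ⟨⟨_, (hl.const_add (r : ℂ)).congr fun v => (shifted_apply r _ v).symm⟩,
        ⟨_, (hl'.const_add (r : ℂ)).congr fun v => (shifted_apply r _ v).symm⟩⟩
  · obtain ⟨ε, hε, H⟩ := Metric.eventually_nhds_iff.1 (hxu.and hunit)
    refine ⟨ε, hε, ?_⟩
    filter_upwards [Metric.ball_mem_nhds P₀ hε] with P hP z' s' Ω' hz hs hΩ hprof
    set y : (ℝ →ᵇ ℂ) × ℝ × ℝ := (z' - r • (1 : ℝ →ᵇ ℂ), s' - s₀, Ω' - Ω₀) with hy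
    obtain ⟨h1, h2⟩ := H (y := (P, y)) (by
      refine max_lt (Metric.mem_ball.1 hP) ?_
      rw [dist_zero_right]
      exact max_lt hz (max_lt hs hΩ))
    have hsh : shifted r y.1 = z' := by simp [shifted, hy]
    have hs' : s₀ + y.2.1 = s' := by simp [hy]
    have hΩ' : Ω₀ + y.2.2 = Ω' := by simp [hy]
    have h3 : y = x P := h1 ((fixedPoint_iff hb h2).2 (by
      rw [hsh, hs', hΩ']; exact hprof)).symm
    rw [← h3]
    exact ⟨hsh.symm, hs'.symm, hΩ'.symm⟩

end LLGS

/-! ### The Landau–Lifschitz–Gilbert–Slonczewski equation in the coordinates `(v, φ)` -/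

namespace LLGS

/-- The polar angle with `log tan (θ / 2) = v`. -/
noncomputable def polarAngle (v : ℝ) : ℝ := 2 * Real.arctan (Real.exp v)

theorem sin_polarAngle (v : ℝ) : Real.sin (polarAngle v) = 1 / Real.cosh v := by
  have h1 : 0 < 1 + Real.exp v ^ 2 := by positivity
  rw [polarAngle, Real.sin_two_mul, Real.sin_arctan, Real.cos_arctan, Real.cosh_eq, Real.exp_neg]
  have h2 := Real.sq_sqrt h1.le
  have h3 : Real.sqrt (1 + Real.exp v ^ 2) ≠ 0 := (Real.sqrt_pos.2 h1).ne'
  have h4 := (Real.exp_pos v).ne'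
  field_simp
  rw [h2]
  ring

theorem cos_polarAngle (v : ℝ) : Real.cos (polarAngle v) = -Real.tanh v := by
  have h1 : 0 < 1 + Real.exp v ^ 2 := by positivity
  rw [polarAngle, Real.cos_two_mul, Real.cos_arctan, Real.tanh_eq_sinh_div_cosh, Real.cosh_eq,
    Real.sinh_eq, Real.exp_neg, div_pow, Real.sq_sqrt h1.le]
  have h4 := (Real.exp_pos v).ne'
  field_simp
  ring

theorem hasDerivAt_inv_cosh (v : ℝ) :
    HasDerivAt (fun v => 1 / Real.cosh v) (-(Real.tanh v * (1 / Real.cosh v))) v := by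
  have := (Real.hasDerivAt_cosh v).inv (Real.cosh_pos v).ne'
  simp only [one_div]
  refine this.congr_deriv ?_
  rw [Real.tanh_eq_sinh_div_cosh]
  have := (Real.cosh_pos v).ne'
  field_simp

theorem inv_cosh_sq (v : ℝ) : (1 / Real.cosh v) ^ 2 = 1 - Real.tanh v ^ 2 := by
  rw [Real.tanh_eq_sinh_div_cosh]
  have := Real.cosh_sq v
  have := (Real.cosh_pos v).ne'
  field_simp
  linarith

theorem hasDerivAt_polarAngle (v : ℝ) : HasDerivAt polarAngle (1 / Real.cosh v) v := by
  have h := ((Real.hasDerivAt_exp v).arctan).const_mul 2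
  refine h.congr_deriv ?_
  rw [Real.cosh_eq, Real.exp_neg]
  have h4 := (Real.exp_pos v).ne'
  field_simp
  ring

/-- The point of the sphere with `log tan (θ / 2) = v` and azimuth `ψ`. -/
noncomputable def spherePoint (v ψ : ℝ) : Fin 3 → ℝ :=
  ![Real.cos ψ * (1 / Real.cosh v), Real.sin ψ * (1 / Real.cosh v), -Real.tanh v]

/-- Velocity of a curve on the sphere in the coordinates of `spherePoint`. -/
noncomputable def sphereVelocity (v ψ p q : ℝ) : Fin 3 → ℝ :=
  ![(-(q * Real.sin ψ) - Real.tanh v * p * Real.cos ψ) * (1 / Real.cosh v),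
    (q * Real.cos ψ - Real.tanh v * p * Real.sin ψ) * (1 / Real.cosh v),
    -((1 / Real.cosh v) ^ 2 * p)]

theorem HasDerivAt.spherePoint {v ψ : ℝ → ℝ} {p q x : ℝ} (hv : HasDerivAt v p x)
    (hψ : HasDerivAt ψ q x) :
    HasDerivAt (fun x => LLGS.spherePoint (v x) (ψ x)) (sphereVelocity (v x) (ψ x) p q) x := by
  have hS := (hasDerivAt_inv_cosh (v x)).comp x hv
  have ht := (hasDerivAt_tanh (v x)).comp x hv
  refine hasDerivAt_pi.2 fun i => ?_
  fin_cases i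
  · refine (hψ.cos.mul hS).congr_deriv ?_
    simp only [sphereVelocity, Function.comp]
    simp
    ring
  · refine (hψ.sin.mul hS).congr_deriv ?_
    simp only [sphereVelocity, Function.comp]
    simp
    ring
  · refine ht.neg.congr_deriv ?_
    rw [← inv_cosh_sq]
    simp [sphereVelocity]

/-- Acceleration of a curve on the sphere in the coordinates of `spherePoint`. -/
noncomputable def sphereAcceleration (v ψ p q p' q' : ℝ) : Fin 3 → ℝ :=
  ![(-(q' * Real.sin ψ) - q ^ 2 * Real.cos ψ - (1 / Real.cosh v) ^ 2 * p ^ 2 * Real.cos ψ -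
      Real.tanh v * p' * Real.cos ψ + 2 * Real.tanh v * p * q * Real.sin ψ +
      Real.tanh v ^ 2 * p ^ 2 * Real.cos ψ) * (1 / Real.cosh v),
    (q' * Real.cos ψ - q ^ 2 * Real.sin ψ - (1 / Real.cosh v) ^ 2 * p ^ 2 * Real.sin ψ -
      Real.tanh v * p' * Real.sin ψ - 2 * Real.tanh v * p * q * Real.cos ψ +
      Real.tanh v ^ 2 * p ^ 2 * Real.sin ψ) * (1 / Real.cosh v),
    (1 / Real.cosh v) ^ 2 * (2 * Real.tanh v * p ^ 2 - p')]

theorem hasDerivAt_sphereVelocity {v ψ p q : ℝ → ℝ} {p' q' x : ℝ} (hv : HasDerivAt v (p x) x)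
    (hψ : HasDerivAt ψ (q x) x) (hp : HasDerivAt p p' x) (hq : HasDerivAt q q' x) :
    HasDerivAt (fun x => sphereVelocity (v x) (ψ x) (p x) (q x))
      (sphereAcceleration (v x) (ψ x) (p x) (q x) p' q') x := by
  have hS := (hasDerivAt_inv_cosh (v x)).comp x hv
  have ht := (hasDerivAt_tanh (v x)).comp x hv
  rw [← inv_cosh_sq] at ht
  refine hasDerivAt_pi.2 fun i => ?_
  fin_cases i
  · refine ((((hq.mul hψ.sin).neg).sub ((ht.mul hp).mul hψ.cos)).mul hS).congr_deriv ?_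
    simp only [sphereAcceleration, Function.comp]
    simp
    ring
  · refine (((hq.mul hψ.cos).sub ((ht.mul hp).mul hψ.sin)).mul hS).congr_deriv ?_
    simp only [sphereAcceleration, Function.comp]
    simp
    ring
  · refine ((hS.pow 2).mul hp).neg.congr_deriv ?_
    simp only [sphereAcceleration, Function.comp]
    simp
    ring

theorem spherePoint_eq_magnetization (s Ω : ℝ) (v φ : ℝ → ℝ) (x t : ℝ) :
    magnetization s Ω (fun ξ => polarAngle (v ξ)) φ x t =
      spherePoint (v (x - s * t)) (φ (x - s * t) + Ω * t) := by
  simp only [magnetization, spherePoint, sin_polarAngle, cos_polarAngle]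

/-- Real part of `riccati`. -/
noncomputable def riccatiRe (P : Params) (s Ω p q t : ℝ) : ℝ :=
  t * (p ^ 2 - q ^ 2) - s * (P.alpha * p - q) + (P.field - Ω) + P.mu * t

/-- Imaginary part of `riccati`. -/
noncomputable def riccatiIm (P : Params) (s Ω p q t : ℝ) : ℝ :=
  2 * t * p * q - s * (P.alpha * q + p) + (P.alpha * Ω - P.beta / (1 - P.ccp * t))

theorem riccati_eq (P : Params) (s Ω p q t : ℝ) : riccati P s Ω (p + q * Complex.I) t =
    riccatiRe P s Ω p q t + riccatiIm P s Ω p q t * Complex.I := by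
  simp only [riccati, riccatiRe, riccatiIm]
  push_cast
  linear_combination (t * q ^ 2 - s * q : ℂ) * Complex.I_sq

/-- Both sides are tangent to the sphere, so three components carry two real equations, and the
factor `1 / cosh v = sin θ` common to them can be cancelled. The arguments `-s p` and `-s q + Ω` are
the time derivatives of `v` and of the azimuth for a wall moving with speed `s`. -/
theorem sphere_equation_iff (P : Params) (s Ω v ψ p q p' q' : ℝ) :
    sphereVelocity v ψ (-s * p) (-s * q + Ω) -
        P.alpha • (spherePoint v ψ ⨯₃ sphereVelocity v ψ (-s * p) (-s * q + Ω)) =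
      -(spherePoint v ψ ⨯₃ effectiveField P (spherePoint v ψ)
          (sphereAcceleration v ψ p q p' q')) +
        spherePoint v ψ ⨯₃ (spherePoint v ψ ⨯₃ spinTransfer P (spherePoint v ψ)) ↔
      p' = riccatiRe P s Ω p q (Real.tanh v) ∧ q' = riccatiIm P s Ω p q (Real.tanh v) := by
  have hS := inv_cosh_sq v
  have hS0 : 1 / Real.cosh v ≠ 0 := by have := Real.cosh_pos v; positivity
  have hψ := Real.sin_sq_add_cos_sq ψ
  simp only [spherePoint, sphereVelocity, sphereAcceleration, effectiveField, spinTransfer,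
    cross_apply, e3, riccatiRe, riccatiIm]
  have hD : P.beta / (1 + P.ccp * -Real.tanh v) = P.beta / (1 - P.ccp * Real.tanh v) := by
    rw [mul_neg, ← sub_eq_add_neg]
  generalize 1 / Real.cosh v = S at *
  generalize Real.sin ψ = σ at *
  generalize Real.cos ψ = c at *
  simp [funext_iff, Fin.forall_fin_succ]
  rw [← sub_eq_add_neg]
  generalize Real.tanh v = t at *
  generalize P.beta / (1 - P.ccp * t) = D at *
  constructor
  · rintro ⟨h1, h2, h3⟩
    -- The third component is `S²` times the equation for `q'`; the azimuthal combination of the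
    -- first two is `S` times that for `p'`.
    have e1 : S ^ 2 * (q' - (2 * t * p * q - s * (P.alpha * q + p) + (P.alpha * Ω - D))) = 0 := by
      grind
    have e2 : S * (p' - (t * (p ^ 2 - q ^ 2) - s * (P.alpha * p - q) + (P.field - Ω) +
        P.mu * t)) = 0 := by
      grind
    rcases mul_eq_zero.1 e1 with h | h
    · exact absurd (pow_eq_zero_iff two_ne_zero |>.1 h) hS0
    rcases mul_eq_zero.1 e2 with h' | h'
    · exact absurd h' hS0
    exact ⟨sub_eq_zero.1 h', sub_eq_zero.1 h⟩
  · rintro ⟨rfl, rfl⟩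
    refine ⟨?_, ?_, ?_⟩
    · grind
    · grind
    · grind

theorem contDiff_polarAngle {n : WithTop ℕ∞} : ContDiff ℝ n polarAngle :=
  contDiff_const.mul (Real.contDiff_arctan.comp Real.contDiff_exp)

/-- The Landau-Lifschitz-Gilbert-Slonczewski equation for a relative equilibrium. -/
theorem isSolution_iff (P : Params) (s Ω : ℝ) {v φ : ℝ → ℝ} (hv : ContDiff ℝ 2 v)
    (hφ : ContDiff ℝ 2 φ) :
    IsSolution P (magnetization s Ω (fun ξ => polarAngle (v ξ)) φ) ↔
      ∀ ξ, deriv (deriv v) ξ = riccatiRe P s Ω (deriv v ξ) (deriv φ ξ) (Real.tanh (v ξ)) ∧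
        deriv (deriv φ) ξ = riccatiIm P s Ω (deriv v ξ) (deriv φ ξ) (Real.tanh (v ξ)) := by
  have hv1 : ∀ ξ, HasDerivAt v (deriv v ξ) ξ := fun ξ =>
    (hv.differentiable (by norm_num) ξ).hasDerivAt
  have hφ1 : ∀ ξ, HasDerivAt φ (deriv φ ξ) ξ := fun ξ =>
    (hφ.differentiable (by norm_num) ξ).hasDerivAt
  have hv2 : ∀ ξ, HasDerivAt (deriv v) (deriv (deriv v) ξ) ξ := fun ξ =>
    ((contDiff_succ_iff_deriv (n := 1)).1 hv).2.2.differentiable one_ne_zero ξ |>.hasDerivAt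
  have hφ2 : ∀ ξ, HasDerivAt (deriv φ) (deriv (deriv φ) ξ) ξ := fun ξ =>
    ((contDiff_succ_iff_deriv (n := 1)).1 hφ).2.2.differentiable one_ne_zero ξ |>.hasDerivAt
  set m := magnetization s Ω (fun ξ => polarAngle (v ξ)) φ with hm
  have hmeq : m = fun x t => spherePoint (v (x - s * t)) (φ (x - s * t) + Ω * t) := by
    ext1 x; ext1 t; exact spherePoint_eq_magnetization s Ω v φ x t
  have hsx : ∀ x t, HasDerivAt (fun x : ℝ => x - s * t) 1 x := fun x t =>
    (hasDerivAt_id x).sub_const _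
  have hst : ∀ x t, HasDerivAt (fun t : ℝ => x - s * t) (-s) t := fun x t => by
    simpa using ((hasDerivAt_id t).const_mul s).const_sub x
  have hcx : ∀ {f : ℝ → ℝ} {f' : ℝ} (x t : ℝ), HasDerivAt f f' (x - s * t) →
      HasDerivAt (fun x => f (x - s * t)) f' x := fun x t h => by
    have h1 := h.comp x (hsx x t)
    rw [mul_one] at h1
    exact h1
  have hct : ∀ {f : ℝ → ℝ} {f' : ℝ} (x t : ℝ), HasDerivAt f f' (x - s * t) →
      HasDerivAt (fun t => f (x - s * t)) (-s * f') t := fun x t h => by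
    have h1 := h.comp t (hst x t)
    rw [mul_comm] at h1
    exact h1
  have hx1 : ∀ x t, HasDerivAt (fun x => m x t) (sphereVelocity (v (x - s * t))
      (φ (x - s * t) + Ω * t) (deriv v (x - s * t)) (deriv φ (x - s * t))) x := by
    intro x t
    rw [hmeq]
    exact HasDerivAt.spherePoint (hcx x t (hv1 _)) ((hcx x t (hφ1 _)).add_const (Ω * t))
  have ht1 : ∀ x t, deriv (fun t => m x t) t = sphereVelocity (v (x - s * t))
      (φ (x - s * t) + Ω * t) (-s * deriv v (x - s * t)) (-s * deriv φ (x - s * t) + Ω) := by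
    intro x t
    have h3 := (hasDerivAt_id t).const_mul Ω
    rw [mul_one] at h3
    rw [hmeq]
    exact (HasDerivAt.spherePoint (hct x t (hv1 _)) ((hct x t (hφ1 _)).add h3)).deriv
  have hx2 : ∀ x t, iteratedDeriv 2 (fun x => m x t) x = sphereAcceleration (v (x - s * t))
      (φ (x - s * t) + Ω * t) (deriv v (x - s * t)) (deriv φ (x - s * t))
      (deriv (deriv v) (x - s * t)) (deriv (deriv φ) (x - s * t)) := by
    intro x t
    rw [iteratedDeriv_succ, iteratedDeriv_one, funext fun x => (hx1 x t).deriv]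
    exact (hasDerivAt_sphereVelocity (hcx x t (hv1 _)) ((hcx x t (hφ1 _)).add_const (Ω * t))
      (hcx x t (hv2 _)) (hcx x t (hφ2 _))).deriv
  constructor
  · intro h ξ
    have h1 := h.equation ξ 0
    rw [hx2, ht1, hmeq] at h1
    simp only at h1
    have h2 := (sphere_equation_iff _ _ _ _ _ _ _ _ _).1 h1
    simpa using h2
  · intro h
    have hθ : ContDiff ℝ 2 fun ξ => polarAngle (v ξ) := contDiff_polarAngle.comp hv
    refine ⟨fun t => ?_, fun x => ?_, fun x t => ?_, fun x t => ?_⟩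
    · refine contDiff_pi.2 fun i => ?_
      have h1 : ContDiff ℝ 2 fun x : ℝ => x - s * t := by fun_prop
      have h2 := hθ.comp h1
      have h3 := hφ.comp h1
      fin_cases i
      · exact (Real.contDiff_cos.comp (h3.add contDiff_const)).mul (Real.contDiff_sin.comp h2)
      · exact (Real.contDiff_sin.comp (h3.add contDiff_const)).mul (Real.contDiff_sin.comp h2)
      · exact Real.contDiff_cos.comp h2
    · refine contDiff_pi.2 fun i => ?_
      have h1 : ContDiff ℝ 1 fun t : ℝ => x - s * t := by fun_prop
      have h2 := (hθ.of_le (m := 1) (by norm_num)).comp h1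
      have h3 := (hφ.of_le (m := 1) (by norm_num)).comp h1
      have h4 : ContDiff ℝ 1 fun t : ℝ => Ω * t := by fun_prop
      fin_cases i
      · exact (Real.contDiff_cos.comp (h3.add h4)).mul (Real.contDiff_sin.comp h2)
      · exact (Real.contDiff_sin.comp (h3.add h4)).mul (Real.contDiff_sin.comp h2)
      · exact Real.contDiff_cos.comp h2
    · have h1 := Real.sin_sq_add_cos_sq (φ (x - s * t) + Ω * t)
      have h2 := Real.sin_sq_add_cos_sq (polarAngle (v (x - s * t)))
      simp only [hm, magnetization, dotProduct, Fin.sum_univ_three]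
      simp
      nlinarith
    · rw [hx2, ht1, hmeq]
      exact (sphere_equation_iff _ _ _ _ _ _ _ _ _).2 (h (x - s * t))

end LLGS

/-! ### Return from `v` to the travelling coordinate `ξ` -/

namespace LLGS

open BoundedContinuousFunction

/-- The function stays within `r / 2` of the constant `r`. -/
def NearConst (r : ℝ) (z : ℝ →ᵇ ℂ) : Prop := ‖z - r • (1 : ℝ →ᵇ ℂ)‖ ≤ r / 2

variable {r : ℝ} {z z₁ z₂ : ℝ →ᵇ ℂ}

theorem NearConst.norm_sub_le (hz : NearConst r z) (v : ℝ) : ‖z v - r‖ ≤ r / 2 := by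
  have h := (z - r • (1 : ℝ →ᵇ ℂ)).norm_coe_le_norm v
  have h1 : (z - r • (1 : ℝ →ᵇ ℂ)) v = z v - r := by simp
  rw [h1] at h
  exact h.trans hz

theorem NearConst.half_le_re (hz : NearConst r z) (v : ℝ) : r / 2 ≤ (z v).re := by
  have h := (abs_le.1 ((Complex.abs_re_le_norm _).trans (hz.norm_sub_le v))).1
  simp only [Complex.sub_re, Complex.ofReal_re] at h
  linarith

theorem NearConst.re_le (hz : NearConst r z) (v : ℝ) : (z v).re ≤ 3 * r / 2 := by
  have h := (abs_le.1 ((Complex.abs_re_le_norm _).trans (hz.norm_sub_le v))).2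
  simp only [Complex.sub_re, Complex.ofReal_re] at h
  linarith

theorem NearConst.abs_im_le (hz : NearConst r z) (v : ℝ) : |(z v).im| ≤ r / 2 := by
  have h := (Complex.abs_im_le_norm _).trans (hz.norm_sub_le v)
  simpa only [Complex.sub_im, Complex.ofReal_im, sub_zero] using h

theorem NearConst.re_pos (hr : 0 < r) (hz : NearConst r z) (v : ℝ) : 0 < (z v).re :=
  lt_of_lt_of_le (by linarith) (hz.half_le_re v)

theorem abs_re_sub_le (z₁ z₂ : ℝ →ᵇ ℂ) (v : ℝ) : |(z₁ v).re - (z₂ v).re| ≤ ‖z₁ - z₂‖ := by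
  rw [← Complex.sub_re]
  exact (Complex.abs_re_le_norm _).trans ((z₁ - z₂).norm_coe_le_norm v)

theorem abs_im_sub_le (z₁ z₂ : ℝ →ᵇ ℂ) (v : ℝ) : |(z₁ v).im - (z₂ v).im| ≤ ‖z₁ - z₂‖ := by
  rw [← Complex.sub_im]
  exact (Complex.abs_im_le_norm _).trans ((z₁ - z₂).norm_coe_le_norm v)

theorem abs_inv_sub_inv_le (hr : 0 < r) (h₁ : NearConst r z₁) (h₂ : NearConst r z₂) (v : ℝ) :
    |(z₁ v).re⁻¹ - (z₂ v).re⁻¹| ≤ 4 / r ^ 2 * ‖z₁ - z₂‖ := by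
  have p1 := h₁.re_pos hr v
  have p2 := h₂.re_pos hr v
  rw [inv_sub_inv p1.ne' p2.ne', abs_div, abs_of_pos (mul_pos p1 p2), div_le_iff₀ (mul_pos p1 p2),
    abs_sub_comm]
  refine (abs_re_sub_le z₁ z₂ v).trans ?_
  have h3 : r / 2 * (r / 2) ≤ (z₁ v).re * (z₂ v).re :=
    mul_le_mul (h₁.half_le_re v) (h₂.half_le_re v) (by linarith) p1.le
  calc ‖z₁ - z₂‖ = 4 / r ^ 2 * ‖z₁ - z₂‖ * (r / 2 * (r / 2)) := by field_simp; ring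
    _ ≤ _ := by gcongr

theorem abs_slope_sub_le (hr : 0 < r) (h₁ : NearConst r z₁) (h₂ : NearConst r z₂) (v : ℝ) :
    |(z₁ v).im / (z₁ v).re - (z₂ v).im / (z₂ v).re| ≤ 4 / r * ‖z₁ - z₂‖ := by
  have p1 := h₁.re_pos hr v
  have h3 : (z₁ v).im / (z₁ v).re - (z₂ v).im / (z₂ v).re =
      ((z₁ v).im - (z₂ v).im) * (z₁ v).re⁻¹ + (z₂ v).im * ((z₁ v).re⁻¹ - (z₂ v).re⁻¹) := by
    rw [div_eq_mul_inv, div_eq_mul_inv]; ring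
  have h4 : |(z₁ v).re⁻¹| ≤ 2 / r := by
    rw [abs_of_pos (inv_pos.2 p1), inv_le_comm₀ p1 (by positivity), inv_div]
    exact h₁.half_le_re v
  rw [h3]
  refine (abs_add_le _ _).trans ?_
  rw [abs_mul, abs_mul]
  calc _ ≤ ‖z₁ - z₂‖ * (2 / r) + r / 2 * (4 / r ^ 2 * ‖z₁ - z₂‖) := by
        gcongr
        · exact abs_im_sub_le z₁ z₂ v
        · exact h₂.abs_im_le v
        · exact abs_inv_sub_inv_le hr h₁ h₂ v
    _ = _ := by field_simp; ring

theorem abs_slope_le_one (hr : 0 < r) (hz : NearConst r z) (v : ℝ) :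
    |(z v).im / (z v).re| ≤ 1 := by
  have p1 := hz.re_pos hr v
  rw [abs_div, abs_of_pos p1, div_le_one p1]
  exact (hz.abs_im_le v).trans (hz.half_le_re v)

theorem continuous_inv_re (hr : 0 < r) (hz : NearConst r z) : Continuous fun v => (z v).re⁻¹ :=
  (Complex.continuous_re.comp z.continuous).inv₀ fun v => (hz.re_pos hr v).ne'

theorem continuous_slope (hr : 0 < r) (hz : NearConst r z) :
    Continuous fun v => (z v).im / (z v).re :=
  (Complex.continuous_im.comp z.continuous).div (Complex.continuous_re.comp z.continuous)
    fun v => (hz.re_pos hr v).ne'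

/-- The travel coordinate `ξ` as a function of `v = log tan (θ / 2)`. -/
noncomputable def travel (z : ℝ →ᵇ ℂ) (v : ℝ) : ℝ := ∫ w in (0 : ℝ)..v, (z w).re⁻¹

/-- The azimuth as a function of `v = log tan (θ / 2)`. -/
noncomputable def azimuth (z : ℝ →ᵇ ℂ) (v : ℝ) : ℝ := ∫ w in (0 : ℝ)..v, (z w).im / (z w).re

/-- The coordinate `v = log tan (θ / 2)` as a function of `ξ`. -/
noncomputable def position (z : ℝ →ᵇ ℂ) : ℝ → ℝ := Function.invFun (travel z)

theorem hasDerivAt_travel (hr : 0 < r) (hz : NearConst r z) (v : ℝ) :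
    HasDerivAt (travel z) (z v).re⁻¹ v :=
  ((continuous_inv_re hr hz).integral_hasStrictDerivAt 0 v).hasDerivAt

theorem hasDerivAt_azimuth (hr : 0 < r) (hz : NearConst r z) (v : ℝ) :
    HasDerivAt (azimuth z) ((z v).im / (z v).re) v :=
  ((continuous_slope hr hz).integral_hasStrictDerivAt 0 v).hasDerivAt

/-- The slope of `travel` is `1 / Re z ≥ 2 / (3 r)`. This expansion gives both surjectivity and the
Lipschitz bound for the inverse `position`. -/
theorem abs_sub_le_travel (hr : 0 < r) (hz : NearConst r z) (v w : ℝ) :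
    |v - w| ≤ 3 * r / 2 * |travel z v - travel z w| := by
  have hmono : Monotone fun v => 3 * r / 2 * travel z v - v := by
    refine monotone_of_hasDerivAt_nonneg
      (f' := fun v => 3 * r / 2 * (z v).re⁻¹ - 1) (fun v =>
        ((hasDerivAt_travel hr hz v).const_mul _).sub (hasDerivAt_id v)) fun v => ?_
    have p1 := hz.re_pos hr v
    have := hz.re_le v
    change (0 : ℝ) ≤ 3 * r / 2 * (z v).re⁻¹ - 1
    rw [sub_nonneg, ← div_eq_mul_inv, one_le_div p1]
    exact this
  wlog h : w ≤ v generalizing v w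
  · rw [abs_sub_comm, abs_sub_comm (travel z v)]
    exact this w v (not_le.1 h).le
  have h1 := hmono h
  simp only at h1
  rw [abs_of_nonneg (sub_nonneg.2 h)]
  have h2 := le_abs_self (travel z v - travel z w)
  nlinarith

theorem travel_zero : travel z 0 = 0 := by simp [travel]

theorem travel_bijective (hr : 0 < r) (hz : NearConst r z) : Function.Bijective (travel z) := by
  have hcont : Continuous (travel z) :=
    continuous_iff_continuousAt.2 fun v => (hasDerivAt_travel hr hz v).continuousAt
  have hmono : StrictMono (travel z) := strictMono_of_deriv_pos fun v => by
    rw [(hasDerivAt_travel hr hz v).deriv]; exact inv_pos.2 (hz.re_pos hr v)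
  refine ⟨hmono.injective, ?_⟩
  have hbound : ∀ v, |v| ≤ 3 * r / 2 * |travel z v| := fun v => by
    simpa [travel_zero] using abs_sub_le_travel hr hz v 0
  refine hcont.surjective ?_ ?_
  · refine tendsto_atTop_mono' atTop (f₁ := fun v => v / (3 * r / 2)) ?_
      (tendsto_id.atTop_div_const (by positivity))
    filter_upwards [eventually_ge_atTop 0] with v hv
    have h0 : 0 ≤ travel z v := by rw [← travel_zero (z := z)]; exact hmono.monotone hv
    have := hbound v
    rw [abs_of_nonneg hv, abs_of_nonneg h0] at this
    rw [div_le_iff₀ (by positivity)]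
    linarith
  · refine tendsto_atBot_mono' atBot (f₁ := fun v => v / (3 * r / 2)) ?_
      (tendsto_id.atBot_div_const (by positivity))
    filter_upwards [eventually_le_atBot 0] with v hv
    have h0 : travel z v ≤ 0 := by rw [← travel_zero (z := z)]; exact hmono.monotone hv
    have := hbound v
    rw [abs_of_nonpos hv, abs_of_nonpos h0] at this
    rw [le_div_iff₀ (by positivity)]
    linarith

theorem travel_position (hr : 0 < r) (hz : NearConst r z) (ξ : ℝ) :
    travel z (position z ξ) = ξ :=
  Function.rightInverse_invFun (travel_bijective hr hz).2 ξ

theorem position_travel (hr : 0 < r) (hz : NearConst r z) (v : ℝ) :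
    position z (travel z v) = v :=
  Function.leftInverse_invFun (travel_bijective hr hz).1 v

theorem position_zero (hr : 0 < r) (hz : NearConst r z) : position z 0 = 0 := by
  have := position_travel hr hz 0
  rwa [travel_zero] at this

/-- The two travel integrals up to `position z₂ ξ₂` differ by at most its length times the distance
of the integrands. The error is thus relative to `|position z₂ ξ₂|`, the form that
`abs_polarAngle_sub_le` needs. -/
theorem abs_position_sub_le (hr : 0 < r) (h₁ : NearConst r z₁) (h₂ : NearConst r z₂)
    (ξ₁ ξ₂ : ℝ) : |position z₁ ξ₁ - position z₂ ξ₂| ≤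
      3 * r / 2 * (|ξ₁ - ξ₂| + 4 / r ^ 2 * ‖z₁ - z₂‖ * |position z₂ ξ₂|) := by
  refine (abs_sub_le_travel hr h₁ _ _).trans ?_
  gcongr
  rw [travel_position hr h₁]
  have h3 : |travel z₂ (position z₂ ξ₂) - travel z₁ (position z₂ ξ₂)| ≤
      4 / r ^ 2 * ‖z₁ - z₂‖ * |position z₂ ξ₂| := by
    rw [travel, travel, ← intervalIntegral.integral_sub
      ((continuous_inv_re hr h₂).intervalIntegrable _ _)
      ((continuous_inv_re hr h₁).intervalIntegrable _ _)]
    have := intervalIntegral.norm_integral_le_of_norm_le_const (a := 0) (b := position z₂ ξ₂)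
      (f := fun w => (z₂ w).re⁻¹ - (z₁ w).re⁻¹) (C := 4 / r ^ 2 * ‖z₁ - z₂‖) fun w _ => by
        rw [Real.norm_eq_abs, abs_sub_comm]
        exact abs_inv_sub_inv_le hr h₁ h₂ w
    rwa [sub_zero] at this
  rw [travel_position hr h₂] at h3
  exact (abs_sub_le _ ξ₂ _).trans (by linarith)

theorem continuous_position (hr : 0 < r) (hz : NearConst r z) : Continuous (position z) := by
  refine Metric.continuous_iff.2 fun ξ ε hε => ⟨ε / (3 * r / 2), by positivity, fun η hη => ?_⟩
  have h := abs_position_sub_le hr hz hz η ξ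
  rw [sub_self, norm_zero, mul_zero, zero_mul, add_zero] at h
  rw [Real.dist_eq] at hη ⊢
  refine h.trans_lt ?_
  rwa [mul_comm, ← lt_div_iff₀ (by positivity)]

theorem hasDerivAt_position (hr : 0 < r) (hz : NearConst r z) (ξ : ℝ) :
    HasDerivAt (position z) (z (position z ξ)).re ξ := by
  have h := HasDerivAt.of_local_left_inverse (continuous_position hr hz).continuousAt
    (hasDerivAt_travel hr hz (position z ξ)) (inv_ne_zero (hz.re_pos hr _).ne')
    (Eventually.of_forall fun η => travel_position hr hz η)
  rwa [inv_inv] at h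

/-- `travel z (v ξ) - ξ` has zero derivative, so the only freedom is a translation in `ξ`. -/
theorem eq_position_of_hasDerivAt (hr : 0 < r) (hz : NearConst r z) {v : ℝ → ℝ}
    (hv : ∀ ξ, HasDerivAt v (z (v ξ)).re ξ) (ξ : ℝ) :
    v ξ = position z (ξ + travel z (v 0)) := by
  have h1 : ∀ ξ, HasDerivAt (fun ξ => travel z (v ξ) - ξ) 0 ξ := fun ξ => by
    have := ((hasDerivAt_travel hr hz (v ξ)).comp ξ (hv ξ)).sub (hasDerivAt_id ξ)
    rwa [inv_mul_cancel₀ (hz.re_pos hr _).ne', sub_self] at this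
  have h2 := is_const_of_deriv_eq_zero (fun ξ => (h1 ξ).differentiableAt)
    (fun ξ => (h1 ξ).deriv) ξ 0
  simp only [sub_zero] at h2
  rw [← h2, add_sub_cancel, position_travel hr hz]

theorem tendsto_position_atTop (hr : 0 < r) (hz : NearConst r z) :
    Tendsto (position z) atTop atTop := by
  have hmono : StrictMono (position z) := strictMono_of_deriv_pos fun ξ => by
    rw [(hasDerivAt_position hr hz ξ).deriv]; exact hz.re_pos hr _
  exact tendsto_atTop_atTop_of_monotone hmono.monotone fun b =>
    ⟨travel z b, (position_travel hr hz b).ge⟩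

theorem tendsto_position_atBot (hr : 0 < r) (hz : NearConst r z) :
    Tendsto (position z) atBot atBot := by
  have hmono : StrictMono (position z) := strictMono_of_deriv_pos fun ξ => by
    rw [(hasDerivAt_position hr hz ξ).deriv]; exact hz.re_pos hr _
  exact tendsto_atBot_atBot_of_monotone hmono.monotone fun b =>
    ⟨travel z b, (position_travel hr hz b).le⟩

theorem abs_azimuth_sub_le (hr : 0 < r) (h₁ : NearConst r z₁) (h₂ : NearConst r z₂) (v₁ v₂ : ℝ) :
    |azimuth z₁ v₁ - azimuth z₂ v₂| ≤ |v₁ - v₂| + 4 / r * ‖z₁ - z₂‖ * |v₂| := by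
  have i1 := fun a b => (continuous_slope hr h₁).intervalIntegrable (μ := MeasureTheory.volume) a b
  have i2 := fun a b => (continuous_slope hr h₂).intervalIntegrable (μ := MeasureTheory.volume) a b
  have e1 : |azimuth z₁ v₁ - azimuth z₁ v₂| ≤ |v₁ - v₂| := by
    rw [azimuth, azimuth, intervalIntegral.integral_interval_sub_left (i1 _ _) (i1 _ _)]
    have := intervalIntegral.norm_integral_le_of_norm_le_const (a := v₂) (b := v₁) (C := 1)
      (f := fun w => (z₁ w).im / (z₁ w).re) fun w _ => abs_slope_le_one hr h₁ w
    rwa [one_mul] at this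
  have e2 : |azimuth z₁ v₂ - azimuth z₂ v₂| ≤ 4 / r * ‖z₁ - z₂‖ * |v₂| := by
    rw [azimuth, azimuth, ← intervalIntegral.integral_sub (i1 _ _) (i2 _ _)]
    have := intervalIntegral.norm_integral_le_of_norm_le_const (a := 0) (b := v₂)
      (f := fun w => (z₁ w).im / (z₁ w).re - (z₂ w).im / (z₂ w).re)
      (C := 4 / r * ‖z₁ - z₂‖) fun w _ => abs_slope_sub_le hr h₁ h₂ w
    rwa [sub_zero] at this
  exact (abs_sub_le _ (azimuth z₁ v₂) _).trans (add_le_add e1 e2)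

theorem hasDerivAt_azimuth_position (hr : 0 < r) (hz : NearConst r z) (ξ : ℝ) :
    HasDerivAt (fun ξ => azimuth z (position z ξ)) (z (position z ξ)).im ξ := by
  have h := (hasDerivAt_azimuth hr hz (position z ξ)).comp ξ (hasDerivAt_position hr hz ξ)
  rwa [div_mul_cancel₀ _ (hz.re_pos hr _).ne'] at h

theorem hasDerivAt_profile_position (hr : 0 < r) (hz : NearConst r z) {P : Params} {s Ω : ℝ}
    (hprof : IsProfile P s Ω z) (ξ : ℝ) :
    HasDerivAt (fun ξ => z (position z ξ))
      (riccati P s Ω (z (position z ξ)) (Real.tanh (position z ξ))) ξ := by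
  have h := (hprof (position z ξ)).scomp ξ (hasDerivAt_position hr hz ξ)
  refine h.congr_deriv ?_
  rw [Complex.real_smul, mul_div_cancel₀]
  exact Complex.ofReal_ne_zero.2 (hz.re_pos hr _).ne'

end LLGS

/-! ### Joint smoothness in parameters and `ξ` -/

namespace LLGS

open BoundedContinuousFunction

/-- Phase space of the polynomial system for `(v, tanh v, φ, 1 / (1 - c tanh v), z)`, with speed,
frequency and parameters as constants. -/
abbrev PolyState : Type := ℝ × ℝ × ℝ × ℝ × ℂ × ℝ × ℝ × Params

/-- The polynomial vector field whose flow contains the domain walls. -/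
noncomputable def polyField : PolyState → PolyState := fun X =>
  let t := X.2.1
  let d := X.2.2.2.1
  let z := X.2.2.2.2.1
  let s := X.2.2.2.2.2.1
  let Ω := X.2.2.2.2.2.2.1
  let P := X.2.2.2.2.2.2.2
  (z.re, (1 - t ^ 2) * z.re, z.im, P.ccp * d ^ 2 * ((1 - t ^ 2) * z.re),
    (t : ℂ) * z ^ 2 - s * (P.alpha + Complex.I) * z + (P.field - Ω) + P.mu * t +
      Complex.I * (P.alpha * Ω - P.beta * d), 0, 0, 0)

/-- Keeping `1 / (1 - c tanh v)` as a separate coordinate makes the field polynomial, hence smooth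
everywhere, as `contDiffAt_solution_family` requires. -/
theorem contDiff_polyField : ContDiff ℝ ∞ polyField := by
  have hre : ContDiff ℝ ∞ Complex.re := Complex.reCLM.contDiff
  have him : ContDiff ℝ ∞ Complex.im := Complex.imCLM.contDiff
  have hof : ContDiff ℝ ∞ ((↑) : ℝ → ℂ) := Complex.ofRealCLM.contDiff
  have hz : ContDiff ℝ ∞ fun X : PolyState => X.2.2.2.2.1 := by fun_prop
  have h1 : ContDiff ℝ ∞ fun X : PolyState => X.2.2.2.2.1.re := hre.comp hz
  have h2 : ContDiff ℝ ∞ fun X : PolyState => X.2.2.2.2.1.im := him.comp hz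
  have h3 : ContDiff ℝ ∞ fun X : PolyState => (X.2.1 : ℂ) := hof.comp (by fun_prop)
  have h4 : ContDiff ℝ ∞ fun X : PolyState => (X.2.2.2.1 : ℂ) := hof.comp (by fun_prop)
  have h5 : ContDiff ℝ ∞ fun X : PolyState => (X.2.2.2.2.2.1 : ℂ) := hof.comp (by fun_prop)
  have h6 : ContDiff ℝ ∞ fun X : PolyState => (X.2.2.2.2.2.2.1 : ℂ) := hof.comp (by fun_prop)
  have h7 : ContDiff ℝ ∞ fun X : PolyState => (X.2.2.2.2.2.2.2.alpha : ℂ) :=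
    hof.comp (by fun_prop)
  have h8 : ContDiff ℝ ∞ fun X : PolyState => (X.2.2.2.2.2.2.2.beta : ℂ) :=
    hof.comp (by fun_prop)
  have h9 : ContDiff ℝ ∞ fun X : PolyState => (X.2.2.2.2.2.2.2.field : ℂ) :=
    hof.comp (by fun_prop)
  have h10 : ContDiff ℝ ∞ fun X : PolyState => (X.2.2.2.2.2.2.2.mu : ℂ) :=
    hof.comp (by fun_prop)
  unfold polyField
  fun_prop

variable {r : ℝ} {z : ℝ →ᵇ ℂ}

/-- The domain wall with profile `z`, as a solution of the polynomial system. -/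
noncomputable def wallState (z : ℝ →ᵇ ℂ) (s Ω : ℝ) (P : Params) (ξ : ℝ) : PolyState :=
  (position z ξ, Real.tanh (position z ξ), azimuth z (position z ξ),
    (1 - P.ccp * Real.tanh (position z ξ))⁻¹, z (position z ξ), s, Ω, P)

theorem one_sub_mul_tanh_pos {c : ℝ} (hc : |c| < 1) (v : ℝ) : 0 < 1 - c * Real.tanh v := by
  have h1 : |c * Real.tanh v| < 1 := by
    rw [abs_mul]
    exact mul_lt_one_of_nonneg_of_lt_one_left (abs_nonneg _) hc (abs_tanh_lt_one v).le
  linarith [(abs_lt.1 h1).2]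

theorem hasDerivAt_wallState (hr : 0 < r) (hz : NearConst r z) {P : Params} {s Ω : ℝ}
    (hprof : IsProfile P s Ω z) (hc : |P.ccp| < 1) (ξ : ℝ) :
    HasDerivAt (wallState z s Ω P) (polyField (wallState z s Ω P ξ)) ξ := by
  have h1 := hasDerivAt_position hr hz ξ
  have h2 := (hasDerivAt_tanh (position z ξ)).comp ξ h1
  have h3 := hasDerivAt_azimuth_position hr hz ξ
  have h4 := ((h2.const_mul P.ccp).const_sub 1).inv (one_sub_mul_tanh_pos hc _).ne'
  have h5 := hasDerivAt_profile_position hr hz hprof ξ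
  refine (h1.prodMk (h2.prodMk (h3.prodMk (h4.prodMk (h5.prodMk ((hasDerivAt_const ξ s).prodMk
    ((hasDerivAt_const ξ Ω).prodMk (hasDerivAt_const ξ P)))))))).congr_deriv ?_
  simp only [polyField, wallState, riccati, Function.comp]
  refine Prod.ext rfl (Prod.ext rfl (Prod.ext rfl (Prod.ext ?_ (Prod.ext ?_ rfl))))
  · simp only
    have := (one_sub_mul_tanh_pos hc (position z ξ)).ne'
    field_simp
  · simp only
    push_cast
    rw [div_eq_mul_inv]

theorem continuousAt_wallState (hr : 0 < r) {zf : Params → ℝ →ᵇ ℂ} {s Ω : Params → ℝ}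
    {P₁ : Params} (hz : ∀ᶠ P in 𝓝 P₁, NearConst r (zf P)) (hzc : ContinuousAt zf P₁)
    (hs : ContinuousAt s P₁) (hΩ : ContinuousAt Ω P₁) (hc : |P₁.ccp| < 1) (ξ₁ : ℝ) :
    ContinuousAt (fun w : Params × ℝ => wallState (zf w.1) (s w.1) (Ω w.1) w.1 w.2) (P₁, ξ₁) := by
  have hz1 : NearConst r (zf P₁) := hz.self_of_nhds
  have hfst : Tendsto (Prod.fst : Params × ℝ → Params) (𝓝 (P₁, ξ₁)) (𝓝 P₁) := continuousAt_fst
  have hsnd : Tendsto (Prod.snd : Params × ℝ → ℝ) (𝓝 (P₁, ξ₁)) (𝓝 ξ₁) := continuousAt_snd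
  have hzf : ContinuousAt (fun w : Params × ℝ => zf w.1) (P₁, ξ₁) := hzc.tendsto.comp hfst
  have hnorm : Tendsto (fun w : Params × ℝ => ‖zf w.1 - zf P₁‖) (𝓝 (P₁, ξ₁)) (𝓝 0) :=
    (tendsto_iff_norm_sub_tendsto_zero.1 hzc).comp hfst
  have hξ : Tendsto (fun w : Params × ℝ => |w.2 - ξ₁|) (𝓝 (P₁, ξ₁)) (𝓝 0) :=
    (tendsto_iff_norm_sub_tendsto_zero.1 hsnd)
  have hpos : ContinuousAt (fun w : Params × ℝ => position (zf w.1) w.2) (P₁, ξ₁) := by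
    refine tendsto_iff_norm_sub_tendsto_zero.2 (squeeze_zero' (Eventually.of_forall fun _ =>
      norm_nonneg _) ((hfst.eventually hz).mono fun w hw =>
        abs_position_sub_le hr hw hz1 w.2 ξ₁) ?_)
    have := (hξ.add ((hnorm.const_mul (4 / r ^ 2)).mul_const |position (zf P₁) ξ₁|)).const_mul
      (3 * r / 2)
    simpa using this
  have htanh : ContinuousAt (fun w : Params × ℝ => Real.tanh (position (zf w.1) w.2)) (P₁, ξ₁) :=
    continuous_tanh.continuousAt.comp hpos
  have hazim : ContinuousAt (fun w : Params × ℝ => azimuth (zf w.1) (position (zf w.1) w.2))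
      (P₁, ξ₁) := by
    refine tendsto_iff_norm_sub_tendsto_zero.2 (squeeze_zero' (Eventually.of_forall fun _ =>
      norm_nonneg _) ((hfst.eventually hz).mono fun w hw =>
        abs_azimuth_sub_le hr hw hz1 (position (zf w.1) w.2) (position (zf P₁) ξ₁)) ?_)
    have := (tendsto_iff_norm_sub_tendsto_zero.1 hpos).add
      ((hnorm.const_mul (4 / r)).mul_const |position (zf P₁) ξ₁|)
    simpa using this
  have hd : ContinuousAt (fun w : Params × ℝ =>
      (1 - w.1.ccp * Real.tanh (position (zf w.1) w.2))⁻¹) (P₁, ξ₁) := by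
    refine ContinuousAt.inv₀ (continuousAt_const.sub (ContinuousAt.mul ?_ htanh))
      (one_sub_mul_tanh_pos hc _).ne'
    fun_prop
  have heval : ContinuousAt (fun w : Params × ℝ => zf w.1 (position (zf w.1) w.2)) (P₁, ξ₁) :=
    hzf.eval hpos
  have hs' : ContinuousAt (fun w : Params × ℝ => s w.1) (P₁, ξ₁) := hs.tendsto.comp hfst
  have hΩ' : ContinuousAt (fun w : Params × ℝ => Ω w.1) (P₁, ξ₁) := hΩ.tendsto.comp hfst
  exact hpos.prodMk (htanh.prodMk (hazim.prodMk (hd.prodMk (heval.prodMk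
    (hs'.prodMk (hΩ'.prodMk continuousAt_fst))))))

/-- A smooth map into bounded functions is not by itself jointly smooth in the parameter and the
point. The walls, however, solve one smooth autonomous system, they are jointly continuous, and
since `position` vanishes at `ξ = 0` their data there involve only `z P 0`, `s P`, `Ω P` and `P`. -/
theorem contDiffAt_wallState (hr : 0 < r) {zf : Params → ℝ →ᵇ ℂ} {s Ω : Params → ℝ}
    {P₁ : Params} (hz : ∀ᶠ P in 𝓝 P₁, NearConst r (zf P))
    (hprof : ∀ᶠ P in 𝓝 P₁, IsProfile P (s P) (Ω P) (zf P))
    (hzc : ContDiffAt ℝ ∞ zf P₁) (hs : ContDiffAt ℝ ∞ s P₁) (hΩ : ContDiffAt ℝ ∞ Ω P₁)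
    (hc : |P₁.ccp| < 1) (ξ₁ : ℝ) :
    ContDiffAt ℝ ∞ (fun w : Params × ℝ => wallState (zf w.1) (s w.1) (Ω w.1) w.1 w.2)
      (P₁, ξ₁) := by
  have hc' : ∀ᶠ P : Params in 𝓝 P₁, |P.ccp| < 1 := by
    have : ContinuousAt (fun P : Params => |P.ccp|) P₁ := by fun_prop
    exact this.eventually_lt_const hc
  refine contDiffAt_solution_family contDiff_polyField ?_ (fun ξ => ?_) ?_ ξ₁
  · filter_upwards [hz, hprof, hc'] with P h1 h2 h3 ξ
    exact hasDerivAt_wallState hr h1 h2 h3 ξ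
  · exact continuousAt_wallState hr hz hzc.continuousAt hs.continuousAt hΩ.continuousAt hc ξ
  · have h0 : (fun P => wallState (zf P) (s P) (Ω P) P 0) =ᶠ[𝓝 P₁]
        fun P => ((0, 0, 0, 1, zf P 0, s P, Ω P, P) : PolyState) := by
      filter_upwards [hz] with P h1
      simp [wallState, position_zero hr h1, azimuth]
    refine ContDiffAt.congr_of_eventuallyEq ?_ h0
    have hev : ContDiffAt ℝ ∞ (fun P => zf P 0) P₁ :=
      (BoundedContinuousFunction.evalCLM ℝ (0 : ℝ) : (ℝ →ᵇ ℂ) →L[ℝ] ℂ).contDiff.contDiffAt.comp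
        P₁ hzc
    fun_prop

end LLGS

/-! ### Walls from profiles: solution property, flatness, inhomogeneity -/

namespace LLGS

open BoundedContinuousFunction

variable {r : ℝ} {z : ℝ →ᵇ ℂ} {P : Params} {s Ω : ℝ}

theorem riccati_re_im (P : Params) (s Ω : ℝ) (z : ℂ) (t : ℝ) :
    (riccati P s Ω z t).re = riccatiRe P s Ω z.re z.im t ∧
      (riccati P s Ω z t).im = riccatiIm P s Ω z.re z.im t := by
  have h := riccati_eq P s Ω z.re z.im t
  rw [Complex.re_add_im] at h
  rw [h]
  constructor <;> simp

theorem HasDerivAt.complex_re {f : ℝ → ℂ} {f' : ℂ} {x : ℝ} (h : HasDerivAt f f' x) :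
    HasDerivAt (fun x => (f x).re) f'.re x :=
  Complex.reCLM.hasFDerivAt.comp_hasDerivAt x h

theorem HasDerivAt.complex_im {f : ℝ → ℂ} {f' : ℂ} {x : ℝ} (h : HasDerivAt f f' x) :
    HasDerivAt (fun x => (f x).im) f'.im x :=
  Complex.imCLM.hasFDerivAt.comp_hasDerivAt x h

/-- The polar angle of the wall with profile `z`. -/
noncomputable def wallTheta (z : ℝ →ᵇ ℂ) (ξ : ℝ) : ℝ := polarAngle (position z ξ)

/-- The azimuth of the wall with profile `z`. -/
noncomputable def wallPhi (z : ℝ →ᵇ ℂ) (ξ : ℝ) : ℝ := azimuth z (position z ξ)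

theorem contDiff_two_of_hasDerivAt {f g h : ℝ → ℝ} (hf : ∀ x, HasDerivAt f (g x) x)
    (hg : ∀ x, HasDerivAt g (h x) x) (hh : Continuous h) : ContDiff ℝ 2 f := by
  have e1 : deriv f = g := funext fun x => (hf x).deriv
  have e2 : deriv g = h := funext fun x => (hg x).deriv
  have h1 : ContDiff ℝ 1 g := contDiff_one_iff_deriv.2
    ⟨fun x => (hg x).differentiableAt, by rwa [e2]⟩
  refine (contDiff_succ_iff_deriv (n := 1)).2 ⟨fun x => (hf x).differentiableAt, by simp, ?_⟩
  rwa [e1]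

theorem continuous_riccati_position (hr : 0 < r) (hz : NearConst r z) (hc : |P.ccp| < 1) :
    Continuous fun ξ => riccati P s Ω (z (position z ξ)) (Real.tanh (position z ξ)) := by
  have hv := continuous_position hr hz
  have ht : Continuous fun ξ => ((Real.tanh (position z ξ) : ℝ) : ℂ) :=
    Complex.continuous_ofReal.comp (continuous_tanh.comp hv)
  have hzv : Continuous fun ξ => z (position z ξ) := z.continuous.comp hv
  have hd : Continuous fun ξ => (P.beta : ℂ) / (1 - P.ccp * (Real.tanh (position z ξ) : ℂ)) := by
    refine continuous_const.div (continuous_const.sub (continuous_const.mul ht)) fun ξ => ?_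
    have := (one_sub_mul_tanh_pos hc (position z ξ)).ne'
    exact_mod_cast this
  unfold riccati
  exact ((((ht.mul (hzv.pow 2)).sub (continuous_const.mul hzv)).add continuous_const).add
    (continuous_const.mul ht)).add (continuous_const.mul (continuous_const.sub hd))

theorem polarAngle_mem_Ioo (v : ℝ) : polarAngle v ∈ Set.Ioo 0 Real.pi := by
  have h1 := Real.arctan_pos.2 (Real.exp_pos v)
  have h2 := Real.arctan_lt_pi_div_two (Real.exp v)
  constructor <;> simp only [polarAngle] <;> linarith

theorem tendsto_profile {v : ℝ → ℝ} {L : Filter ℝ} {e : ℝ} (he : e ^ 2 = 1)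
    (h : Tendsto (fun ξ => Real.tanh (v ξ)) L (𝓝 e)) :
    Tendsto (profile fun ξ => polarAngle (v ξ)) L (𝓝 (-e • e3)) := by
  refine tendsto_pi_nhds.2 fun i => ?_
  fin_cases i
  · have h1 : ∀ ξ, Real.sqrt (1 - Real.tanh (v ξ) ^ 2) = 1 / Real.cosh (v ξ) := fun ξ => by
      rw [← inv_cosh_sq, Real.sqrt_sq (by have := Real.cosh_pos (v ξ); positivity)]
    have h2 := (Real.continuous_sqrt.tendsto _).comp ((h.pow 2).const_sub 1)
    rw [he, sub_self, Real.sqrt_zero] at h2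
    simp only [profile, sin_polarAngle, e3]
    simpa using h2.congr h1
  · simpa [profile, e3] using tendsto_const_nhds
  · simpa [profile, cos_polarAngle, e3] using h.neg

theorem deriv_position (hr : 0 < r) (hz : NearConst r z) :
    deriv (position z) = fun ξ => (z (position z ξ)).re :=
  funext fun ξ => (hasDerivAt_position hr hz ξ).deriv

theorem deriv_wallPhi (hr : 0 < r) (hz : NearConst r z) :
    deriv (wallPhi z) = fun ξ => (z (position z ξ)).im :=
  funext fun ξ => (hasDerivAt_azimuth_position hr hz ξ).deriv

theorem isDomainWall_of_isProfile (hr : 0 < r) (hz : NearConst r z) (hc : |P.ccp| < 1)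
    (hprof : IsProfile P s Ω z) : IsDomainWall P s Ω (wallTheta z) (wallPhi z) := by
  have hd := hasDerivAt_profile_position hr hz hprof
  have hcr := continuous_riccati_position (s := s) (Ω := Ω) (P := P) hr hz hc
  have hv2 : ContDiff ℝ 2 (position z) := contDiff_two_of_hasDerivAt (hasDerivAt_position hr hz)
    (fun ξ => HasDerivAt.complex_re (hd ξ)) (Complex.continuous_re.comp hcr)
  have hφ2 : ContDiff ℝ 2 (wallPhi z) :=
    contDiff_two_of_hasDerivAt (hasDerivAt_azimuth_position hr hz)
      (fun ξ => HasDerivAt.complex_im (hd ξ)) (Complex.continuous_im.comp hcr)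
  refine ⟨contDiff_polarAngle.comp hv2, hφ2, fun ξ => polarAngle_mem_Ioo _, ?_, Or.inl ⟨?_, ?_⟩⟩
  · refine (isSolution_iff P s Ω hv2 hφ2).2 fun ξ => ?_
    rw [deriv_position hr hz, deriv_wallPhi hr hz]
    obtain ⟨h1, h2⟩ := riccati_re_im P s Ω (z (position z ξ)) (Real.tanh (position z ξ))
    exact ⟨(HasDerivAt.complex_re (hd ξ)).deriv.trans h1,
      (HasDerivAt.complex_im (hd ξ)).deriv.trans h2⟩
  · have := tendsto_profile (v := position z) (by norm_num)
      (tendsto_tanh_atBot.comp (tendsto_position_atBot hr hz))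
    change Tendsto (profile fun ξ => polarAngle (position z ξ)) _ _
    simpa using this
  · have := tendsto_profile (v := position z) (by norm_num)
      (tendsto_tanh_atTop.comp (tendsto_position_atTop hr hz))
    change Tendsto (profile fun ξ => polarAngle (position z ξ)) _ _
    simpa using this

theorem isFlat_of_hasLimits (hr : 0 < r) (hz : NearConst r z) (hl : HasLimits z) :
    IsFlat (wallPhi z) := by
  have main : ∀ {L L' : Filter ℝ} {l : ℂ}, Tendsto (position z) L L' → Tendsto z L' (𝓝 l) →
      Tendsto (fun ξ => ((|wavenumber (wallPhi z) ξ| : ℝ) : EReal)) L (𝓝 (|l.im| : ℝ)) := by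
    intro L L' l h1 h2
    have h3 : Tendsto (fun ξ => |(z (position z ξ)).im|) L (𝓝 |l.im|) :=
      (((Complex.continuous_im.tendsto l).comp h2).comp h1).abs
    simp only [wavenumber, deriv_wallPhi hr hz]
    exact (continuous_coe_real_ereal.tendsto _).comp h3
  obtain ⟨⟨l, hl⟩, ⟨l', hl'⟩⟩ := hl
  exact ⟨⟨_, main (tendsto_position_atBot hr hz) hl⟩, ⟨_, main (tendsto_position_atTop hr hz) hl'⟩⟩

/-- If `q = 0`, the imaginary part of the equation gives `s p` as a rational function of `t = tanh
v` with a pole at `1 / c`. Inserted in the real part, multiplied by powers of `s` so that `s = 0`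
needs no separate case, it yields a polynomial identity on `(-1, 1)`, hence everywhere; at the pole
it reads `β² (1 - c²) = 0`. -/
theorem not_isHomogeneous_wallPhi (hr : 0 < r) (hz : NearConst r z) (hc : |P.ccp| < 1)
    (hprof : IsProfile P s Ω z) (hc0 : P.ccp ≠ 0) (hβ : P.beta ≠ 0) :
    ¬ IsHomogeneous (wallPhi z) := by
  rintro ⟨φ₀, hφ⟩
  have hq : ∀ v, (z v).im = 0 := by
    intro v
    have h1 : deriv (wallPhi z) (travel z v) = 0 := by
      rw [show wallPhi z = fun _ => φ₀ from funext hφ, deriv_const]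
    simp only [deriv_wallPhi hr hz] at h1
    rwa [position_travel hr hz] at h1
  set c := P.ccp with hcdef
  have hre : ∀ v, HasDerivAt (fun v => (z v).re)
      (riccatiRe P s Ω (z v).re 0 (Real.tanh v) / (z v).re) v := by
    intro v
    have h1 := HasDerivAt.complex_re (hprof v)
    rwa [Complex.div_ofReal_re, (riccati_re_im P s Ω (z v) (Real.tanh v)).1, hq] at h1
  have him : ∀ v, riccatiIm P s Ω (z v).re 0 (Real.tanh v) = 0 := by
    intro v
    have h1 := HasDerivAt.complex_im (hprof v)
    rw [Complex.div_ofReal_im, (riccati_re_im P s Ω (z v) (Real.tanh v)).2, hq] at h1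
    have h2 := h1.unique (((hasDerivAt_const v (0 : ℝ))).congr_of_eventuallyEq
      (Eventually.of_forall hq))
    exact (div_eq_zero_iff.1 h2).resolve_right (hz.re_pos hr v).ne'
  have hsp : ∀ v, s * (z v).re = P.alpha * Ω - P.beta * (1 - c * Real.tanh v)⁻¹ := by
    intro v
    have := him v
    simp only [riccatiIm] at this
    rw [div_eq_mul_inv] at this
    linarith
  have hdiff : ∀ v, s * (riccatiRe P s Ω (z v).re 0 (Real.tanh v) / (z v).re) =
      -(P.beta * (c * (1 - Real.tanh v ^ 2) / (1 - c * Real.tanh v) ^ 2)) := by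
    intro v
    have h1 := (hre v).const_mul s
    have h2 := (((((hasDerivAt_tanh v).const_mul c).const_sub 1).inv
      (one_sub_mul_tanh_pos hc v).ne').const_mul P.beta).const_sub (P.alpha * Ω)
    have h3 := h1.unique (h2.congr_of_eventuallyEq (Eventually.of_forall hsp))
    rw [h3, neg_neg]
  -- This is the real part of the equation after elimination of `p` and clearing of denominators;
  -- `αΩ (1 - c t) - β` stands for `s p (1 - c t)`.
  set Q : Polynomial ℝ :=
    (Polynomial.C (P.alpha * Ω) * (1 - Polynomial.C c * Polynomial.X) - Polynomial.C P.beta) *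
        (Polynomial.C (P.beta * c) * (1 - Polynomial.X ^ 2)) +
      (1 - Polynomial.C c * Polynomial.X) *
        (Polynomial.X * (Polynomial.C (P.alpha * Ω) * (1 - Polynomial.C c * Polynomial.X) -
            Polynomial.C P.beta) ^ 2 -
          Polynomial.C (s ^ 2 * P.alpha) * (1 - Polynomial.C c * Polynomial.X) *
            (Polynomial.C (P.alpha * Ω) * (1 - Polynomial.C c * Polynomial.X) -
              Polynomial.C P.beta) +
          (1 - Polynomial.C c * Polynomial.X) ^ 2 *
            (Polynomial.C (s ^ 2) * (Polynomial.C (P.field - Ω) +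
              Polynomial.C P.mu * Polynomial.X))) with hQ
  have hroot : ∀ v, Q.IsRoot (Real.tanh v) := by
    intro v
    have h1 := hdiff v
    have h2 := hsp v
    have hp := (hz.re_pos hr v).ne'
    have hw := (one_sub_mul_tanh_pos hc v).ne'
    simp only [riccatiRe] at h1
    simp only [Polynomial.IsRoot, hQ, Polynomial.eval_add, Polynomial.eval_mul,
      Polynomial.eval_sub, Polynomial.eval_C, Polynomial.eval_one, Polynomial.eval_X,
      Polynomial.eval_pow]
    generalize (z v).re = p at *
    generalize Real.tanh v = t at *
    have h3 : P.alpha * Ω * (1 - c * t) - P.beta = s * p * (1 - c * t) := by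
      rw [h2, sub_mul, inv_mul_cancel_right₀ hw]
    rw [h3]
    generalize hD : c * (1 - t ^ 2) / (1 - c * t) ^ 2 = D at h1
    rw [div_eq_iff (pow_ne_zero 2 hw)] at hD
    rw [mul_div_assoc', div_eq_iff hp] at h1
    linear_combination s * (1 - c * t) ^ 3 * h1 + s * p * (1 - c * t) * P.beta * hD
  have hQ0 : Q = 0 := by
    refine Polynomial.eq_zero_of_infinite_isRoot Q (Set.Infinite.mono (s := Set.range Real.tanh) ?_
      (Set.infinite_range_of_injective strictMono_tanh.injective))
    rintro _ ⟨v, rfl⟩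
    exact hroot v
  -- At `t = 1 / c` every term with a free factor `1 - c t` vanishes, and only a multiple of `β²`
  -- survives.
  have heval : Q.eval c⁻¹ = 0 := by rw [hQ0, Polynomial.eval_zero]
  simp only [hQ, Polynomial.eval_add, Polynomial.eval_mul, Polynomial.eval_sub, Polynomial.eval_C,
    Polynomial.eval_one, Polynomial.eval_X, Polynomial.eval_pow, mul_inv_cancel₀ hc0] at heval
  have h1 : P.beta ^ 2 * (1 - c ^ 2) = 0 := by
    have hinv : c * c⁻¹ = 1 := mul_inv_cancel₀ hc0
    generalize c⁻¹ = d at *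
    linear_combination c * heval - P.beta ^ 2 * (c * d + 1) * hinv
  have h2 : c ^ 2 < 1 := by rw [← sq_abs]; exact pow_lt_one₀ (abs_nonneg _) hc two_ne_zero
  rcases mul_eq_zero.1 h1 with h | h
  · exact hβ (pow_eq_zero_iff two_ne_zero |>.1 h)
  · linarith

end LLGS

/-! ### Comparison with the explicit wall, and profiles from nearby walls -/

namespace LLGS

open BoundedContinuousFunction

variable {r : ℝ} {z : ℝ →ᵇ ℂ} {P : Params} {s Ω : ℝ}

theorem nearConst_self (hr : 0 < r) : NearConst r (r • (1 : ℝ →ᵇ ℂ)) := by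
  rw [NearConst, sub_self, norm_zero]; positivity

theorem position_const (hr : 0 < r) (ξ : ℝ) : position (r • (1 : ℝ →ᵇ ℂ)) ξ = r * ξ := by
  have h := eq_position_of_hasDerivAt hr (nearConst_self hr) (v := fun ξ => r * ξ)
    (fun ξ => by simpa using (hasDerivAt_id ξ).const_mul r) ξ
  simp only [mul_zero, travel_zero, add_zero] at h
  exact h.symm

theorem azimuth_const (v : ℝ) : azimuth (r • (1 : ℝ →ᵇ ℂ)) v = 0 := by
  simp [azimuth]

theorem phase_of_position {v φ : ℝ → ℝ} {p q : ℝ} {ξ : ℝ} (hv : HasDerivAt v p ξ)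
    (hφ : HasDerivAt φ q ξ) : phase (fun ξ => polarAngle (v ξ)) φ ξ = (polarAngle (v ξ), p, q) := by
  have h := ((hasDerivAt_polarAngle (v ξ)).comp ξ hv).deriv
  have hc := (Real.cosh_pos (v ξ)).ne'
  rw [phase, wavenumber, hφ.deriv, sin_polarAngle]
  refine Prod.ext rfl (Prod.ext ?_ rfl)
  change deriv (polarAngle ∘ v) ξ / (1 / Real.cosh (v ξ)) = p
  rw [h]
  field_simp

theorem phase_wall (hr : 0 < r) (hz : NearConst r z) (ξ : ℝ) :
    phase (wallTheta z) (wallPhi z) ξ =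
      (polarAngle (position z ξ), (z (position z ξ)).re, (z (position z ξ)).im) :=
  phase_of_position (hasDerivAt_position hr hz ξ) (hasDerivAt_azimuth_position hr hz ξ)

theorem phase_theta0 (P : Params) (ξ : ℝ) :
    phase (theta0 P) phi0 ξ = (polarAngle (Real.sqrt (-P.mu) * ξ), Real.sqrt (-P.mu), 0) :=
  phase_of_position (v := fun ξ => Real.sqrt (-P.mu) * ξ)
    (by simpa using (hasDerivAt_id ξ).const_mul (Real.sqrt (-P.mu))) (hasDerivAt_const ξ 0)

theorem abs_le_cosh (v : ℝ) : |v| ≤ Real.cosh v := by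
  rw [← Real.cosh_abs, Real.cosh_eq]
  have h1 := Real.quadratic_le_exp_of_nonneg (abs_nonneg v)
  have h2 := Real.exp_pos (-|v|)
  nlinarith [sq_nonneg (|v| - 1)]

/-- The derivative `1 / cosh x` is at most `1 / |x|`, and `|x| ≥ |w| / 2` on the segment since `ε ≤
1 / 2`. A relative error in `v`, unbounded on the line, thus becomes a uniform error in `θ`. -/
theorem abs_polarAngle_sub_le {v w ε : ℝ} (hε0 : 0 ≤ ε) (hε : ε ≤ 1 / 2) (h : |v - w| ≤ ε * |w|) :
    |polarAngle v - polarAngle w| ≤ 2 * ε := by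
  rcases eq_or_ne w 0 with rfl | hw
  · rw [abs_zero, mul_zero] at h
    have hv : v = 0 := by simpa using abs_nonpos_iff.1 h
    rw [hv, sub_self, abs_zero]; positivity
  · have hwpos : 0 < |w| := abs_pos.2 hw
    have hbound : ∀ x ∈ Set.uIcc w v, ‖1 / Real.cosh x‖ ≤ 2 / |w| := by
      intro x hx
      have h1 : |x - w| ≤ |v - w| := Set.abs_sub_left_of_mem_uIcc hx
      have h2 : |w| / 2 ≤ |x| := by
        have h3 := abs_sub_abs_le_abs_sub w x
        rw [abs_sub_comm] at h3
        nlinarith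
      have h3 := h2.trans (abs_le_cosh x)
      rw [Real.norm_eq_abs, abs_of_pos (by have := Real.cosh_pos x; positivity),
        div_le_div_iff₀ (Real.cosh_pos x) hwpos]
      linarith
    have h1 := (convex_uIcc w v).norm_image_sub_le_of_norm_hasDerivWithin_le (f := polarAngle)
      (fun x _ => (hasDerivAt_polarAngle x).hasDerivWithinAt) hbound Set.left_mem_uIcc
      Set.right_mem_uIcc
    refine h1.trans ?_
    rw [Real.norm_eq_abs]
    calc 2 / |w| * |v - w| ≤ 2 / |w| * (ε * |w|) := by gcongr
      _ = 2 * ε := by field_simp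

/-- The orbit of a wall is uniformly close to that of the explicit one. -/
theorem dist_phase_wall_le (hr : 0 < r) (hrP : r = Real.sqrt (-P.mu))
    (hz : ‖z - r • (1 : ℝ →ᵇ ℂ)‖ ≤ r / 12) (ξ : ℝ) :
    dist (phase (wallTheta z) (wallPhi z) ξ) (phase (theta0 P) phi0 ξ) ≤
      (12 / r + 1) * ‖z - r • (1 : ℝ →ᵇ ℂ)‖ := by
  have hn : NearConst r z := hz.trans (by linarith)
  have hz0 := norm_nonneg (z - r • (1 : ℝ →ᵇ ℂ))
  have h12 : 0 ≤ 12 / r * ‖z - r • (1 : ℝ →ᵇ ℂ)‖ := by positivity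
  rw [phase_wall hr hn, phase_theta0, ← hrP]
  refine max_le ?_ (max_le ?_ ?_)
  · have h1 := abs_position_sub_le hr hn (nearConst_self hr) ξ ξ
    rw [position_const hr, sub_self, abs_zero, zero_add] at h1
    have h2 : |position z ξ - r * ξ| ≤ 6 / r * ‖z - r • (1 : ℝ →ᵇ ℂ)‖ * |r * ξ| := by
      refine h1.trans_eq ?_
      field_simp
      ring
    -- The radius `r / 12` is chosen so that the relative error is at most `1 / 2`.
    have h3 : 6 / r * ‖z - r • (1 : ℝ →ᵇ ℂ)‖ ≤ 1 / 2 := by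
      calc 6 / r * ‖z - r • (1 : ℝ →ᵇ ℂ)‖ ≤ 6 / r * (r / 12) := by gcongr
        _ = 1 / 2 := by field_simp; norm_num
    have h4 := abs_polarAngle_sub_le (by positivity) h3 h2
    rw [Real.dist_eq]
    refine h4.trans ?_
    have : 2 * (6 / r * ‖z - r • (1 : ℝ →ᵇ ℂ)‖) = 12 / r * ‖z - r • (1 : ℝ →ᵇ ℂ)‖ := by ring
    linarith
  · rw [Real.dist_eq]
    have := abs_re_sub_le z (r • (1 : ℝ →ᵇ ℂ)) (position z ξ)
    simp only [BoundedContinuousFunction.coe_smul, BoundedContinuousFunction.coe_one,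
      Pi.one_apply, Complex.real_smul, mul_one, Complex.ofReal_re] at this
    linarith
  · rw [Real.dist_eq]
    have := abs_im_sub_le z (r • (1 : ℝ →ᵇ ℂ)) (position z ξ)
    simp only [BoundedContinuousFunction.coe_smul, BoundedContinuousFunction.coe_one,
      Pi.one_apply, Complex.real_smul, mul_one, Complex.ofReal_im] at this
    linarith

/-- The relations between speed, frequency and parameters of the explicit wall. -/
theorem explicit_relations (hμ : P.mu < 0) :
    P.field - Omega0 P = P.alpha * s0 P * Real.sqrt (-P.mu) ∧
      P.alpha * Omega0 P - P.beta = s0 P * Real.sqrt (-P.mu) := by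
  have h1 : Real.sqrt (-P.mu) ≠ 0 := (Real.sqrt_pos.2 (by linarith)).ne'
  have h2 : 1 + P.alpha ^ 2 ≠ 0 := by positivity
  rw [Omega0, s0]
  constructor
  · field_simp
    ring
  · field_simp
    ring

theorem isProfile_explicit (hμ : P.mu < 0) (hc : P.ccp = 0) :
    IsProfile P (s0 P) (Omega0 P) (Real.sqrt (-P.mu) • (1 : ℝ →ᵇ ℂ)) := by
  intro v
  obtain ⟨h1, h2⟩ := explicit_relations hμ
  have hsq : Real.sqrt (-P.mu) ^ 2 = -P.mu := Real.sq_sqrt (by linarith)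
  have h3 : riccati P (s0 P) (Omega0 P) ((Real.sqrt (-P.mu) • (1 : ℝ →ᵇ ℂ)) v)
      (Real.tanh v) = 0 := by
    have e := riccati_eq P (s0 P) (Omega0 P) (Real.sqrt (-P.mu)) 0 (Real.tanh v)
    have hre : riccatiRe P (s0 P) (Omega0 P) (Real.sqrt (-P.mu)) 0 (Real.tanh v) = 0 := by
      rw [riccatiRe]
      linear_combination Real.tanh v * hsq + h1
    have him : riccatiIm P (s0 P) (Omega0 P) (Real.sqrt (-P.mu)) 0 (Real.tanh v) = 0 := by
      rw [riccatiIm, hc, zero_mul, sub_zero, div_one]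
      linear_combination h2
    rw [hre, him] at e
    simpa using e
  rw [h3, zero_div]
  have : ((Real.sqrt (-P.mu) • (1 : ℝ →ᵇ ℂ) : ℝ →ᵇ ℂ) : ℝ → ℂ) =
      fun _ => (Real.sqrt (-P.mu) : ℂ) := by ext; simp
  rw [this]
  exact hasDerivAt_const v _

theorem bijective_of_hasDerivAt_ge {f f' : ℝ → ℝ} {c : ℝ} (hc : 0 < c)
    (hf : ∀ x, HasDerivAt f (f' x) x) (h : ∀ x, c ≤ f' x) : Function.Bijective f := by
  have hcont : Continuous f := continuous_iff_continuousAt.2 fun x => (hf x).continuousAt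
  have hmono : Monotone fun x => f x - c * x := by
    refine monotone_of_hasDerivAt_nonneg (f' := fun x => f' x - c) (fun x => ?_) fun x => ?_
    · have := (hf x).sub ((hasDerivAt_id x).const_mul c)
      rwa [mul_one] at this
    · exact sub_nonneg.2 (h x)
  have hstrict : StrictMono f := strictMono_of_deriv_pos fun x => by
    rw [(hf x).deriv]; exact hc.trans_le (h x)
  refine ⟨hstrict.injective, hcont.surjective ?_ ?_⟩
  · refine tendsto_atTop_mono' atTop (f₁ := fun x => f 0 + c * x) ?_
      (tendsto_atTop_add_const_left _ _ (tendsto_id.const_mul_atTop hc))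
    filter_upwards [eventually_ge_atTop 0] with x hx
    have := hmono hx
    simp only [mul_zero, sub_zero] at this
    linarith
  · refine tendsto_atBot_mono' atBot (f₁ := fun x => f 0 + c * x) ?_
      (tendsto_atBot_add_const_left _ _ (tendsto_id.const_mul_atBot hc))
    filter_upwards [eventually_le_atBot 0] with x hx
    have := hmono hx
    simp only [mul_zero, sub_zero] at this
    linarith

/-- A domain wall whose orbit is near the homogeneous one is given by a profile. -/
theorem exists_isProfile_of_isDomainWall {θ φ : ℝ → ℝ} {ε : ℝ} (hε : ε ≤ r / 4) (hr : 0 < r)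
    (hdw : IsDomainWall P s Ω θ φ) (hp : ∀ ξ, |deriv θ ξ / Real.sin (θ ξ) - r| < ε)
    (hq : ∀ ξ, |deriv φ ξ| < ε) :
    ∃ (z : ℝ →ᵇ ℂ) (v : ℝ → ℝ), ‖z - r • (1 : ℝ →ᵇ ℂ)‖ ≤ 2 * ε ∧ IsProfile P s Ω z ∧
      (∀ ξ, θ ξ = polarAngle (v ξ)) ∧ (∀ ξ, HasDerivAt v (z (v ξ)).re ξ) ∧
      ∀ ξ, HasDerivAt φ (z (v ξ)).im ξ := by
  have hε0 : 0 < ε := (abs_nonneg _).trans_lt (hq 0)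
  set v : ℝ → ℝ := fun ξ => Real.log (Real.tan (θ ξ / 2)) with hvdef
  have hhalf : ∀ ξ, θ ξ / 2 ∈ Set.Ioo 0 (Real.pi / 2) := fun ξ => by
    have := hdw.mem_Ioo ξ
    constructor <;> linarith [this.1, this.2]
  have htan : ∀ ξ, 0 < Real.tan (θ ξ / 2) := fun ξ =>
    Real.tan_pos_of_pos_of_lt_pi_div_two (hhalf ξ).1 (hhalf ξ).2
  have hθv : ∀ ξ, θ ξ = polarAngle (v ξ) := fun ξ => by
    rw [polarAngle, hvdef]
    simp only
    rw [Real.exp_log (htan ξ), Real.arctan_tan (by linarith [(hhalf ξ).1, Real.pi_pos])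
      (hhalf ξ).2]
    ring
  have hv2 : ContDiff ℝ 2 v := by
    refine contDiff_iff_contDiffAt.2 fun ξ => ?_
    have h1 : ContDiffAt ℝ 2 (fun ξ => Real.tan (θ ξ / 2)) ξ := by
      refine ContDiffAt.comp ξ (g := Real.tan) (f := fun ξ => θ ξ / 2) ?_
        (hdw.contDiff_theta.contDiffAt.div_const 2)
      refine Real.contDiffAt_tan.2 (Real.cos_pos_of_mem_Ioo ⟨?_, (hhalf ξ).2⟩).ne'
      linarith [(hhalf ξ).1, Real.pi_pos]
    exact h1.log (htan ξ).ne'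
  have hv1 : ∀ ξ, HasDerivAt v (deriv v ξ) ξ := fun ξ =>
    (hv2.differentiable (by norm_num) ξ).hasDerivAt
  have hφ1 : ∀ ξ, HasDerivAt φ (deriv φ ξ) ξ := fun ξ =>
    (hdw.contDiff_phi.differentiable (by norm_num) ξ).hasDerivAt
  have hv3 := ((contDiff_succ_iff_deriv (n := 1)).1 hv2).2.2
  have hφ3 := ((contDiff_succ_iff_deriv (n := 1)).1 hdw.contDiff_phi).2.2
  have hθeq : θ = fun ξ => polarAngle (v ξ) := funext hθv
  have hpv : ∀ ξ, deriv θ ξ / Real.sin (θ ξ) = deriv v ξ := fun ξ => by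
    have h1 := phase_of_position (hv1 ξ) (hφ1 ξ)
    rw [← hθeq] at h1
    exact congrArg (fun x : ℝ × ℝ × ℝ => x.2.1) h1
  simp only [hpv] at hp
  have hvge : ∀ ξ, r / 2 ≤ deriv v ξ := fun ξ => by
    have := (abs_lt.1 (hp ξ)).1
    linarith
  have hbij := bijective_of_hasDerivAt_ge (half_pos hr) hv1 hvge
  have hmono : StrictMono v := strictMono_of_deriv_pos fun ξ => by
    linarith [hvge ξ]
  -- Since `p = v' ≥ r / 2`, `v` is a bijection of the line, and its inverse turns `p + i q` into a
  -- function of `v`.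
  set w : ℝ ≃o ℝ := (hmono.orderIsoOfSurjective v hbij.2).symm with hw
  have hvw : ∀ y, v (w y) = y := fun y => (hmono.orderIsoOfSurjective v hbij.2).apply_symm_apply y
  have hwv : ∀ ξ, w (v ξ) = ξ := fun ξ => (hmono.orderIsoOfSurjective v hbij.2).symm_apply_apply ξ
  have hwc : Continuous w := w.continuous
  have hZc : Continuous fun ξ => ((deriv v ξ : ℝ) : ℂ) + (deriv φ ξ : ℝ) * Complex.I :=
    (Complex.continuous_ofReal.comp hv3.continuous).add
      ((Complex.continuous_ofReal.comp hφ3.continuous).mul continuous_const)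
  have hbound : ∀ ξ, ‖(((deriv v ξ : ℝ) : ℂ) + (deriv φ ξ : ℝ) * Complex.I) - r‖ ≤ 2 * ε := by
    intro ξ
    have e : (((deriv v ξ : ℝ) : ℂ) + (deriv φ ξ : ℝ) * Complex.I) - r =
        ((deriv v ξ - r : ℝ) : ℂ) + ((deriv φ ξ : ℝ) : ℂ) * Complex.I := by push_cast; ring
    rw [e]
    refine (norm_add_le _ _).trans ?_
    rw [norm_mul, Complex.norm_I, mul_one, Complex.norm_real, Complex.norm_real, Real.norm_eq_abs,
      Real.norm_eq_abs]
    linarith [hp ξ, hq ξ]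
  set z : ℝ →ᵇ ℂ := BoundedContinuousFunction.ofNormedAddCommGroup
    (fun y => ((deriv v (w y) : ℝ) : ℂ) + (deriv φ (w y) : ℝ) * Complex.I) (hZc.comp hwc)
    (2 * ε + r) (fun y => by
      have h1 := norm_add_le ((((deriv v (w y) : ℝ) : ℂ) + (deriv φ (w y) : ℝ) * Complex.I) - r)
        (r : ℂ)
      rw [sub_add_cancel, Complex.norm_real, Real.norm_of_nonneg hr.le] at h1
      linarith [hbound (w y)]) with hz
  have hzv : ∀ ξ, z (v ξ) = ((deriv v ξ : ℝ) : ℂ) + (deriv φ ξ : ℝ) * Complex.I := fun ξ => by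
    change ((deriv v (w (v ξ)) : ℝ) : ℂ) + (deriv φ (w (v ξ)) : ℝ) * Complex.I = _
    rw [hwv]
  have hzre : ∀ ξ, (z (v ξ)).re = deriv v ξ := fun ξ => by rw [hzv]; simp
  have hzim : ∀ ξ, (z (v ξ)).im = deriv φ ξ := fun ξ => by rw [hzv]; simp
  have hsol := (isSolution_iff P s Ω hv2 hdw.contDiff_phi).1 (by
    have := hdw.solution
    rwa [hθeq] at this)
  refine ⟨z, v, ?_, fun y => ?_, hθv, fun ξ => ?_, fun ξ => ?_⟩
  · refine (BoundedContinuousFunction.norm_le (by positivity)).2 fun y => ?_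
    have h1 := hbound (w y)
    have h2 : (z - r • (1 : ℝ →ᵇ ℂ)) y =
        (((deriv v (w y) : ℝ) : ℂ) + (deriv φ (w y) : ℝ) * Complex.I) - r := by
      simp [hz]
    rwa [h2]
  · obtain ⟨ξ, rfl⟩ := hbij.2 y
    have hwd : HasDerivAt w (deriv v ξ)⁻¹ (v ξ) := by
      refine HasDerivAt.of_local_left_inverse hwc.continuousAt ?_ (by linarith [hvge ξ] : deriv v ξ ≠ 0)
        (Eventually.of_forall hvw)
      rw [hwv]
      exact hv1 ξ
    have hZd : HasDerivAt (fun ξ => ((deriv v ξ : ℝ) : ℂ) + (deriv φ ξ : ℝ) * Complex.I)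
        (((deriv (deriv v) ξ : ℝ) : ℂ) + (deriv (deriv φ) ξ : ℝ) * Complex.I) (w (v ξ)) := by
      rw [hwv]
      exact ((hv3.differentiable one_ne_zero ξ).hasDerivAt.ofReal_comp).add
        (((hφ3.differentiable one_ne_zero ξ).hasDerivAt.ofReal_comp).mul_const Complex.I)
    refine (hZd.scomp (v ξ) hwd).congr_deriv ?_
    rw [(hsol ξ).1, (hsol ξ).2, ← riccati_eq, hzv, Complex.real_smul, Complex.ofReal_inv,
      inv_mul_eq_div]
    simp
  · rw [hzre]; exact hv1 ξ
  · rw [hzim]; exact hφ1 ξ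

end LLGS

/-! ### The codim-2 condition for the explicit wall -/

namespace LLGS

open BoundedContinuousFunction

/-- The lower bound on the field gives `s₀ ≥ 0`; the upper bound is `α s₀ < 2 √(-μ)` after clearing
denominators. Together they place `Re a = α s₀ / r` in `[0, 2)`. -/
theorem isBaseState_explicit {P : Params} (hα : 0 < P.alpha) (hμ : P.mu < 0) (hc : P.ccp = 0)
    (hlow : P.beta / P.alpha ≤ P.field)
    (hup : P.field < P.beta / P.alpha - 2 * P.mu - 2 * P.mu / P.alpha ^ 2) :
    IsBaseState P (Real.sqrt (-P.mu)) (s0 P) (Omega0 P) := by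
  have hr : 0 < Real.sqrt (-P.mu) := Real.sqrt_pos.2 (by linarith)
  have hsq : Real.sqrt (-P.mu) ^ 2 = -P.mu := Real.sq_sqrt (by linarith)
  have h1 : 0 ≤ P.alpha * P.field - P.beta := by
    rw [div_le_iff₀ hα] at hlow; linarith
  have h2 : P.alpha * (P.alpha * P.field - P.beta) < -2 * P.mu * (1 + P.alpha ^ 2) := by
    have h3 : P.beta / P.alpha - 2 * P.mu - 2 * P.mu / P.alpha ^ 2 =
        (P.alpha * P.beta - 2 * P.mu * (1 + P.alpha ^ 2)) / P.alpha ^ 2 := by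
      field_simp; ring
    rw [h3, lt_div_iff₀ (by positivity)] at hup
    linarith
  refine ⟨hr, hsq, hc, (explicit_relations hμ).1, (explicit_relations hμ).2, ?_, ?_⟩
  · have h4 : 0 ≤ P.alpha * s0 P := by rw [s0]; positivity
    linarith
  · rw [s0, mul_div_assoc', div_lt_iff₀ (by positivity)]
    refine h2.trans_eq ?_
    linear_combination (-2 * (1 + P.alpha ^ 2)) * hsq

theorem continuousAt_s0 {P : Params} (hμ : P.mu < 0) : ContinuousAt s0 P := by
  have hr : 0 < Real.sqrt (-P.mu) := Real.sqrt_pos.2 (by linarith)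
  unfold s0
  refine ContinuousAt.div (by fun_prop) ?_ (by positivity)
  exact (Real.continuous_sqrt.continuousAt.comp (by fun_prop)).mul (by fun_prop)

theorem continuousAt_Omega0 (P : Params) : ContinuousAt Omega0 P := by
  unfold Omega0
  exact ContinuousAt.div (by fun_prop) (by fun_prop) (by positivity)

end LLGS

/-! ### Assembly of the theorem -/

open LLGS in
theorem theorem3 (α₀ β₀ h₀ μ₀ : ℝ) (hα : 0 < α₀) (hβ : 0 ≤ β₀) (hμ : μ₀ < 0)
    (hlow : β₀ / α₀ ≤ h₀) (hup : h₀ < β₀ / α₀ - 2 * μ₀ - 2 * μ₀ / α₀ ^ 2)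
    (P₀ : LLGS.Params) (hP₀ : P₀ = (0, α₀, β₀, h₀, μ₀)) :
    ∃ (U : Set LLGS.Params) (s Ω : LLGS.Params → ℝ) (θ φ : LLGS.Params → ℝ → ℝ),
      -- a smooth family over a neighbourhood of the given parameters
      IsOpen U ∧ P₀ ∈ U ∧
      ContDiffOn ℝ ∞ s U ∧ ContDiffOn ℝ ∞ Ω U ∧
      ContDiffOn ℝ ∞ (fun x : LLGS.Params × ℝ => θ x.1 x.2) (U ×ˢ Set.univ) ∧
      ContDiffOn ℝ ∞ (fun x : LLGS.Params × ℝ => φ x.1 x.2) (U ×ˢ Set.univ) ∧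
      -- of flat domain walls, with speed and frequency given by the parameters
      (∀ P ∈ U, LLGS.IsDomainWall P (s P) (Ω P) (θ P) (φ P) ∧ LLGS.IsFlat (φ P)) ∧
      -- inhomogeneous in the presence of a polarized current
      (∀ P ∈ U, P.ccp ≠ 0 → P.beta ≠ 0 → ¬ LLGS.IsHomogeneous (φ P)) ∧
      -- which contains the explicit homogeneous domain walls
      (∀ P ∈ U, P.ccp = 0 → s P = LLGS.s0 P ∧ Ω P = LLGS.Omega0 P ∧
        θ P = LLGS.theta0 P ∧ φ P = LLGS.phi0) ∧
      -- depends continuously on the parameters uniformly in space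
      TendstoUniformly (fun P ξ => LLGS.phase (θ P) (φ P) ξ)
        (LLGS.phase (LLGS.theta0 P₀) LLGS.phi0) (𝓝 P₀) ∧
      -- and is locally unique, up to translation and rotation
      ∃ δ : ℝ, 0 < δ ∧
        (∀ P ∈ U, |s P - LLGS.s0 P₀| < δ ∧ |Ω P - LLGS.Omega0 P₀| < δ ∧
          ∀ ξ, dist (LLGS.phase (θ P) (φ P) ξ)
            (LLGS.phase (LLGS.theta0 P₀) LLGS.phi0 ξ) < δ) ∧
        (∀ P ∈ U, ∀ (s' Ω' : ℝ) (θ' φ' : ℝ → ℝ),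
          |s' - LLGS.s0 P₀| < δ → |Ω' - LLGS.Omega0 P₀| < δ →
          LLGS.IsDomainWall P s' Ω' θ' φ' →
          (∀ ξ, ∃ τ, dist (LLGS.phase θ' φ' ξ)
            (LLGS.phase (LLGS.theta0 P₀) LLGS.phi0 τ) < δ) →
          s' = s P ∧ Ω' = Ω P ∧
            ∃ τ κ : ℝ, ∀ ξ, θ' ξ = θ P (ξ + τ) ∧ φ' ξ = φ P (ξ + τ) + κ) := by
  have hc0 : P₀.ccp = 0 := by rw [hP₀]
  have hμ0 : P₀.mu < 0 := by rw [hP₀]; exact hμ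
  have hb : IsBaseState P₀ (Real.sqrt (-P₀.mu)) (s0 P₀) (Omega0 P₀) :=
    isBaseState_explicit (by rw [hP₀]; exact hα) hμ0 hc0 (by rw [hP₀]; exact hlow)
      (by rw [hP₀]; exact hup)
  obtain ⟨z, s, Ω, hz0, hs0, hΩ0, hzc, hsc, hΩc, hsol, ε, hε, huniq⟩ := exists_profile_family hb
  set r := Real.sqrt (-P₀.mu) with hrdef
  have hr : 0 < r := hb.pos
  have hznorm : Tendsto (fun P => ‖z P - r • (1 : BoundedContinuousFunction ℝ ℂ)‖) (𝓝 P₀)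
      (𝓝 0) := by
    have := tendsto_iff_norm_sub_tendsto_zero.1 hzc.continuousAt
    rwa [hz0] at this
  have habs : ∀ {f : Params → ℝ} {c : ℝ}, ContinuousAt f P₀ → f P₀ = c → ∀ η > 0,
      ∀ᶠ P in 𝓝 P₀, |f P - c| < η := fun hf hfc η hη => by
    rw [ContinuousAt, hfc] at hf
    simpa [Real.dist_eq] using Metric.tendsto_nhds.1 hf η hη
  -- A wall within `δ` in `p` and `q` has a profile within `2 δ < ε` of the constant, inside the
  -- uniqueness ball; `δ ≤ r / 4` keeps `p` away from zero.
  set δ := min (ε / 3) (r / 4) with hδdef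
  have hδ : 0 < δ := lt_min (by positivity) (by positivity)
  have hδε : 2 * δ < ε := by have := min_le_left (ε / 3) (r / 4); linarith
  have hδr : δ ≤ r / 4 := min_le_right _ _
  have hK : 0 < 12 / r + 1 := by positivity
  have hsqrt : ContinuousAt (fun P : Params => Real.sqrt (-P.mu)) P₀ :=
    Real.continuous_sqrt.continuousAt.comp (by fun_prop)
  have hev : ∀ᶠ P in 𝓝 P₀,
      (ContDiffAt ℝ ω z P ∧ ContDiffAt ℝ ω s P ∧ ContDiffAt ℝ ω Ω P) ∧
      (IsProfile P (s P) (Ω P) (z P) ∧ HasLimits (z P)) ∧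
      (∀ (z' : BoundedContinuousFunction ℝ ℂ) (s' Ω' : ℝ),
        ‖z' - r • (1 : BoundedContinuousFunction ℝ ℂ)‖ < ε → |s' - s0 P₀| < ε →
        |Ω' - Omega0 P₀| < ε → IsProfile P s' Ω' z' → z' = z P ∧ s' = s P ∧ Ω' = Ω P) ∧
      (‖z P - r • (1 : BoundedContinuousFunction ℝ ℂ)‖ < r / 12 ∧
        ‖z P - r • (1 : BoundedContinuousFunction ℝ ℂ)‖ < δ / (12 / r + 1)) ∧
      (|s P - s0 P₀| < δ ∧ |Ω P - Omega0 P₀| < δ) ∧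
      (|P.ccp| < 1 ∧ P.mu < 0) ∧
      (|Real.sqrt (-P.mu) - r| < ε ∧ |s0 P - s0 P₀| < ε ∧ |Omega0 P - Omega0 P₀| < ε) := by
    refine Eventually.and ?_ (hsol.and (huniq.and (Eventually.and ?_ (Eventually.and ?_
      (Eventually.and ?_ ?_)))))
    · exact (hzc.eventually (by simp)).and ((hsc.eventually (by simp)).and
        (hΩc.eventually (by simp)))
    · exact (hznorm.eventually_lt_const (by positivity)).and
        (hznorm.eventually_lt_const (by positivity))
    · exact (habs hsc.continuousAt hs0 δ hδ).and (habs hΩc.continuousAt hΩ0 δ hδ)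
    · refine Eventually.and ?_ ?_
      · have h1 : ContinuousAt (fun P : Params => P.ccp) P₀ := by fun_prop
        simpa using habs h1 hc0 1 one_pos
      · have h1 : ContinuousAt (fun P : Params => P.mu) P₀ := by fun_prop
        exact h1.eventually_lt_const hμ0
    · exact (habs hsqrt rfl ε hε).and ((habs (continuousAt_s0 hμ0) rfl ε hε).and
        (habs (continuousAt_Omega0 P₀) rfl ε hε))
  obtain ⟨U, hU, hUo, hP₀U⟩ := eventually_nhds_iff.1 hev
  have hnear : ∀ P ∈ U, NearConst r (z P) := fun P hP =>
    (hU P hP).2.2.2.1.1.le.trans (by linarith)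
  have hwall : ∀ P ∈ U, ∀ ξ, ContDiffAt ℝ ∞
      (fun w : Params × ℝ => wallState (z w.1) (s w.1) (Ω w.1) w.1 w.2) (P, ξ) := by
    intro P hP ξ
    obtain ⟨⟨h1, h2, h3⟩, -, -, -, -, ⟨h4, -⟩, -⟩ := hU P hP
    exact contDiffAt_wallState hr (eventually_of_mem (hUo.mem_nhds hP) hnear)
      (eventually_of_mem (hUo.mem_nhds hP) fun P' hP' => (hU P' hP').2.1.1)
      (h1.of_le le_top) (h2.of_le le_top) (h3.of_le le_top) h4 ξ
  have hdist : ∀ P ∈ U, ∀ ξ, dist (phase (wallTheta (z P)) (wallPhi (z P)) ξ)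
      (phase (theta0 P₀) phi0 ξ) ≤
        (12 / r + 1) * ‖z P - r • (1 : BoundedContinuousFunction ℝ ℂ)‖ := fun P hP ξ =>
    dist_phase_wall_le hr hrdef (hU P hP).2.2.2.1.1.le ξ
  refine ⟨U, s, Ω, fun P => wallTheta (z P), fun P => wallPhi (z P), hUo, hP₀U, ?_, ?_, ?_, ?_,
    ?_, ?_, ?_, ?_, δ, hδ, ?_, ?_⟩
  · exact fun P hP => ((hU P hP).1.2.1.of_le le_top).contDiffWithinAt
  · exact fun P hP => ((hU P hP).1.2.2.of_le le_top).contDiffWithinAt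
  · rintro ⟨P, ξ⟩ ⟨hP, -⟩
    exact (contDiff_polarAngle.contDiffAt.comp (P, ξ) (hwall P hP ξ).fst).contDiffWithinAt
  · rintro ⟨P, ξ⟩ ⟨hP, -⟩
    exact (hwall P hP ξ).snd.snd.fst.contDiffWithinAt
  · intro P hP
    obtain ⟨-, ⟨h1, h2⟩, -, -, -, ⟨h3, -⟩, -⟩ := hU P hP
    exact ⟨isDomainWall_of_isProfile hr (hnear P hP) h3 h1, isFlat_of_hasLimits hr (hnear P hP) h2⟩
  · intro P hP hc hβ'
    obtain ⟨-, ⟨h1, -⟩, -, -, -, ⟨h3, -⟩, -⟩ := hU P hP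
    exact not_isHomogeneous_wallPhi hr (hnear P hP) h3 h1 hc hβ'
  · intro P hP hc
    obtain ⟨-, -, h1, -, -, ⟨-, h2⟩, h3, h4, h5⟩ := hU P hP
    have hρ : 0 < Real.sqrt (-P.mu) := Real.sqrt_pos.2 (by linarith)
    -- For `c_cp = 0` the constant `√(-μ)` is a profile in the uniqueness ball, so the family member
    -- must be it.
    obtain ⟨e1, e2, e3⟩ := h1 (Real.sqrt (-P.mu) • (1 : BoundedContinuousFunction ℝ ℂ)) (s0 P)
      (Omega0 P) (by
        rw [← sub_smul, norm_smul, norm_one, mul_one]; exact h3) h4 h5 (isProfile_explicit h2 hc)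
    refine ⟨e2.symm, e3.symm, ?_, ?_⟩
    · ext ξ
      change polarAngle (position (z P) ξ) = theta0 P ξ
      rw [← e1, position_const hρ]
      rfl
    · ext ξ
      change azimuth (z P) (position (z P) ξ) = phi0 ξ
      rw [← e1, azimuth_const]
      rfl
  · refine Metric.tendstoUniformly_iff.2 fun η hη => ?_
    have h1 : Tendsto (fun P => (12 / r + 1) *
        ‖z P - r • (1 : BoundedContinuousFunction ℝ ℂ)‖) (𝓝 P₀) (𝓝 0) := by
      simpa using hznorm.const_mul (12 / r + 1)
    filter_upwards [hUo.mem_nhds hP₀U, h1.eventually_lt_const hη] with P hP h2 ξ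
    rw [dist_comm]
    exact (hdist P hP ξ).trans_lt h2
  · intro P hP
    obtain ⟨-, -, -, ⟨-, h1⟩, ⟨h2, h3⟩, -, -⟩ := hU P hP
    refine ⟨h2, h3, fun ξ => (hdist P hP ξ).trans_lt ?_⟩
    rwa [lt_div_iff₀ hK, mul_comm] at h1
  · intro P hP s' Ω' θ' φ' hs' hΩ' hdw horb
    have horb' : ∀ ξ, |deriv θ' ξ / Real.sin (θ' ξ) - r| < δ ∧ |deriv φ' ξ| < δ := by
      intro ξ
      obtain ⟨τ, hτ⟩ := horb ξ
      rw [phase_theta0, phase, Prod.dist_eq, Prod.dist_eq] at hτ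
      have h1 := (le_max_right _ _).trans_lt hτ
      refine ⟨(le_max_left _ _).trans_lt h1, ?_⟩
      have h2 := (le_max_right _ _).trans_lt h1
      simpa [Real.dist_eq, wavenumber] using h2
    obtain ⟨z', v, hz', hprof, hθ', hv, hφ'⟩ := exists_isProfile_of_isDomainWall hδr hr hdw
      (fun ξ => (horb' ξ).1) (fun ξ => (horb' ξ).2)
    obtain ⟨e1, e2, e3⟩ := (hU P hP).2.2.1 z' s' Ω' (hz'.trans_lt hδε) (by linarith)
      (by linarith) hprof
    subst e1
    -- The translation is the value of `ξ` at which the family member passes through `v 0`; the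
    -- rotation matches the azimuths at `ξ = 0`.
    refine ⟨e2, e3, travel (z P) (v 0), φ' 0 - wallPhi (z P) (travel (z P) (v 0)), fun ξ => ?_⟩
    have hpos := eq_position_of_hasDerivAt hr (hnear P hP) hv
    refine ⟨by rw [hθ', hpos ξ]; rfl, ?_⟩
    have hd : ∀ ξ, HasDerivAt (fun ξ => φ' ξ - wallPhi (z P) (ξ + travel (z P) (v 0))) 0 ξ := by
      intro ξ
      have h1 : HasDerivAt (fun ξ => wallPhi (z P) (ξ + travel (z P) (v 0))) (z P (v ξ)).im ξ := by
        have h2 := hasDerivAt_azimuth_position hr (hnear P hP) (ξ + travel (z P) (v 0))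
        rw [← hpos ξ] at h2
        exact h2.comp_add_const ξ (travel (z P) (v 0))
      have h3 := (hφ' ξ).sub h1
      rwa [sub_self] at h3
    have hconst := is_const_of_deriv_eq_zero (fun ξ => (hd ξ).differentiableAt)
      (fun ξ => (hd ξ).deriv) ξ 0
    simp only [zero_add] at hconst
    linarith
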